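/- **Corollary 3.2.** For a permutation group $H$ of a finite set, let $O_k(H)$ denote the number of orbits of $H$ on the $k$-element subsets of that set; $H$ is called $k$-homogeneous if $O_k(H)=1$, and $k$-transitive if it has a single orbit on ordered $k$-tuples of distinct points. Let $n\ge 8$, and let $D$ be an integer with $3\le D<\lfloor n/2\rfloor$ such that, for each $m\in\{n-2,n-1,n\}$, the only $D$-transitive subgroups of $S_m$ are $A_m$ and $S_m$; if $D\le 4$, suppose also that for each such $m$ the only $D$-homogeneous subgroups of $S_m$ are $A_m$ and $S_m$. Let $H\le S_n$ satisfy $$O_2(H)=O_3(H)=\dots=O_D(H).$$ 1. If $H$ has exactly one fixed point $x$ in $\{1,\dots,n\}$, then $H$ is $A_{n-1}$ or $S_{n-1}$, that is, $H=\mathrm{Alt}(\{1,\dots,n\}\setminus\{x\})$ or $H=\mathrm{Sym}(\{1,\dots,n\}\setminus\{x\})$. 2. If $H$ stabilizes (setwise) a $2$-element set $B\subset\{1,\dots,n\}$, then, with $U=\{1,\dots,n\}\setminus B$, the group $H$ is one of the following subgroups of $\mathrm{Sym}(B)\times\mathrm{Sym}(U)\le S_n$: $A_{n-2}=\mathrm{Alt}(U)$;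 $S_{n-2}=\mathrm{Sym}(U)$ (both fixing $B$ pointwise); $S_2\times S_{n-2}=\mathrm{Sym}(B)\times \mathrm{Sym}(U)$; $S_2\times_{C_2}S_{n-2}=\{(g_1,g_2)\in \mathrm{Sym}(B)\times \mathrm{Sym}(U):\operatorname{sgn} g_1=\operatorname{sgn} g_2\}$; $S_2\times A_{n-2}=\mathrm{Sym}(B)\times \mathrm{Alt}(U)$. -/

import Mathlib

namespace OrbitCorollary

open Equiv

/-- `O_k(H)`: the number of orbits of a permutation group `H` of the finite set `α` on the
`k`-element subsets of `α`. -/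
noncomputable def numOrbits {α : Type*} [DecidableEq α] (H : Subgroup (Perm α)) (k : ℕ) : ℕ :=
  Nat.card (MulAction.orbitRel.Quotient H (Set.powersetCard α k))

/-- `D` is an admissible transitivity bound for degree `n`: `3 ≤ D < ⌊n / 2⌋`, and the only
`D`-transitive groups of degree `n - 2`, `n - 1` or `n` are the alternating and symmetric groups;
if `D ≤ 4`, this is required for `D`-homogeneous groups as well (when `5 ≤ D` a `D`-homogeneous
group of such a degree is automatically `D`-transitive). -/
structure IsTransitivityBound (n D : ℕ) : Prop where
  three_le : 3 ≤ D
  lt_half : D < n / 2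
  transitive : ∀ m : ℕ, n - 2 ≤ m → m ≤ n → ∀ K : Subgroup (Perm (Fin m)),
    MulAction.IsMultiplyPretransitive K (Fin m) D → K = alternatingGroup (Fin m) ∨ K = ⊤
  homogeneous : D ≤ 4 → ∀ m : ℕ, n - 2 ≤ m → m ≤ n → ∀ K : Subgroup (Perm (Fin m)),
    numOrbits K D = 1 → K = alternatingGroup (Fin m) ∨ K = ⊤

section Embedded

variable {α : Type*} [Fintype α] [DecidableEq α]

/-- A subgroup of `Sym(B) × Sym(α \ B)`, seen as a group of permutations of `α`. -/
def embed (B : Finset α) (K : Subgroup (Perm {a // a ∈ B} × Perm {a // a ∉ B})) :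
    Subgroup (Perm α) :=
  K.map (Perm.subtypeCongrHom (fun a => a ∈ B))

/-- `Alt(α \ B)`, fixing `B` pointwise. -/
def altCompl (B : Finset α) : Subgroup (Perm α) :=
  embed B ((⊥ : Subgroup _).prod (alternatingGroup {a // a ∉ B}))

/-- `Sym(α \ B)`, fixing `B` pointwise. -/
def symCompl (B : Finset α) : Subgroup (Perm α) :=
  embed B ((⊥ : Subgroup _).prod ⊤)

/-- `Sym(B) × Sym(α \ B)`. -/
def symProdSym (B : Finset α) : Subgroup (Perm α) :=
  embed B ((⊤ : Subgroup _).prod ⊤)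

/-- `Sym(B) × Alt(α \ B)`. -/
def symProdAlt (B : Finset α) : Subgroup (Perm α) :=
  embed B ((⊤ : Subgroup _).prod (alternatingGroup {a // a ∉ B}))

/-- The fiber product of `Sym(B)` and `Sym(α \ B)` over `{1, -1}`, with respect to the two sign
homomorphisms: the pairs `(g₁, g₂)` with `sign g₁ = sign g₂`. -/
def symFiberSym (B : Finset α) : Subgroup (Perm α) :=
  embed B (((Perm.sign : Perm {a // a ∈ B} →* ℤˣ).comp (MonoidHom.fst _ _)).eqLocus
    ((Perm.sign : Perm {a // a ∉ B} →* ℤˣ).comp (MonoidHom.snd _ _)))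

end Embedded

end OrbitCorollary

/-!
Let `B` be the invariant set with one or two points. The orbits of `H` on the `k`-sets split
according to the size of the intersection of the `k`-set with `B`: the number of orbits on `k`-sets
is a sum of numbers `orbs H (layer B j (k - j))`, `j ≤ #B`. Each of these is
non-decreasing in `k` (`orbs_layer_le_succ`), because the inclusion matrix of `k`-sets against
`(k + 1)`-sets of the complement of `B` has full rank. If the total is constant for
`2 ≤ k ≤ D`, every summand is constant, and looking at points and pairs shows that the constant for
`j = 0` is `1` (`orbs_layer_zero_le_one_of_card_eq_one`, `orbs_layer_zero_le_one_of_card_eq_two`).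
So the group induced by `H` off `B` is `k`-homogeneous for all `k ≤ D`.

By the assumption on `D` this group contains the alternating group: directly when `D ≤ 4`, and when
`5 ≤ D` because it is then `D`-transitive by the theorem of Livingstone and Wagner
(`isMultTransitive_of_isHomogeneous`). Fourth powers of elements of `H` that induce a 3-cycle off `B`
are that 3-cycle and fix `B`, so `H` contains the alternating group of the complement of `B`
(`bot_prod_alternatingGroup_le`) and is determined by the pairs of signs of its elements on `B` and
off `B` (`classification_of_card_le_two`).

Most of the file proves the theorem of Livingstone and Wagner in the following form: if `5 ≤ k`,
`2 * k ≤ n` and `G` is `i`-homogeneous for all `i ≤ k`, then `G` is `k`-transitive. The recurring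
device is a 2-subgroup `Q` that has maximal order among those with at least `i` fixed points. By
Sylow's theorem the group induced by the normalizer of `Q` on the fixed points of `Q` (`reduced G Q`)
inherits homogeneity and transitivity, and carries them back to `G`; moreover it contains no
involution with at least `i` fixed points (`IsMaxTwoSubgroup.noInvolutionFixing`). In a group without
such involutions, the product of two involutions that agree on enough points has odd order, so a
partial map commuting with an involution extends to an element of its centralizer
(`NoInvolutionFixing.lift`), and transpositions of small sets can be produced from involutions.

* If `Q` is not maximal for `k` points although it is for `k + 1`, every `k`-set of fixed points of
  `Q` is fixed pointwise by an involution of `reduced G Q`, and `G` is `(k + 1)`-transitive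
  (`isMultTransitive_or_isMaxTwoSubgroup`).
* Otherwise a `(k - 1)`-transitive and `k`-homogeneous group, `5 ≤ k`, induces at least the
  alternating group on each `k`-set (`index_induced_le_two_of_noInvolutionFixing`), and a group that
  induces precisely the alternating group is excluded by signs and, for `k = 5`, by a four-group
  acting on a group of odd order (`isMultTransitive_of_index_le_two`).
* Transitivity up to degree four comes from counting how the points outside a set are linked by its
  pointwise stabilizer (`linkCount_mul`), with degree 24 as an exceptional case that needs a separate
  argument (`isMultTransitive_four_of_card_fixed_eq_two`).
-/

namespace LivingstoneWagner

set_option linter.unusedSectionVars false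

open Finset Equiv

/-! ### Monotonicity of orbit counts -/

section

variable {α : Type*} [DecidableEq α]

/-- Each `k`-subset of `T` is omitted by exactly `#T - k` of the sets `T.erase x`. -/
theorem sum_sum_powersetCard_erase (g : Finset α → ℚ) (T : Finset α) (k : ℕ) :
    ∑ x ∈ T, ∑ S ∈ powersetCard k (T.erase x), g S =
      ((#T : ℚ) - k) * ∑ S ∈ powersetCard k T, g S := by
  rw [Finset.sum_comm' (t' := powersetCard k T) (s' := fun S => T \ S), Finset.mul_sum]
  · refine Finset.sum_congr rfl fun S hS => ?_
    rw [mem_powersetCard] at hS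
    rw [Finset.sum_const, nsmul_eq_mul, card_sdiff_of_subset hS.1, Nat.cast_sub (card_le_card hS.1),
      hS.2]
  · intro x S
    simp only [mem_powersetCard, mem_sdiff, subset_erase]
    tauto

theorem sum_powersetCard_eq_zero (g : Finset α → ℚ) (V : Finset α) (k : ℕ)
    (h : ∀ T ⊆ V, #T = k + 1 → ∑ x ∈ T, g (T.erase x) = 0) (T : Finset α) (hT : T ⊆ V)
    (hk : k + 1 ≤ #T) : ∑ S ∈ powersetCard k T, g S = 0 := by
  obtain ⟨m, hm⟩ := Nat.exists_eq_add_of_le hk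
  induction m generalizing T with
  | zero =>
    have h1 := sum_sum_powersetCard_erase g T k
    have h2 : ∑ x ∈ T, ∑ S ∈ powersetCard k (T.erase x), g S = ∑ x ∈ T, g (T.erase x) := by
      refine Finset.sum_congr rfl fun x hx => ?_
      have hc : k = #(T.erase x) := by rw [card_erase_of_mem hx]; omega
      nth_rw 1 [hc]
      rw [powersetCard_self, sum_singleton]
    rw [h2, h T hT hm, hm] at h1
    push_cast at h1
    linarith
  | succ m ih =>
    have h1 := sum_sum_powersetCard_erase g T k
    rw [Finset.sum_eq_zero] at h1
    · rcases mul_eq_zero.1 h1.symm with h2 | h2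
      · rw [hm] at h2
        push_cast at h2
        linarith
      · exact h2
    · intro x hx
      refine ih _ ((erase_subset _ _).trans hT) ?_ ?_ <;> rw [card_erase_of_mem hx] <;> omega

/-- The inclusion matrix of `k`-subsets against `(k+1)`-subsets of a set with at least `2k+1`
elements has trivial kernel. By averaging, the sum of `g` over the `k`-subsets of any larger set
vanishes, hence so does its sum over the `k`-sets disjoint from a set with at most `k` elements,
and inclusion-exclusion isolates a single `k`-set. -/
theorem eq_zero_of_sum_erase_eq_zero (g : Finset α → ℚ) (V : Finset α) (k : ℕ)
    (hV : 2 * k + 1 ≤ #V) (h : ∀ T ⊆ V, #T = k + 1 → ∑ x ∈ T, g (T.erase x) = 0)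
    (S : Finset α) (hS : S ⊆ V) (hk : #S = k) : g S = 0 := by
  have key : ∀ A D : Finset α, A ⊆ V → D ⊆ V → #A + #D ≤ k →
      ∑ S ∈ powersetCard k V with A ⊆ S ∧ Disjoint S D, g S = 0 := by
    intro A
    induction A using Finset.induction_on with
    | empty =>
      intro D _ hD hc
      have : {S ∈ powersetCard k V | ∅ ⊆ S ∧ Disjoint S D} = powersetCard k (V \ D) := by
        ext S
        simp only [mem_filter, mem_powersetCard, empty_subset, true_and, subset_sdiff]
        tauto
      rw [this]
      refine sum_powersetCard_eq_zero g V k h _ sdiff_subset ?_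
      rw [card_sdiff_of_subset hD]
      simp at hc
      omega
    | insert a A ha ih =>
      intro D hA hD hc
      rw [card_insert_of_notMem ha] at hc
      have hAV : A ⊆ V := (subset_insert _ _).trans hA
      have h1 := ih D hAV hD (by omega)
      have h2 := ih (insert a D) hAV (insert_subset (hA (mem_insert_self _ _)) hD)
        (by have := card_insert_le a D; omega)
      rw [← Finset.sum_filter_add_sum_filter_not _ (fun S => a ∈ S), filter_filter,
        filter_filter] at h1
      have e1 : {S ∈ powersetCard k V | insert a A ⊆ S ∧ Disjoint S D} =
          {S ∈ powersetCard k V | (A ⊆ S ∧ Disjoint S D) ∧ a ∈ S} := by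
        ext S; simp only [mem_filter, insert_subset_iff]; tauto
      have e2 : {S ∈ powersetCard k V | A ⊆ S ∧ Disjoint S (insert a D)} =
          {S ∈ powersetCard k V | (A ⊆ S ∧ Disjoint S D) ∧ a ∉ S} := by
        ext S; simp only [mem_filter, disjoint_insert_right]; tauto
      rw [e1]
      rw [e2] at h2
      linarith
  have h0 := key S ∅ hS (empty_subset _) (by simp [hk])
  rw [Finset.sum_eq_single S] at h0
  · exact h0
  · intro T hT hne
    simp only [mem_filter, mem_powersetCard] at hT
    exact absurd (eq_of_subset_of_card_le hT.2.1 (by omega)).symm hne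
  · intro hn
    simp [hS, hk] at hn

/-- The orbit of the finite set `S` under `H`. -/
def cls (H : Subgroup (Perm α)) (S : Finset α) : Set (Finset α) :=
  {T | ∃ h ∈ H, S.image h = T}

theorem cls_eq_iff (H : Subgroup (Perm α)) (S T : Finset α) :
    cls H S = cls H T ↔ ∃ h ∈ H, S.image h = T := by
  constructor
  · intro h
    have : T ∈ cls H T := ⟨1, H.one_mem, by simp⟩
    rw [← h] at this
    exact this
  · rintro ⟨h, hh, rfl⟩
    ext R
    constructor
    · rintro ⟨g, hg, rfl⟩
      refine ⟨g * h⁻¹, H.mul_mem hg (H.inv_mem hh), ?_⟩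
      rw [image_image]
      congr 1
      ext x; simp
    · rintro ⟨g, hg, rfl⟩
      exact ⟨g * h, H.mul_mem hg hh, by rw [image_image]; rfl⟩

/-- The number of `H`-orbits that meet the family `F` of finite sets. -/
noncomputable def orbs (H : Subgroup (Perm α)) (F : Set (Finset α)) : ℕ :=
  (cls H '' F).ncard

/-- The sets with `j` elements in `B` and `k` elements outside `B`. -/
def layer (B : Finset α) (j k : ℕ) : Set (Finset α) := {S | #(S ∩ B) = j ∧ #(S \ B) = k}

variable [Fintype α]

theorem numOrbits_eq_orbs (H : Subgroup (Perm α)) (k : ℕ) :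
    OrbitCorollary.numOrbits H k = orbs H {S | #S = k} := by
  have hrel : ∀ S T : Set.powersetCard α k,
      (MulAction.orbitRel H (Set.powersetCard α k)) S T ↔ cls H (S : Finset α) = cls H T := by
    intro S T
    rw [MulAction.orbitRel_apply, MulAction.mem_orbit_iff, eq_comm, cls_eq_iff]
    constructor
    · rintro ⟨h, hh⟩
      exact ⟨h, h.2, by rw [← hh]; rfl⟩
    · rintro ⟨h, hh, e⟩
      refine ⟨⟨h, hh⟩, Subtype.ext ?_⟩
      exact e
  unfold OrbitCorollary.numOrbits orbs
  rw [← Nat.card_coe_set_eq]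
  refine Nat.card_congr (Equiv.ofBijective (fun q => Quotient.liftOn q
    (fun S : Set.powersetCard α k => (⟨cls H (S : Finset α), ⟨S, S.2, rfl⟩⟩ :
      cls H '' {S : Finset α | #S = k}))
    (fun S T h => Subtype.ext ((hrel S T).1 h))) ⟨?_, ?_⟩)
  · intro p q
    induction p using Quotient.inductionOn
    induction q using Quotient.inductionOn
    intro h
    exact Quotient.sound ((hrel _ _).2 (congrArg Subtype.val h))
  · rintro ⟨_, ⟨S, hS, rfl⟩⟩
    exact ⟨Quotient.mk _ ⟨S, hS⟩, rfl⟩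

/-- The Livingstone-Wagner inequality, relative to an invariant set `B`: summation over the points
outside `B` maps invariant functions on one layer injectively to invariant functions on the
next. -/
theorem orbs_layer_le_succ (H : Subgroup (Perm α)) (B : Finset α)
    (hB : ∀ h ∈ H, ∀ b, h b ∈ B ↔ b ∈ B) (j k : ℕ) (hk : 2 * k + 1 ≤ #Bᶜ) :
    orbs H (layer B j k) ≤ orbs H (layer B j (k + 1)) := by
  classical
  set X := cls H '' layer B j k with hX
  set Y := cls H '' layer B j (k + 1) with hY
  have hrep : ∀ y : Y, ∃ T ∈ layer B j (k + 1), cls H T = y := fun y => y.2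
  choose rep hrep1 hrep2 using hrep
  let ext : (X → ℚ) → Finset α → ℚ := fun φ S => if h : cls H S ∈ X then φ ⟨_, h⟩ else 0
  have hadd : ∀ φ ψ S, ext (φ + ψ) S = ext φ S + ext ψ S := by
    intro φ ψ S; simp only [ext]; split_ifs <;> simp
  have hsmul : ∀ (c : ℚ) φ S, ext (c • φ) S = c * ext φ S := by
    intro c φ S; simp only [ext]; split_ifs <;> simp
  have hinv : ∀ φ S, ∀ h ∈ H, ext φ (S.image h) = ext φ S := by
    intro φ S h hh
    have : cls H (S.image h) = cls H S := ((cls_eq_iff H _ _).2 ⟨h, hh, rfl⟩).symm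
    simp only [ext, this]
  let L : (X → ℚ) →ₗ[ℚ] (Y → ℚ) :=
    { toFun := fun φ y => ∑ x ∈ rep y \ B, ext φ ((rep y).erase x)
      map_add' := fun φ ψ => by
        funext y; simp only [hadd, sum_add_distrib, Pi.add_apply]
      map_smul' := fun c φ => by
        funext y; simp only [hsmul, ← mul_sum, Pi.smul_apply, smul_eq_mul, RingHom.id_apply] }
  have hL : Function.Injective L := by
    rw [← LinearMap.ker_eq_bot, LinearMap.ker_eq_bot']
    intro φ hφ
    have hall : ∀ T ∈ layer B j (k + 1), ∑ x ∈ T \ B, ext φ (T.erase x) = 0 := by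
      intro T hT
      have hTY : cls H T ∈ Y := ⟨T, hT, rfl⟩
      obtain ⟨h, hh, e⟩ := (cls_eq_iff H _ _).1 (hrep2 ⟨_, hTY⟩)
      have h0 : ∑ x ∈ rep ⟨_, hTY⟩ \ B, ext φ ((rep ⟨_, hTY⟩).erase x) = 0 :=
        congrFun hφ ⟨_, hTY⟩
      rw [← h0]
      symm
      refine Finset.sum_bij (fun x _ => h x) ?_ (fun x _ y _ hxy => h.injective hxy) ?_ ?_
      · intro x hx
        rw [mem_sdiff] at hx ⊢
        rw [hB h hh, ← e]
        exact ⟨mem_image_of_mem _ hx.1, hx.2⟩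
      · intro y hy
        rw [mem_sdiff, ← e, mem_image] at hy
        obtain ⟨⟨x, hx, rfl⟩, hy⟩ := hy
        exact ⟨x, mem_sdiff.2 ⟨hx, by rwa [hB h hh] at hy⟩, rfl⟩
      · intro x hx
        rw [← hinv φ _ h hh, image_erase h.injective, e]
    funext ⟨x, S, hS, hx⟩
    subst hx
    have hzero := eq_zero_of_sum_erase_eq_zero (fun R => ext φ ((S ∩ B) ∪ R)) Bᶜ k hk ?_
      (S \ B) (fun x hx => by simp at hx ⊢; exact hx.2) hS.2
    · have hS' : cls H S ∈ X := ⟨S, hS, rfl⟩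
      rw [union_comm, sdiff_union_inter] at hzero
      simp only [ext] at hzero
      rw [dif_pos hS'] at hzero
      exact hzero
    · intro T hT hcard
      have hTB : ∀ x ∈ T, x ∉ B := fun x hx => by simpa using hT hx
      have e1 : ((S ∩ B) ∪ T) ∩ B = S ∩ B := by
        ext x; simp only [mem_inter, mem_union]; have := hTB x; tauto
      have e2 : ((S ∩ B) ∪ T) \ B = T := by
        ext x; simp only [mem_sdiff, mem_union, mem_inter]; have := hTB x; tauto
      rw [← hall ((S ∩ B) ∪ T) ⟨by rw [e1]; exact hS.1, by rw [e2]; exact hcard⟩, e2]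
      refine Finset.sum_congr rfl fun x hx => ?_
      congr 1
      ext y
      simp only [mem_union, mem_erase, mem_inter]
      have := hTB x hx
      constructor
      · rintro (h | h)
        · exact ⟨fun e => this (e ▸ h.2), Or.inl h⟩
        · exact ⟨h.1, Or.inr h.2⟩
      · tauto
  have hfin := LinearMap.finrank_le_finrank_of_injective hL
  rw [Module.finrank_fintype_fun_eq_card, Module.finrank_fintype_fun_eq_card,
    ← Nat.card_eq_fintype_card, ← Nat.card_eq_fintype_card] at hfin
  exact hfin

end

/-! ### Homogeneous and transitive groups -/

section

variable {α : Type*} [DecidableEq α]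

theorem inv_apply_self' (g : Perm α) (x : α) : g⁻¹ (g x) = x := by simp

/-- `G` is `k`-homogeneous: any `k`-set can be moved onto any other. -/
def IsHomogeneous (G : Subgroup (Perm α)) (k : ℕ) : Prop :=
  ∀ S T : Finset α, #S = k → #T = k → ∃ g ∈ G, ∀ x ∈ S, g x ∈ T

/-- `G` is `i`-transitive for all `i ≤ k`, phrased without tuples: on a set with at most `k`
elements, every permutation of `α` agrees with some element of `G`. -/
def IsMultTransitive (G : Subgroup (Perm α)) (k : ℕ) : Prop :=
  ∀ (σ : Perm α) (S : Finset α), #S ≤ k → ∃ g ∈ G, ∀ x ∈ S, g x = σ x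

/-- The only element of `G` with square `1` that fixes at least `m` points is `1`. -/
def NoInvolutionFixing (G : Subgroup (Perm α)) (m : ℕ) : Prop :=
  ∀ g ∈ G, g * g = 1 → ∀ S : Finset α, m ≤ #S → (∀ x ∈ S, g x = x) → g = 1

/-- The pointwise stabilizer of `S` in `G`. -/
def fixer (G : Subgroup (Perm α)) (S : Finset α) : Subgroup (Perm α) where
  carrier := {g | g ∈ G ∧ ∀ x ∈ S, g x = x}
  mul_mem' := fun {a b} ha hb => ⟨G.mul_mem ha.1 hb.1, fun x hx => by
    rw [Perm.mul_apply, hb.2 x hx, ha.2 x hx]⟩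
  one_mem' := ⟨G.one_mem, fun _ _ => rfl⟩
  inv_mem' := fun {a} ha => ⟨G.inv_mem ha.1, fun x hx => by
    rw [Perm.inv_eq_iff_eq, ha.2 x hx]⟩

/-- The group of permutations of `S` induced by elements of `G`. -/
def induced (G : Subgroup (Perm α)) (S : Finset α) : Subgroup (Perm S) where
  carrier := {σ | ∃ g ∈ G, ∀ x : S, g x = σ x}
  mul_mem' := by
    rintro a b ⟨g, hg, hga⟩ ⟨h, hh, hhb⟩
    exact ⟨g * h, G.mul_mem hg hh, fun x => by rw [Perm.mul_apply, hhb, hga]; rfl⟩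
  one_mem' := ⟨1, G.one_mem, fun _ => rfl⟩
  inv_mem' := by
    rintro a ⟨g, hg, hga⟩
    exact ⟨g⁻¹, G.inv_mem hg, fun x => by
      rw [Perm.inv_eq_iff_eq, hga, ← Perm.mul_apply, mul_inv_cancel, Perm.one_apply]⟩

/-- Some element of `G` fixes `Γ` pointwise and maps `u` to `w`. -/
def Linked (G : Subgroup (Perm α)) (Γ : Finset α) (u w : α) : Prop :=
  ∃ g ∈ G, (∀ x ∈ Γ, g x = x) ∧ g u = w

/-- Some element of `G` acts on `S` as the transposition of `a` and `b`. -/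
def Swappable (G : Subgroup (Perm α)) (S : Finset α) (a b : α) : Prop :=
  ∃ g ∈ G, ∀ x ∈ S, g x = swap a b x

theorem mem_fixer {G : Subgroup (Perm α)} {S : Finset α} {g : Perm α} :
    g ∈ fixer G S ↔ g ∈ G ∧ ∀ x ∈ S, g x = x := Iff.rfl

theorem mem_induced {G : Subgroup (Perm α)} {S : Finset α} {σ : Perm S} :
    σ ∈ induced G S ↔ ∃ g ∈ G, ∀ x : S, g x = σ x := Iff.rfl

theorem fixer_anti (G : Subgroup (Perm α)) {S T : Finset α} (h : S ⊆ T) :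
    fixer G T ≤ fixer G S := fun _ hg => ⟨hg.1, fun x hx => hg.2 x (h hx)⟩

theorem fixer_le (G : Subgroup (Perm α)) (S : Finset α) : fixer G S ≤ G := fun _ hg => hg.1

theorem IsMultTransitive.mono {G : Subgroup (Perm α)} {k k' : ℕ}
    (h : IsMultTransitive G k) (hk : k' ≤ k) : IsMultTransitive G k' :=
  fun σ S hS => h σ S (hS.trans hk)

theorem Linked.symm {G : Subgroup (Perm α)} {Γ : Finset α} {u w : α} (h : Linked G Γ u w) :
    Linked G Γ w u := by
  obtain ⟨g, hg, h1, rfl⟩ := h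
  exact ⟨g⁻¹, G.inv_mem hg, fun x hx => by rw [Perm.inv_eq_iff_eq, h1 x hx], by simp⟩

theorem Linked.refl (G : Subgroup (Perm α)) (Γ : Finset α) (u : α) : Linked G Γ u u :=
  ⟨1, G.one_mem, fun _ _ => rfl, rfl⟩

/-- Transport of a link along an element of `G`. -/
theorem Linked.map {G : Subgroup (Perm α)} {Γ : Finset α} {u w : α} (h : Linked G Γ u w)
    {g : Perm α} (hg : g ∈ G) : Linked G (Γ.image g) (g u) (g w) := by
  obtain ⟨p, hp, h1, rfl⟩ := h
  refine ⟨g * p * g⁻¹, G.mul_mem (G.mul_mem hg hp) (G.inv_mem hg), fun x hx => ?_, by simp⟩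
  obtain ⟨z, hz, rfl⟩ := mem_image.1 hx
  simp [h1 z hz]

theorem Swappable.symm {G : Subgroup (Perm α)} {S : Finset α} {a b : α}
    (h : Swappable G S a b) : Swappable G S b a := by
  obtain ⟨g, hg, h1⟩ := h
  exact ⟨g, hg, fun x hx => by rw [h1 x hx, swap_comm]⟩

theorem Swappable.refl (G : Subgroup (Perm α)) (S : Finset α) (a : α) : Swappable G S a a :=
  ⟨1, G.one_mem, fun x _ => by simp⟩

theorem swap_mem_of_mem {S : Finset α} {a b x : α} (ha : a ∈ S) (hb : b ∈ S) (hx : x ∈ S) :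
    swap a b x ∈ S := by
  rw [swap_apply_def]; split_ifs <;> assumption

theorem swappable_iff_swap_mem_induced {G : Subgroup (Perm α)} {S : Finset α} {a b : α}
    (ha : a ∈ S) (hb : b ∈ S) :
    Swappable G S a b ↔ swap (⟨a, ha⟩ : S) ⟨b, hb⟩ ∈ induced G S := by
  have key : ∀ x : S, ((swap (⟨a, ha⟩ : S) ⟨b, hb⟩ x : S) : α) = swap a b x := by
    intro x
    simp only [swap_apply_def, Subtype.ext_iff]
    split_ifs <;> rfl
  constructor
  · rintro ⟨g, hg, h⟩
    exact ⟨g, hg, fun x => by rw [h x x.2, key]⟩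
  · rintro ⟨g, hg, h⟩
    exact ⟨g, hg, fun x hx => by rw [h ⟨x, hx⟩, key]⟩

theorem Swappable.trans {G : Subgroup (Perm α)} {S : Finset α} {a b c : α} (ha : a ∈ S)
    (hb : b ∈ S) (hc : c ∈ S) (h : Swappable G S a b) (h' : Swappable G S b c) :
    Swappable G S a c := by
  rw [swappable_iff_swap_mem_induced ‹_› ‹_›] at *
  exact SubmonoidClass.swap_mem_trans (α := S) _ h h'

/-- Transport of a transposition along an element of `G`. -/
theorem Swappable.map {G : Subgroup (Perm α)} {S : Finset α} {a b : α} (h : Swappable G S a b)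
    {g : Perm α} (hg : g ∈ G) : Swappable G (S.image g) (g a) (g b) := by
  obtain ⟨p, hp, h1⟩ := h
  refine ⟨g * p * g⁻¹, G.mul_mem (G.mul_mem hg hp) (G.inv_mem hg), fun x hx => ?_⟩
  obtain ⟨z, hz, rfl⟩ := mem_image.1 hx
  rw [Perm.mul_apply, Perm.mul_apply, inv_apply_self', h1 z hz]
  simp only [swap_apply_def, g.injective.eq_iff]
  split_ifs <;> rfl

theorem image_eq_of_forall_mem {S T : Finset α} {g : Perm α} (h : ∀ x ∈ S, g x ∈ T)
    (hc : #T ≤ #S) : S.image g = T :=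
  eq_of_subset_of_card_le (fun y hy => by
    obtain ⟨x, hx, rfl⟩ := mem_image.1 hy; exact h x hx)
    (by rwa [card_image_of_injective _ g.injective])

/-- Every injective assignment on a finite set is realised by a permutation. -/
theorem exists_perm_extend [Fintype α] (S : Finset α) (f : α → α) (hf : Set.InjOn f S) :
    ∃ σ : Perm α, ∀ x ∈ S, σ x = f x := by
  classical
  let e : {x // x ∈ S} ≃ {x // x ∈ S.image f} :=
    Equiv.ofBijective (fun x => ⟨f x, mem_image_of_mem f x.2⟩) ⟨fun x y h => Subtype.ext
      (hf x.2 y.2 (congrArg Subtype.val h)), fun ⟨y, hy⟩ => by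
        obtain ⟨x, hx, rfl⟩ := mem_image.1 hy
        exact ⟨⟨x, hx⟩, rfl⟩⟩
  refine ⟨e.extendSubtype, fun x hx => ?_⟩
  rw [Equiv.extendSubtype_apply_of_mem _ _ hx]
  rfl

theorem IsMultTransitive.exists_eq [Fintype α] {G : Subgroup (Perm α)} {k : ℕ}
    (h : IsMultTransitive G k) (S : Finset α) (f : α → α) (hS : #S ≤ k) (hf : Set.InjOn f S) :
    ∃ g ∈ G, ∀ x ∈ S, g x = f x := by
  obtain ⟨σ, hσ⟩ := exists_perm_extend S f hf
  obtain ⟨g, hg, h1⟩ := h σ S hS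
  exact ⟨g, hg, fun x hx => (h1 x hx).trans (hσ x hx)⟩

theorem exists_perm_map_eq [Fintype α] (l l' : List α) (hl : l.Nodup) (hl' : l'.Nodup)
    (h : l.length = l'.length) : ∃ σ : Perm α, l.map σ = l' := by
  classical
  obtain ⟨σ, hσ⟩ := exists_perm_extend l.toFinset (fun x => l'.getD (l.idxOf x) x) (by
    intro x hx y hy hxy
    simp only [List.coe_toFinset, Set.mem_ofPred_eq] at hx hy
    have h1 := List.idxOf_lt_length_of_mem hx
    have h2 := List.idxOf_lt_length_of_mem hy
    simp only at hxy
    rw [List.getD_eq_getElem _ _ (h ▸ h1), List.getD_eq_getElem _ _ (h ▸ h2),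
      hl'.getElem_inj_iff] at hxy
    exact (List.idxOf_inj hx).1 hxy)
  refine ⟨σ, List.ext_getElem (by simpa using h) fun i h1 h2 => ?_⟩
  have h3 : i < l.length := by simpa using h1
  rw [List.getElem_map, hσ _ (by simp), hl.idxOf_getElem, List.getD_eq_getElem _ _ h2]

theorem IsMultTransitive.exists_map_eq [Fintype α] {G : Subgroup (Perm α)} {k : ℕ}
    (h : IsMultTransitive G k) (l l' : List α) (hl : l.Nodup) (hl' : l'.Nodup)
    (hll : l.length = l'.length) (hk : l.length ≤ k) : ∃ g ∈ G, l.map g = l' := by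
  obtain ⟨σ, hσ⟩ := exists_perm_map_eq l l' hl hl' hll
  obtain ⟨g, hg, h1⟩ := h σ l.toFinset ((List.toFinset_card_le l).trans hk)
  refine ⟨g, hg, ?_⟩
  rw [← hσ]
  exact List.map_congr_left fun x hx => h1 x (by simpa using hx)

theorem exists_superset_card [Fintype α] (S : Finset α) {k : ℕ} (h : #S ≤ k)
    (hk : k ≤ Fintype.card α) : ∃ T : Finset α, S ⊆ T ∧ #T = k := by
  obtain ⟨T, h1, h2⟩ := Finset.exists_superset_card_eq h hk
  exact ⟨T, h1, h2⟩

theorem IsMultTransitive.isHomogeneous [Fintype α] {G : Subgroup (Perm α)} {k : ℕ}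
    (h : IsMultTransitive G k) : IsHomogeneous G k := by
  intro S T hS hT
  obtain ⟨σ, hσ⟩ := exists_perm_map_eq S.toList T.toList S.nodup_toList T.nodup_toList (by simp [hS, hT])
  obtain ⟨g, hg, h1⟩ := h σ S hS.le
  refine ⟨g, hg, fun x hx => ?_⟩
  rw [h1 x hx, ← Finset.mem_toList, ← hσ]
  exact List.mem_map_of_mem (by simpa using hx)

/-- A `k`-homogeneous group that induces the full symmetric group on one `k`-set is
`k`-transitive. -/
theorem IsHomogeneous.isMultTransitive [Fintype α] {G : Subgroup (Perm α)} {k : ℕ}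
    (h : IsHomogeneous G k) (hk : k ≤ Fintype.card α) (S₀ : Finset α) (hS₀ : #S₀ = k)
    (htop : induced G S₀ = ⊤) : IsMultTransitive G k := by
  intro σ R hR
  obtain ⟨S, hRS, hS⟩ := exists_superset_card R hR hk
  obtain ⟨a, ha, h1⟩ := h S₀ S hS₀ hS
  obtain ⟨b, hb, h2⟩ := h (S.image σ) S₀ (by rw [card_image_of_injective _ σ.injective, hS]) hS₀
  -- `b ∘ σ ∘ a` permutes `S₀`
  have hmem : ∀ x : S₀, (b * σ * a) x ∈ S₀ := fun x =>
    h2 _ (mem_image_of_mem _ (h1 x x.2))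
  let τ : Perm S₀ := Equiv.ofBijective (fun x => ⟨(b * σ * a) x, hmem x⟩)
    (Finite.injective_iff_bijective.1 fun x y hxy =>
      Subtype.ext ((b * σ * a).injective (congrArg Subtype.val hxy)))
  have hτ : τ ∈ induced G S₀ := by rw [htop]; trivial
  obtain ⟨g, hg, h3⟩ := hτ
  refine ⟨b⁻¹ * g * a⁻¹, G.mul_mem (G.mul_mem (G.inv_mem hb) hg) (G.inv_mem ha),
    fun x hx => ?_⟩
  have hx' : x ∈ S₀.image a := by rw [image_eq_of_forall_mem h1 (by omega)]; exact hRS hx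
  obtain ⟨z, hz, rfl⟩ := mem_image.1 hx'
  rw [Perm.mul_apply, Perm.mul_apply, inv_apply_self', h3 ⟨z, hz⟩, Perm.inv_eq_iff_eq]
  rfl

theorem induced_eq_top_of_swappable {G : Subgroup (Perm α)} {S : Finset α}
    (h : ∀ a ∈ S, ∀ b ∈ S, a ≠ b → Swappable G S a b) : induced G S = ⊤ := by
  rw [eq_top_iff, ← Perm.closure_isSwap, Subgroup.closure_le]
  rintro _ ⟨x, y, hxy, rfl⟩
  exact (swappable_iff_swap_mem_induced x.2 y.2).1
    (h x x.2 y y.2 fun e => hxy (Subtype.ext e))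

theorem IsHomogeneous.isMultTransitive_of_swappable [Fintype α] {G : Subgroup (Perm α)} {k : ℕ}
    (h : IsHomogeneous G k) (hk : k ≤ Fintype.card α)
    (hsw : ∀ S : Finset α, #S = k → ∀ a ∈ S, ∀ b ∈ S, a ≠ b → Swappable G S a b) :
    IsMultTransitive G k := by
  obtain ⟨S, -, hS⟩ := exists_superset_card (∅ : Finset α) (by simp) hk
  exact h.isMultTransitive hk S hS (induced_eq_top_of_swappable (hsw S hS))

/-! ### Involutions with many fixed points -/

section Involutions

variable [Finite α]

theorem pow_apply_eq_self {g : Perm α} {x : α} (h : g x = x) (n : ℕ) : (g ^ n) x = x := by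
  induction n with
  | zero => rfl
  | succ n ih => rw [pow_succ, Perm.mul_apply, h, ih]

theorem NoInvolutionFixing.odd_orderOf {G : Subgroup (Perm α)} {m : ℕ}
    (h : NoInvolutionFixing G m) {c : Perm α} (hc : c ∈ G) (S : Finset α) (hS : m ≤ #S)
    (hfix : ∀ x ∈ S, c x = x) : Odd (orderOf c) := by
  by_contra hodd
  rw [Nat.not_odd_iff_even] at hodd
  obtain ⟨d, hd⟩ := hodd
  have hpos : 0 < orderOf c := orderOf_pos c
  have h1 := h (c ^ d) (G.pow_mem hc d) (by rw [← pow_add, ← hd, pow_orderOf_eq_one]) S hS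
    fun x hx => pow_apply_eq_self (hfix x hx) d
  have := Nat.le_of_dvd (by omega) (orderOf_dvd_of_pow_eq_one h1)
  omega

/-- If `g ^ 2` fixes at least `m` points, an odd power of `g` is an involution; it agrees with `g`
on the points fixed by `g ^ 2`. -/
theorem NoInvolutionFixing.exists_involution {G : Subgroup (Perm α)} {m : ℕ}
    (h : NoInvolutionFixing G m) {g : Perm α} (hg : g ∈ G) (S : Finset α) (hS : m ≤ #S)
    (hfix : ∀ x ∈ S, g (g x) = x) :
    ∃ y ∈ G, y * y = 1 ∧ ∀ x, g (g x) = x → y x = g x := by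
  obtain ⟨l, hl⟩ := h.odd_orderOf (G.mul_mem hg hg) S hS hfix
  refine ⟨g ^ (2 * l + 1), G.pow_mem hg _, ?_, fun x hx => ?_⟩
  · rw [← (Commute.refl g).mul_pow, ← hl, pow_orderOf_eq_one]
  · rw [pow_succ', Perm.mul_apply, pow_mul, pow_two, pow_apply_eq_self hx]

/-- The rigidity of involutions: if `g` intertwines the involutions `y` and `y'` on a set with at
least `m` points, then it can be corrected outside that set so as to intertwine them everywhere.
The product of `y'` and `g y g⁻¹` has odd order, so these generate a dihedral group in which they
are conjugate. -/
theorem NoInvolutionFixing.lift {G : Subgroup (Perm α)} {m : ℕ}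
    (h : NoInvolutionFixing G m) {y y' g : Perm α} (hy : y ∈ G) (hy2 : y * y = 1)
    (hy' : y' ∈ G) (hy'2 : y' * y' = 1) (hg : g ∈ G) (S : Finset α) (hS : m ≤ #S)
    (hgS : ∀ x ∈ S, g (y x) = y' (g x)) :
    ∃ f ∈ G, (∀ x ∈ S, f x = g x) ∧ ∀ x, f (y x) = y' (f x) := by
  set a := g * y * g⁻¹ with ha
  set c := y' * a with hc
  have hcG : c ∈ G := G.mul_mem hy' (G.mul_mem (G.mul_mem hg hy) (G.inv_mem hg))
  have hcfix : ∀ x ∈ S, c (g x) = g x := by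
    intro x hx
    have : c (g x) = y' (g (y x)) := by simp [hc, ha]
    rw [this, hgS x hx, ← Perm.mul_apply, hy'2, Perm.one_apply]
  obtain ⟨l, hl⟩ := h.odd_orderOf hcG (S.image g)
    (by rwa [card_image_of_injective _ g.injective]) (by
      intro x hx
      obtain ⟨z, hz, rfl⟩ := mem_image.1 hx
      exact hcfix z hz)
  have haa : a * a = 1 := by
    rw [ha, show g * y * g⁻¹ * (g * y * g⁻¹) = g * (y * y) * g⁻¹ by group, hy2]
    simp
  have hy'_inv : y'⁻¹ = y' := inv_eq_of_mul_eq_one_left hy'2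
  have ha_inv : a⁻¹ = a := inv_eq_of_mul_eq_one_left haa
  have hsemi : SemiconjBy y' c c⁻¹ := by
    rw [SemiconjBy, hc, mul_inv_rev, ha_inv, hy'_inv, ← mul_assoc, hy'2, one_mul, mul_assoc,
      hy'2, mul_one]
  have hodd : c ^ (l + 1) * a = y' * c ^ (l + 1) := by
    have h1 : c ^ (2 * l + 1) = 1 := by rw [← hl, pow_orderOf_eq_one]
    have h2 : (c⁻¹) ^ (l + 1) = c ^ l := by
      rw [inv_pow, inv_eq_iff_mul_eq_one, ← pow_add, ← h1]; congr 1; omega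
    rw [(hsemi.pow_right (l + 1)).eq, h2, pow_succ, hc, mul_assoc, mul_assoc y', haa, mul_one]
  refine ⟨c ^ (l + 1) * g, G.mul_mem (G.pow_mem hcG _) hg, fun x hx => ?_, fun x => ?_⟩
  · rw [Perm.mul_apply, pow_apply_eq_self (hcfix x hx)]
  · have h1 : c ^ (l + 1) * g * y = y' * (c ^ (l + 1) * g) := by
      rw [← mul_assoc, ← hodd, ha]; group
    exact congrArg (fun p : Perm α => p x) h1

end Involutions

end

/-! ### Counting links -/

section

variable {α : Type*} [DecidableEq α]

theorem ncard_image_mul_card [Finite α] {β : Type*} (G K : Subgroup (Perm α)) (hKG : K ≤ G)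
    (Φ : Perm α → β) (h : ∀ g ∈ G, ∀ f ∈ G, Φ g = Φ f ↔ g⁻¹ * f ∈ K) :
    (Φ '' G).ncard * Nat.card K = Nat.card G := by
  rw [← Subgroup.card_mul_index (K.subgroupOf G), mul_comm,
    Nat.card_congr (Subgroup.subgroupOfEquivOfLe hKG).toEquiv]
  congr 1
  rw [← Nat.card_coe_set_eq, Subgroup.index]
  symm
  refine Nat.card_congr (Equiv.ofBijective (fun q => Quotient.liftOn' q
    (fun g : G => (⟨Φ g, g, g.2, rfl⟩ : Φ '' (G : Set (Perm α))))
    (fun g f hgf => Subtype.ext ((h g g.2 f f.2).2 ?_))) ⟨?_, ?_⟩)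
  · rw [QuotientGroup.leftRel_apply, Subgroup.mem_subgroupOf] at hgf
    exact hgf
  · intro p q
    induction p using Quotient.inductionOn'
    induction q using Quotient.inductionOn'
    rename_i g f
    intro hgf
    refine Quotient.sound' ?_
    rw [QuotientGroup.leftRel_apply, Subgroup.mem_subgroupOf]
    exact (h g g.2 f f.2).1 (congrArg Subtype.val hgf)
  · rintro ⟨_, g, hg, rfl⟩
    exact ⟨Quotient.mk'' ⟨g, hg⟩, rfl⟩

/-- The setwise stabilizer of `S` in `G`. -/
def setStabilizer (G : Subgroup (Perm α)) (S : Finset α) : Subgroup (Perm α) where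
  carrier := {g | g ∈ G ∧ S.image g = S}
  mul_mem' := fun {a b} ha hb => ⟨G.mul_mem ha.1 hb.1, by
    rw [Perm.coe_mul, ← image_image, hb.2, ha.2]⟩
  one_mem' := ⟨G.one_mem, by simp⟩
  inv_mem' := fun {a} ha => ⟨G.inv_mem ha.1, by
    nth_rw 1 [← ha.2]
    rw [image_image, ← Perm.coe_mul, inv_mul_cancel, Perm.coe_one, image_id]⟩

theorem fixer_le_setStabilizer (G : Subgroup (Perm α)) (S : Finset α) :
    fixer G S ≤ setStabilizer G S := fun g hg => ⟨hg.1, by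
  rw [image_congr (g := id) (fun x hx => hg.2 x hx), image_id]⟩

theorem card_induced_mul_card_fixer [Finite α] (G : Subgroup (Perm α)) (S : Finset α) :
    Nat.card (induced G S) * Nat.card (fixer G S) = Nat.card (setStabilizer G S) := by
  rw [← ncard_image_mul_card _ _ (fixer_le_setStabilizer G S) (fun g (x : S) => g x)]
  · congr 1
    have hinj : Function.Injective (fun (σ : Perm S) (x : S) => (σ x : α)) := fun σ τ h =>
      Equiv.ext fun x => Subtype.ext (congrFun h x)
    have e := Nat.card_image_of_injective hinj (induced G S : Set (Perm S))
    rw [Nat.card_coe_set_eq] at e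
    refine e.symm.trans (congrArg Set.ncard ?_)
    ext f
    constructor
    · rintro ⟨σ, ⟨g, hg, h⟩, rfl⟩
      refine ⟨g, ⟨hg, ?_⟩, funext h⟩
      exact image_eq_of_forall_mem (fun x hx => by rw [h ⟨x, hx⟩]; exact (σ _).2) le_rfl
    · rintro ⟨g, ⟨hg, hS⟩, rfl⟩
      have hm : ∀ x : S, g x ∈ S := fun x => by
        have := mem_image_of_mem g x.2
        rwa [hS] at this
      exact ⟨Equiv.ofBijective (fun x => ⟨g x, hm x⟩) (Finite.injective_iff_bijective.1
        fun x y hxy => Subtype.ext (g.injective (congrArg Subtype.val hxy))),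
        ⟨g, hg, fun x => rfl⟩, rfl⟩
  · intro g hg f hf
    rw [mem_fixer, funext_iff]
    constructor
    · intro h
      refine ⟨G.mul_mem (G.inv_mem hg.1) hf.1, fun x hx => ?_⟩
      rw [Perm.mul_apply, Perm.inv_eq_iff_eq]
      exact (h ⟨x, hx⟩).symm
    · rintro ⟨-, h⟩ x
      have := h x x.2
      rw [Perm.mul_apply, Perm.inv_eq_iff_eq] at this
      exact this.symm

theorem IsHomogeneous.card_eq [Fintype α] {G : Subgroup (Perm α)} {k : ℕ}
    (h : IsHomogeneous G k) (S : Finset α) (hS : #S = k) :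
    (Fintype.card α).choose k * (Nat.card (induced G S) * Nat.card (fixer G S)) = Nat.card G := by
  rw [card_induced_mul_card_fixer, ← ncard_image_mul_card G (setStabilizer G S)
    (fun g hg => hg.1) (fun g => S.image g)]
  · congr 1
    rw [← card_univ, ← card_powersetCard, ← Set.ncard_coe_finset]
    congr 1
    ext T
    simp only [mem_powersetCard_univ, Set.mem_image, SetLike.mem_coe]
    constructor
    · intro hT'
      obtain ⟨g, hg, h1⟩ := h S T hS hT'
      exact ⟨g, hg, image_eq_of_forall_mem h1 (by omega)⟩
    · rintro ⟨g, hg, rfl⟩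
      simp [card_image_of_injective _ g.injective, hS]
  · intro g hg f hf
    constructor
    · intro e
      refine ⟨G.mul_mem (G.inv_mem hg) hf, ?_⟩
      rw [Perm.coe_mul, ← image_image, ← e, image_image, ← Perm.coe_mul, inv_mul_cancel,
        Perm.coe_one, image_id]
    · rintro ⟨-, e⟩
      show S.image g = S.image f
      nth_rw 1 [← e]
      rw [image_image, ← Perm.coe_mul, mul_inv_cancel_left]

theorem card_fixer_image (G : Subgroup (Perm α)) (S : Finset α) {g : Perm α} (hg : g ∈ G) :
    Nat.card (fixer G (S.image g)) = Nat.card (fixer G S) := by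
  refine Nat.card_congr
    { toFun := fun p => ⟨g⁻¹ * p * g, ?_⟩
      invFun := fun p => ⟨g * p * g⁻¹, ?_⟩
      left_inv := fun p => Subtype.ext (by group)
      right_inv := fun p => Subtype.ext (by group) }
  · refine ⟨G.mul_mem (G.mul_mem (G.inv_mem hg) p.2.1) hg, fun x hx => ?_⟩
    rw [Perm.mul_apply, Perm.mul_apply, p.2.2 _ (mem_image_of_mem g hx), inv_apply_self']
  · refine ⟨G.mul_mem (G.mul_mem hg p.2.1) (G.inv_mem hg), fun x hx => ?_⟩
    obtain ⟨z, hz, rfl⟩ := mem_image.1 hx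
    rw [Perm.mul_apply, Perm.mul_apply, inv_apply_self', p.2.2 z hz]

theorem IsHomogeneous.card_fixer_eq {G : Subgroup (Perm α)} {k : ℕ} (h : IsHomogeneous G k)
    {S T : Finset α} (hS : #S = k) (hT : #T = k) :
    Nat.card (fixer G S) = Nat.card (fixer G T) := by
  obtain ⟨g, hg, h1⟩ := h S T hS hT
  rw [← image_eq_of_forall_mem h1 (by omega), card_fixer_image G S hg]

theorem ncard_linked_mul_card_fixer [Finite α] (G : Subgroup (Perm α)) (Γ : Finset α) (u : α) :
    {w | Linked G Γ u w}.ncard * Nat.card (fixer G (insert u Γ)) = Nat.card (fixer G Γ) := by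
  rw [← ncard_image_mul_card (fixer G Γ) (fixer G (insert u Γ))
    (fixer_anti G (subset_insert _ _)) (fun g => g u)]
  · congr 2
    ext w
    constructor
    · rintro ⟨g, hg, h1, h2⟩
      exact ⟨g, ⟨hg, h1⟩, h2⟩
    · rintro ⟨g, ⟨hg, h1⟩, h2⟩
      exact ⟨g, hg, h1, h2⟩
  · intro g hg f hf
    rw [mem_fixer]
    constructor
    · intro e
      have hm := (fixer G Γ).mul_mem ((fixer G Γ).inv_mem hg) hf
      refine ⟨hm.1, fun x hx => ?_⟩
      rcases mem_insert.1 hx with rfl | hx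
      · rw [Perm.mul_apply, ← e, inv_apply_self']
      · exact hm.2 x hx
    · rintro ⟨-, h⟩
      have := h u (mem_insert_self _ _)
      rw [Perm.mul_apply, Perm.inv_eq_iff_eq] at this
      exact this.symm

theorem IsMultTransitive.induced_eq_top [Fintype α] {G : Subgroup (Perm α)} {k : ℕ}
    (h : IsMultTransitive G k) (S : Finset α) (hS : #S ≤ k) : induced G S = ⊤ := by
  rw [eq_top_iff]
  intro σ _
  obtain ⟨g, hg, h1⟩ := h (σ.extendDomain (p := fun x => x ∈ S) (Equiv.refl _)) S hS
  exact ⟨g, hg, fun x => by rw [h1 x x.2, Perm.extendDomain_apply_subtype _ _ x.2]; rfl⟩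

/-- In a `k`-transitive and `(k+1)`-homogeneous group, the points linked to a given point relative
to a `k`-set are equally many in all cases. Their number `v` and the index `r` of the group
induced on a `(k+1)`-set satisfy `r * v = n - k`. -/
theorem exists_ncard_linked_eq [Fintype α] {G : Subgroup (Perm α)} {k : ℕ}
    (ht : IsMultTransitive G k) (hh : IsHomogeneous G (k + 1)) (hk : k + 1 ≤ Fintype.card α)
    (S : Finset α) (hS : #S = k + 1) :
    ∃ v, (∀ Γ : Finset α, #Γ = k → ∀ u ∉ Γ, {w | Linked G Γ u w}.ncard = v) ∧
      (induced G S).index * v = Fintype.card α - k := by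
  obtain ⟨Γ, hΓS, hΓ⟩ := Finset.exists_subset_card_eq (show k ≤ #S by omega)
  have hpos : ∀ T, 0 < Nat.card (fixer G T) := fun T => Nat.card_pos
  have hone : ∀ Γ' : Finset α, #Γ' = k → ∀ u ∉ Γ',
      {w | Linked G Γ' u w}.ncard * Nat.card (fixer G S) = Nat.card (fixer G Γ) := by
    intro Γ' hΓ' u hu
    rw [hh.card_fixer_eq hS (T := insert u Γ') (by rw [card_insert_of_notMem hu, hΓ']),
      ncard_linked_mul_card_fixer, ht.isHomogeneous.card_fixer_eq hΓ' hΓ]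
  obtain ⟨u, hu⟩ : ∃ u, u ∉ Γ := by
    by_contra! hall
    have : #Γ = Fintype.card α := by rw [← card_univ, eq_univ_of_forall hall]
    omega
  refine ⟨{w | Linked G Γ u w}.ncard, fun Γ' hΓ' u' hu' => ?_, ?_⟩
  · exact Nat.eq_of_mul_eq_mul_right (hpos S) ((hone Γ' hΓ' u' hu').trans (hone Γ hΓ u hu).symm)
  · have e1 := hh.card_eq S hS
    have e2 := ht.isHomogeneous.card_eq Γ hΓ
    have e3 : Nat.card (induced G Γ) = k.factorial := by
      rw [ht.induced_eq_top Γ hΓ.le, Subgroup.card_top, Nat.card_perm]; simp [hΓ]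
    have e4 : Nat.card (induced G S) * (induced G S).index = (k + 1).factorial := by
      rw [Subgroup.card_mul_index, Nat.card_perm]; simp [hS]
    have e5 := hone Γ hΓ u hu
    have e6 := Nat.choose_succ_right_eq (Fintype.card α) k
    rw [Nat.factorial_succ] at e4
    set v := {w | Linked G Γ u w}.ncard
    set X := Nat.card (induced G S)
    set r := (induced G S).index
    set N := Fintype.card α
    set p := Nat.card (fixer G S) with hp
    set c := N.choose k
    have hp0 : 0 < p := hpos S
    have hc0 : 0 < c := Nat.choose_pos (by omega)
    have hf0 : 0 < k.factorial := Nat.factorial_pos k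
    -- both sides of the identity, multiplied by `(k + 1)! * choose N k * p`, count `G` up to `r`
    refine Nat.eq_of_mul_eq_mul_right (m := (k + 1) * (c * k.factorial * p))
      (by positivity) ?_
    rw [e3, ← e5] at e2
    calc r * v * ((k + 1) * (c * k.factorial * p))
        = r * (k + 1) * (c * (k.factorial * (v * p))) := by ring
      _ = r * (k + 1) * (N.choose (k + 1) * (X * p)) := by rw [e2, e1]
      _ = (N.choose (k + 1) * (k + 1)) * (X * r) * p := by ring
      _ = (c * (N - k)) * ((k + 1) * k.factorial) * p := by rw [e6, e4]
      _ = (N - k) * ((k + 1) * (c * k.factorial * p)) := by ring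

theorem even_card_of_involution {β : Type*} [DecidableEq β] (s : Finset β) (f : β → β)
    (hf : ∀ x ∈ s, f x ∈ s) (hne : ∀ x ∈ s, f x ≠ x) (hinv : ∀ x ∈ s, f (f x) = x) :
    Even #s := by
  rw [← ZMod.natCast_eq_zero_iff_even, card_eq_sum_ones, Nat.cast_sum]
  exact sum_involution (fun x _ => f x) (fun x _ => by simpa using CharTwo.add_self_eq_zero 1)
    (fun x hx _ => hne x hx) hf hinv

open Classical in
/-- The number of ordered pairs of distinct points of `Θ` that are linked relative to the rest of
`Θ`. -/
noncomputable def linkCount (G : Subgroup (Perm α)) (Θ : Finset α) : ℕ :=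
  #{p ∈ Θ.offDiag | Linked G (Θ \ {p.1, p.2}) p.1 p.2}

theorem linkCount_image (G : Subgroup (Perm α)) (Θ : Finset α) {g : Perm α} (hg : g ∈ G) :
    linkCount G Θ ≤ linkCount G (Θ.image g) := by
  classical
  unfold linkCount
  refine card_le_card_of_injOn (fun p => (g p.1, g p.2)) ?_ ?_
  · rintro ⟨a, b⟩ hp
    simp only [coe_filter, mem_offDiag, Set.mem_ofPred_eq] at hp ⊢
    obtain ⟨⟨ha, hb, hab⟩, hl⟩ := hp
    refine ⟨⟨mem_image_of_mem _ ha, mem_image_of_mem _ hb, fun e => hab (g.injective e)⟩, ?_⟩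
    have := hl.map hg
    rwa [image_sdiff _ _ g.injective, image_insert, image_singleton] at this
  · rintro ⟨a, b⟩ _ ⟨c, d⟩ _ h
    simp only [Prod.mk.injEq, g.injective.eq_iff] at h
    rw [h.1, h.2]

theorem even_linkCount (G : Subgroup (Perm α)) (Θ : Finset α) : Even (linkCount G Θ) := by
  classical
  refine even_card_of_involution _ Prod.swap (fun p hp => ?_) (fun p hp e => ?_)
    fun p _ => Prod.swap_swap p
  · obtain ⟨a, b⟩ := p
    simp only [mem_filter, mem_offDiag, Prod.swap] at hp ⊢
    refine ⟨⟨hp.1.2.1, hp.1.1, hp.1.2.2.symm⟩, ?_⟩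
    rw [pair_comm]
    exact hp.2.symm
  · rw [mem_filter, mem_offDiag] at hp
    exact hp.1.2.2 (congrArg Prod.snd e)

/-- Double counting of the linked pairs: `q * (n - k - 1) = (k + 1) * (k + 2) * (v - 1)`. -/
theorem linkCount_mul [Fintype α] {G : Subgroup (Perm α)} {k v : ℕ}
    (hh : IsHomogeneous G (k + 2)) (hk : k + 2 ≤ Fintype.card α)
    (hv : ∀ Γ : Finset α, #Γ = k → ∀ u ∉ Γ, {w | Linked G Γ u w}.ncard = v)
    (Θ : Finset α) (hΘ : #Θ = k + 2) :
    linkCount G Θ * (Fintype.card α - k - 1) = (k + 1) * (k + 2) * (v - 1) := by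
  classical
  have hq : ∀ Θ' ∈ powersetCard (k + 2) (univ : Finset α), linkCount G Θ' = linkCount G Θ := by
    intro Θ' hΘ'
    rw [mem_powersetCard_univ] at hΘ'
    obtain ⟨g, hg, h1⟩ := hh Θ Θ' hΘ hΘ'
    obtain ⟨f, hf, h2⟩ := hh Θ' Θ hΘ' hΘ
    have h3 := linkCount_image G Θ hg
    have h4 := linkCount_image G Θ' hf
    rw [image_eq_of_forall_mem h1 (by omega)] at h3
    rw [image_eq_of_forall_mem h2 (by omega)] at h4
    omega
  have hA : ∑ Θ' ∈ powersetCard (k + 2) (univ : Finset α), linkCount G Θ' =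
      ∑ Γ ∈ powersetCard k (univ : Finset α), ∑ u ∈ Γᶜ, #{w | w ≠ u ∧ Linked G Γ u w} := by
    simp only [linkCount, ← card_sigma]
    refine card_nbij' (fun p => ⟨p.1 \ {p.2.1, p.2.2}, p.2.1, p.2.2⟩)
      (fun p => ⟨insert p.2.1 (insert p.2.2 p.1), p.2.1, p.2.2⟩) ?_ ?_ ?_ ?_
    · rintro ⟨Θ', a, b⟩ hp
      simp only [coe_sigma, Set.mem_sigma_iff, mem_coe, mem_powersetCard_univ, mem_filter,
        mem_offDiag, mem_compl, mem_univ, true_and] at hp ⊢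
      obtain ⟨h1, ⟨ha, hb, hab⟩, hl⟩ := hp
      refine ⟨?_, by simp, hab.symm, hl⟩
      rw [card_sdiff_of_subset (by simp [insert_subset_iff, ha, hb]), h1, card_pair hab]
      omega
    · rintro ⟨Γ, a, b⟩ hp
      simp only [coe_sigma, Set.mem_sigma_iff, mem_coe, mem_powersetCard_univ, mem_filter,
        mem_offDiag, mem_compl, mem_univ, true_and] at hp ⊢
      obtain ⟨h1, ha, hab, hl⟩ := hp
      have hb : b ∉ Γ := by
        intro hb
        obtain ⟨g, hg, h2, h3⟩ := hl
        exact hab ((g.injective ((h2 b hb).trans h3.symm)))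
      have e : (insert a (insert b Γ)) \ {a, b} = Γ := by
        ext x; simp only [mem_sdiff, mem_insert, mem_singleton]
        constructor
        · tauto
        · intro hx
          refine ⟨Or.inr (Or.inr hx), ?_⟩
          rintro (rfl | rfl) <;> contradiction
      refine ⟨?_, ⟨by simp, by simp, hab.symm⟩, by rwa [e]⟩
      rw [card_insert_of_notMem (by simp [ha, hab.symm]), card_insert_of_notMem hb, h1]
    · rintro ⟨Θ', a, b⟩ hp
      simp only [coe_sigma, Set.mem_sigma_iff, mem_coe, mem_powersetCard_univ, mem_filter,
        mem_offDiag] at hp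
      obtain ⟨h1, ⟨ha, hb, hab⟩, hl⟩ := hp
      have e : insert a (insert b (Θ' \ {a, b})) = Θ' := by
        ext x; simp only [mem_sdiff, mem_insert, mem_singleton]
        constructor
        · rintro (rfl | rfl | h)
          · exact ha
          · exact hb
          · exact h.1
        · tauto
      simp only [e]
    · rintro ⟨Γ, a, b⟩ hp
      simp only [coe_sigma, Set.mem_sigma_iff, mem_coe, mem_powersetCard_univ, mem_filter,
        mem_compl, mem_univ, true_and] at hp
      obtain ⟨h1, ha, hab, hl⟩ := hp
      have hb : b ∉ Γ := by
        intro hb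
        obtain ⟨g, hg, h2, h3⟩ := hl
        exact hab ((g.injective ((h2 b hb).trans h3.symm)))
      have e : (insert a (insert b Γ)) \ {a, b} = Γ := by
        ext x; simp only [mem_sdiff, mem_insert, mem_singleton]
        constructor
        · tauto
        · intro hx
          refine ⟨Or.inr (Or.inr hx), ?_⟩
          rintro (rfl | rfl) <;> contradiction
      simp only [e]
  have hB : ∀ Γ ∈ powersetCard k (univ : Finset α), ∀ u ∈ Γᶜ,
      #{w | w ≠ u ∧ Linked G Γ u w} = v - 1 := by
    intro Γ hΓ u hu
    rw [← hv Γ (by simpa using hΓ) u (by simpa using hu), ← Set.ncard_coe_finset,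
      ← Set.ncard_sdiff_singleton_of_mem (a := u) (Linked.refl G Γ u)]
    congr 1
    ext w
    simp [and_comm]
  rw [sum_congr rfl hq, sum_congr rfl fun Γ hΓ => sum_congr rfl (hB Γ hΓ), sum_const,
    card_powersetCard, card_univ] at hA
  simp only [sum_const, card_compl, smul_eq_mul] at hA
  rw [sum_congr rfl (g := fun _ => (Fintype.card α - k) * (v - 1)) (fun Γ hΓ => by
    rw [mem_powersetCard_univ.1 hΓ]), sum_const, card_powersetCard, card_univ,
    smul_eq_mul] at hA
  have e1 := Nat.choose_succ_right_eq (Fintype.card α) k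
  have e2 := Nat.choose_succ_right_eq (Fintype.card α) (k + 1)
  have hc : 0 < (Fintype.card α).choose k := Nat.choose_pos (by omega)
  have hc' : 0 < (Fintype.card α).choose (k + 2) := Nat.choose_pos (by omega)
  set N := Fintype.card α
  set q := linkCount G Θ
  refine Nat.eq_of_mul_eq_mul_right (m := N.choose k * (N - k))
    (Nat.mul_pos hc (by omega)) ?_
  calc q * (N - k - 1) * (N.choose k * (N - k))
      = q * (N.choose k * (N - k) * (N - (k + 1))) := by
        rw [Nat.sub_sub]; ring
    _ = q * (N.choose (k + 2) * (k + 1 + 1) * (k + 1)) := by rw [← e1, e2]; ring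
    _ = (k + 1) * (k + 2) * (N.choose (k + 2) * q) := by ring
    _ = (k + 1) * (k + 2) * (v - 1) * (N.choose k * (N - k)) := by rw [hA]; ring

theorem index_induced_dvd (G : Subgroup (Perm α)) (S : Finset α) :
    (induced G S).index ∣ (#S).factorial := by
  have := (induced G S).index_dvd_card
  rwa [Nat.card_perm, Nat.card_eq_fintype_card, Fintype.card_coe] at this

theorem IsHomogeneous.isMultTransitive_of_index [Fintype α] {G : Subgroup (Perm α)} {k : ℕ}
    (h : IsHomogeneous G k) (hk : k ≤ Fintype.card α) (S : Finset α) (hS : #S = k)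
    (h1 : (induced G S).index = 1) : IsMultTransitive G k :=
  h.isMultTransitive hk S hS (Subgroup.index_eq_one.1 h1)

/-- The Diophantine constraint that links the degree to the index `r` of the group induced on a
`(k+1)`-set. -/
theorem exists_index_equation [Fintype α] {G : Subgroup (Perm α)} {k : ℕ}
    (ht : IsMultTransitive G k) (hh : IsHomogeneous G (k + 1)) (hh' : IsHomogeneous G (k + 2))
    (hk : k + 2 ≤ Fintype.card α) (S : Finset α) (hS : #S = k + 1) :
    ∃ v q, 0 < v ∧ (induced G S).index * v = Fintype.card α - k ∧
      q * 2 * ((induced G S).index * v - 1) = (k + 1) * (k + 2) * (v - 1) := by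
  obtain ⟨v, hv, hr⟩ := exists_ncard_linked_eq ht hh (by omega) S hS
  obtain ⟨Θ, -, hΘ⟩ := exists_superset_card (∅ : Finset α) (by simp) hk
  have h1 := linkCount_mul hh' hk hv Θ hΘ
  obtain ⟨q, hq⟩ := even_linkCount G Θ
  refine ⟨v, q, Nat.pos_of_ne_zero ?_, hr, ?_⟩
  · rintro rfl
    omega
  · rw [hr, mul_two, ← hq, h1]

theorem isMultTransitive_two [Fintype α] {G : Subgroup (Perm α)} (hn : 10 ≤ Fintype.card α)
    (ht : IsMultTransitive G 1) (h2 : IsHomogeneous G 2) (h3 : IsHomogeneous G 3) :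
    IsMultTransitive G 2 := by
  obtain ⟨S, -, hS⟩ := exists_superset_card (∅ : Finset α) (k := 2) (by simp) (by omega)
  refine h2.isMultTransitive_of_index (by omega) S hS ?_
  obtain ⟨v, q, hv, hr, hq⟩ := exists_index_equation ht h2 h3 (by omega) S hS
  have hdvd := index_induced_dvd G S
  rw [hS] at hdvd
  rcases (Nat.dvd_prime Nat.prime_two).1 hdvd with h | h
  · exact h
  · exfalso
    rw [h] at hr hq
    obtain ⟨w, rfl⟩ : ∃ w, v = w + 1 := ⟨v - 1, by omega⟩
    have e : 2 * (w + 1) - 1 = 2 * w + 1 := by omega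
    rw [e] at hq
    have hq4 : q < 2 := by
      by_contra hge
      have : 2 * 2 * (2 * w + 1) ≤ q * 2 * (2 * w + 1) := by gcongr; omega
      omega
    interval_cases q <;> omega

theorem isMultTransitive_three [Fintype α] {G : Subgroup (Perm α)} (hn : 10 ≤ Fintype.card α)
    (ht : IsMultTransitive G 2) (h3 : IsHomogeneous G 3) (h4 : IsHomogeneous G 4) :
    IsMultTransitive G 3 := by
  obtain ⟨S, -, hS⟩ := exists_superset_card (∅ : Finset α) (k := 3) (by simp) (by omega)
  refine h3.isMultTransitive_of_index (by omega) S hS ?_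
  obtain ⟨v, q, hv, hr, hq⟩ := exists_index_equation ht h3 h4 (by omega) S hS
  have hdvd := index_induced_dvd G S
  rw [hS] at hdvd
  obtain ⟨w, rfl⟩ : ∃ w, v = w + 1 := ⟨v - 1, by omega⟩
  have hle := Nat.le_of_dvd (Nat.factorial_pos 3) hdvd
  simp only [Nat.factorial] at hle hdvd
  by_contra hne
  set r := (induced G S).index
  have hr0 : r ≠ 0 := by rintro h; rw [h] at hdvd; simp at hdvd
  have hq4 : q < 6 := by
    by_contra hge
    have h1 : 2 * (w + 1) ≤ r * (w + 1) := by gcongr; omega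
    have h2 : 6 * 2 * (r * (w + 1) - 1) ≤ q * 2 * (r * (w + 1) - 1) := by gcongr; omega
    omega
  interval_cases r <;> first | omega | (interval_cases q <;> omega)

/-- For 4-sets the constraint leaves one possibility besides 4-transitivity, in degree 24, if the
group induced on a 4-set has order divisible by 4. -/
theorem index_eq_three_of_dvd_six [Fintype α] {G : Subgroup (Perm α)}
    (hn : 10 ≤ Fintype.card α) (ht : IsMultTransitive G 3) (h4 : IsHomogeneous G 4)
    (h5 : IsHomogeneous G 5) (S : Finset α) (hS : #S = 4) (hdvd : (induced G S).index ∣ 6)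
    (hne : (induced G S).index ≠ 1) : (induced G S).index = 3 ∧ Fintype.card α = 24 := by
  obtain ⟨v, q, hv, hr, hq⟩ := exists_index_equation ht h4 h5 (by omega) S hS
  obtain ⟨w, rfl⟩ : ∃ w, v = w + 1 := ⟨v - 1, by omega⟩
  have hle := Nat.le_of_dvd (by norm_num) hdvd
  set r := (induced G S).index
  have hr0 : r ≠ 0 := by rintro h; rw [h] at hdvd; simp at hdvd
  have hq4 : q < 10 := by
    by_contra hge
    have h1 : 2 * (w + 1) ≤ r * (w + 1) := by gcongr; omega
    have h2 : 10 * 2 * (r * (w + 1) - 1) ≤ q * 2 * (r * (w + 1) - 1) := by gcongr; omega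
    omega
  interval_cases r <;> first | omega | (interval_cases q <;> omega)

end

/-! ### Reduction to the fixed points of a 2-subgroup -/

section

open scoped Pointwise

/-- Sylow's theorem for subgroups of maximal order among the 2-subgroups of `P`. -/
theorem exists_conj_mem_of_card_max {A : Type*} [Group A] [Finite A] {P Q R : Subgroup A}
    (hQP : Q ≤ P) (hRP : R ≤ P) (hQ : IsPGroup 2 Q) (hR : IsPGroup 2 R)
    (hmax : ∀ T ≤ P, IsPGroup 2 T → Nat.card T ≤ Nat.card Q) (hcard : Nat.card R = Nat.card Q) :
    ∃ p ∈ P, ∀ x, x ∈ R ↔ p * x * p⁻¹ ∈ Q := by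
  have mk : ∀ T ≤ P, IsPGroup 2 T → Nat.card T = Nat.card Q →
      ∃ S : Sylow 2 P, (S : Subgroup P) = T.subgroupOf P := by
    intro T hTP hT hc
    refine ⟨⟨T.subgroupOf P, hT.of_equiv (Subgroup.subgroupOfEquivOfLe hTP).symm, ?_⟩, rfl⟩
    intro U hU hle
    have h1 : T ≤ U.map P.subtype := fun x hx => ⟨⟨x, hTP hx⟩, hle hx, rfl⟩
    have h2 := hmax (U.map P.subtype) (by rintro _ ⟨x, -, rfl⟩; exact x.2) (hU.map _)
    rw [← hc] at h2
    have h3 := Subgroup.eq_of_le_of_card_ge h1 h2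
    rw [Subgroup.subgroupOf, h3, Subgroup.comap_map_eq_self_of_injective P.subtype_injective]
  obtain ⟨SQ, hSQ⟩ := mk Q hQP hQ rfl
  obtain ⟨SR, hSR⟩ := mk R hRP hR hcard
  obtain ⟨p, hp⟩ := MulAction.exists_smul_eq P SR SQ
  refine ⟨p, p.2, fun x => ?_⟩
  have h1 : ((p • SR : Sylow 2 P) : Subgroup P) = MulAut.conj p • (SR : Subgroup P) := rfl
  rw [hp, hSQ, hSR] at h1
  constructor
  · intro hx
    have : MulAut.conj p • (⟨x, hRP hx⟩ : P) ∈ Q.subgroupOf P := by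
      rw [h1]; exact Subgroup.smul_mem_pointwise_smul _ _ _ hx
    exact this
  · intro hx
    have h2 : (⟨p * x * p⁻¹, hQP hx⟩ : P) ∈ Q.subgroupOf P := hx
    rw [h1, Subgroup.mem_pointwise_smul_iff_inv_smul_mem] at h2
    have h3 : ((MulAut.conj p)⁻¹ • (⟨p * x * p⁻¹, hQP hx⟩ : P) : P) =
        p⁻¹ * ⟨p * x * p⁻¹, hQP hx⟩ * p := by
      rw [← map_inv, MulAut.smul_def, MulAut.conj_apply, inv_inv]
    rw [h3] at h2
    have h4 : ((p : A)⁻¹ * (p * x * (p : A)⁻¹) * p) ∈ R := h2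
    simpa [mul_assoc] using h4

variable {α : Type*} [DecidableEq α] [Fintype α]

open Classical in
/-- The set of points fixed by all elements of `Q`. -/
noncomputable def fixedFinset (Q : Subgroup (Perm α)) : Finset α := {x | ∀ q ∈ Q, q x = x}

theorem mem_fixedFinset {Q : Subgroup (Perm α)} {x : α} :
    x ∈ fixedFinset Q ↔ ∀ q ∈ Q, q x = x := by simp [fixedFinset]

/-- `Q` has maximal order among the 2-subgroups of `G` that fix at least `i` points. -/
structure IsMaxTwoSubgroup (G Q : Subgroup (Perm α)) (i : ℕ) : Prop where
  le : Q ≤ G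
  isPGroup : IsPGroup 2 Q
  le_card : i ≤ #(fixedFinset Q)
  max : ∀ R ≤ G, IsPGroup 2 R → i ≤ #(fixedFinset R) → Nat.card R ≤ Nat.card Q

theorem exists_isMaxTwoSubgroup (G : Subgroup (Perm α)) {i : ℕ} (hi : i ≤ Fintype.card α) :
    ∃ Q, IsMaxTwoSubgroup G Q i := by
  obtain ⟨Q, ⟨h1, h2, h3⟩, h4⟩ := Set.exists_max_image
    {Q : Subgroup (Perm α) | Q ≤ G ∧ IsPGroup 2 Q ∧ i ≤ #(fixedFinset Q)}
    (fun Q => Nat.card Q) (Set.toFinite _) ⟨⊥, bot_le, IsPGroup.of_bot, by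
      have : fixedFinset (⊥ : Subgroup (Perm α)) = univ := by
        ext x; simp [mem_fixedFinset]
      rwa [this, card_univ]⟩
  exact ⟨Q, h1, h2, h3, fun R hR1 hR2 hR3 => h4 R ⟨hR1, hR2, hR3⟩⟩

/-- The group induced on the fixed points of `Q` by the normalizer of `Q` in `G`. -/
def reduced (G Q : Subgroup (Perm α)) : Subgroup (Perm (fixedFinset Q)) where
  carrier := {σ | ∃ h ∈ G, h ∈ Subgroup.normalizer (Q : Set (Perm α)) ∧
    ∀ x : fixedFinset Q, h x = σ x}
  mul_mem' := by
    rintro a b ⟨g, hg, hgn, hga⟩ ⟨h, hh, hhn, hhb⟩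
    exact ⟨g * h, G.mul_mem hg hh, Subgroup.mul_mem _ hgn hhn, fun x => by
      rw [Perm.mul_apply, hhb, hga]; rfl⟩
  one_mem' := ⟨1, G.one_mem, Subgroup.one_mem _, fun _ => rfl⟩
  inv_mem' := by
    rintro a ⟨g, hg, hgn, hga⟩
    exact ⟨g⁻¹, G.inv_mem hg, Subgroup.inv_mem _ hgn, fun x => by
      rw [Perm.inv_eq_iff_eq, hga, ← Perm.mul_apply, mul_inv_cancel, Perm.one_apply]⟩

theorem apply_mem_fixedFinset {Q : Subgroup (Perm α)} {h : Perm α}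
    (hn : h ∈ Subgroup.normalizer (Q : Set (Perm α))) {x : α} (hx : x ∈ fixedFinset Q) :
    h x ∈ fixedFinset Q := by
  rw [mem_fixedFinset] at hx ⊢
  intro q hq
  have h1 := hx (h⁻¹ * q * h) (by
    rw [Subgroup.mem_normalizer_iff.1 hn]; simpa [mul_assoc] using hq)
  rw [Perm.mul_apply, Perm.mul_apply, Perm.inv_eq_iff_eq] at h1
  exact h1

theorem exists_mem_reduced {G Q : Subgroup (Perm α)} {h : Perm α} (hG : h ∈ G)
    (hn : h ∈ Subgroup.normalizer (Q : Set (Perm α))) :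
    ∃ σ ∈ reduced G Q, ∀ x : fixedFinset Q, h x = σ x :=
  ⟨Equiv.ofBijective (fun x => ⟨h x, apply_mem_fixedFinset hn x.2⟩)
    (Finite.injective_iff_bijective.1 fun _ _ hxy =>
      Subtype.ext (h.injective (congrArg Subtype.val hxy))), ⟨h, hG, hn, fun _ => rfl⟩,
    fun _ => rfl⟩

/-- An element of `G` that maps at least `i` fixed points of `Q` to fixed points of `Q` can be
corrected so as to normalize `Q`, because `Q` is a Sylow subgroup of the pointwise stabilizer of the
image points. -/
theorem IsMaxTwoSubgroup.exists_reduced {G Q : Subgroup (Perm α)} {i : ℕ}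
    (hQ : IsMaxTwoSubgroup G Q i) (S : Finset (fixedFinset Q)) (hS : i ≤ #S) {g : Perm α}
    (hg : g ∈ G) (f : fixedFinset Q → fixedFinset Q) (hgf : ∀ x ∈ S, g x = f x) :
    ∃ σ ∈ reduced G Q, ∀ x ∈ S, σ x = f x := by
  set T : Finset α := S.image (fun x : fixedFinset Q => g (x : α)) with hT
  have hTcard : i ≤ #T := by
    rw [hT, card_image_of_injective _ fun x y hxy => Subtype.ext (g.injective hxy)]
    exact hS
  have hfix : ∀ R : Subgroup (Perm α), R ≤ fixer G T → i ≤ #(fixedFinset R) := fun R hR =>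
    hTcard.trans (card_le_card fun x hx => mem_fixedFinset.2 fun q hq => (hR hq).2 x hx)
  have hQT : Q ≤ fixer G T := by
    refine fun q hq => ⟨hQ.le hq, fun x hx => ?_⟩
    obtain ⟨z, hz, rfl⟩ := mem_image.1 hx
    simp only [hgf z hz]
    exact mem_fixedFinset.1 (f z).2 q hq
  have hRT : Q.map (MulAut.conj g).toMonoidHom ≤ fixer G T := by
    rintro _ ⟨q, hq, rfl⟩
    refine ⟨G.mul_mem (G.mul_mem hg (hQ.le hq)) (G.inv_mem hg), fun x hx => ?_⟩
    obtain ⟨z, hz, rfl⟩ := mem_image.1 hx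
    have := mem_fixedFinset.1 z.2 q hq
    simp [this]
  obtain ⟨p, hp, hpQ⟩ := exists_conj_mem_of_card_max hQT hRT hQ.isPGroup (hQ.isPGroup.map _)
    (fun R hR hR2 => hQ.max R (hR.trans (fixer_le G T)) hR2 (hfix R hR))
    (Subgroup.card_map_of_injective (MulAut.conj g).injective)
  have hn : p * g ∈ Subgroup.normalizer (Q : Set (Perm α)) := by
    rw [Subgroup.mem_normalizer_iff]
    intro q
    rw [show p * g * q * (p * g)⁻¹ = p * (g * q * g⁻¹) * p⁻¹ by group, ← hpQ]
    constructor
    · intro hq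
      exact ⟨q, hq, rfl⟩
    · rintro ⟨q', hq', e⟩
      have : q' = q := by simpa using e
      exact this ▸ hq'
  obtain ⟨σ, hσ, h1⟩ := exists_mem_reduced (G.mul_mem hp.1 hg) hn
  refine ⟨σ, hσ, fun x hx => Subtype.ext ?_⟩
  rw [← h1, Perm.mul_apply, hp.2 _ (mem_image_of_mem _ hx), hgf x hx]

theorem IsMaxTwoSubgroup.isHomogeneous {G Q : Subgroup (Perm α)} {i j : ℕ}
    (hQ : IsMaxTwoSubgroup G Q i) (hij : i ≤ j) (h : IsHomogeneous G j) :
    IsHomogeneous (reduced G Q) j := by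
  intro S T hS hT
  rcases T.eq_empty_or_nonempty with rfl | ⟨t, ht⟩
  · have : S = ∅ := by rw [← card_eq_zero, hS, ← hT, card_empty]
    exact ⟨1, Subgroup.one_mem _, by simp [this]⟩
  obtain ⟨g, hg, h1⟩ := h (S.map (Function.Embedding.subtype _))
    (T.map (Function.Embedding.subtype _)) (by rwa [card_map]) (by rwa [card_map])
  have h2 : ∀ x ∈ S, ∃ y ∈ T, g x = y := by
    intro x hx
    obtain ⟨y, hy, e⟩ := mem_map.1 (h1 x (mem_map_of_mem _ hx))
    exact ⟨y, hy, e.symm⟩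
  choose! f hf using h2
  obtain ⟨σ, hσ, h3⟩ := hQ.exists_reduced S (by omega) hg f (fun x hx => (hf x hx).2)
  exact ⟨σ, hσ, fun x hx => by rw [h3 x hx]; exact (hf x hx).1⟩

theorem IsMaxTwoSubgroup.isMultTransitive {G Q : Subgroup (Perm α)} {i j : ℕ}
    (hQ : IsMaxTwoSubgroup G Q i) (hij : i ≤ j) (hj : j ≤ #(fixedFinset Q))
    (h : IsMultTransitive G j) : IsMultTransitive (reduced G Q) j := by
  intro τ R hR
  obtain ⟨S, hRS, hS⟩ := exists_superset_card R hR (by simpa using hj)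
  obtain ⟨g, hg, h1⟩ := h (τ.extendDomain (p := fun x => x ∈ fixedFinset Q) (Equiv.refl _))
    (S.map (Function.Embedding.subtype _)) (by rw [card_map, hS])
  obtain ⟨σ, hσ, h2⟩ := hQ.exists_reduced S (by omega) hg τ (fun x hx => by
    rw [show (x : α) = Function.Embedding.subtype _ x from rfl, h1 _ (mem_map_of_mem _ hx)]
    exact Perm.extendDomain_apply_subtype _ _ x.2)
  exact ⟨σ, hσ, fun x hx => h2 x (hRS hx)⟩

theorem IsMaxTwoSubgroup.linked_iff {G Q : Subgroup (Perm α)} {i : ℕ}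
    (hQ : IsMaxTwoSubgroup G Q i) (Γ : Finset (fixedFinset Q)) (u w : fixedFinset Q)
    (hi : i ≤ #(insert u Γ)) (hu : u ∉ Γ) :
    Linked (reduced G Q) Γ u w ↔
      Linked G (Γ.map (Function.Embedding.subtype _)) u w := by
  constructor
  · rintro ⟨σ, ⟨h, hh, -, hσ⟩, h1, h2⟩
    refine ⟨h, hh, fun x hx => ?_, by rw [hσ, h2]⟩
    obtain ⟨z, hz, rfl⟩ := mem_map.1 hx
    exact (hσ z).trans (congrArg _ (h1 z hz))
  · rintro ⟨g, hg, h1, h2⟩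
    obtain ⟨σ, hσ, h3⟩ := hQ.exists_reduced (insert u Γ) hi hg
      (fun x => if x = u then w else x) (fun x hx => by
        split_ifs with hxu
        · rw [hxu, h2]
        · exact h1 x (mem_map_of_mem _ ((mem_insert.1 hx).resolve_left hxu)))
    refine ⟨σ, hσ, fun x hx => ?_, ?_⟩
    · rw [h3 x (mem_insert_of_mem hx), if_neg]
      rintro rfl
      exact hu hx
    · rw [h3 u (mem_insert_self _ _), if_pos rfl]

theorem IsMaxTwoSubgroup.linkCount_eq {G Q : Subgroup (Perm α)} {i : ℕ}
    (hQ : IsMaxTwoSubgroup G Q i) (Θ : Finset (fixedFinset Q)) (hi : i + 1 ≤ #Θ) :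
    linkCount (reduced G Q) Θ = linkCount G (Θ.map (Function.Embedding.subtype _)) := by
  classical
  have key : ∀ a b, a ∈ Θ → b ∈ Θ → a ≠ b → (Linked (reduced G Q) (Θ \ {a, b}) a b ↔
      Linked G (Θ.map (Function.Embedding.subtype _) \ {(a : α), (b : α)}) a b) := by
    intro a b ha hb hab
    rw [hQ.linked_iff, Finset.map_sdiff, Finset.map_insert, Finset.map_singleton]
    · rfl
    · rw [card_insert_of_notMem (by simp), card_sdiff_of_subset
        (by simp [insert_subset_iff, ha, hb]), card_pair hab]
      omega
    · simp
  unfold linkCount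
  refine card_nbij (fun p => (↑p.1, ↑p.2)) ?_ ?_ ?_
  · rintro ⟨a, b⟩ hp
    simp only [coe_filter, mem_offDiag, Set.mem_ofPred_eq] at hp ⊢
    obtain ⟨⟨ha, hb, hab⟩, hl⟩ := hp
    exact ⟨⟨mem_map_of_mem _ ha, mem_map_of_mem _ hb, fun e => hab (Subtype.ext e)⟩,
      (key a b ha hb hab).1 hl⟩
  · rintro ⟨a, b⟩ _ ⟨c, d⟩ _ h
    simp only [Prod.mk.injEq, Subtype.ext_iff] at h ⊢
    exact h
  · rintro ⟨a, b⟩ hp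
    simp only [coe_filter, mem_offDiag, Set.mem_ofPred_eq] at hp
    obtain ⟨⟨ha, hb, hab⟩, hl⟩ := hp
    obtain ⟨a, ha', rfl⟩ := mem_map.1 ha
    obtain ⟨b, hb', rfl⟩ := mem_map.1 hb
    have hab' : a ≠ b := fun e => hab (by rw [e])
    exact ⟨(a, b), by
      simp only [coe_filter, mem_offDiag, Set.mem_ofPred_eq]
      exact ⟨⟨ha', hb', hab'⟩, (key a b ha' hb' hab').2 hl⟩, rfl⟩

theorem IsMaxTwoSubgroup.index_induced {G Q : Subgroup (Perm α)} {i : ℕ}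
    (hQ : IsMaxTwoSubgroup G Q i) (S : Finset (fixedFinset Q)) (hS : i ≤ #S) :
    (induced (reduced G Q) S).index =
      (induced G (S.map (Function.Embedding.subtype _))).index := by
  let e : S ≃ S.map (Function.Embedding.subtype (fun x => x ∈ fixedFinset Q)) :=
    Equiv.ofBijective (fun x => ⟨((x : fixedFinset Q) : α), mem_map_of_mem _ x.2⟩)
      ⟨fun x y h => Subtype.ext (Subtype.ext (Subtype.mk.inj h)), fun ⟨y, hy⟩ => by
        obtain ⟨x, hx, rfl⟩ := mem_map.1 hy
        exact ⟨⟨x, hx⟩, rfl⟩⟩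
  have h1 : induced (reduced G Q) S = (induced G (S.map (Function.Embedding.subtype _))).comap
      e.permCongrHom.toMonoidHom := by
    have hval : ∀ x : S.map (Function.Embedding.subtype _), ((e.symm x : S) : α) = x := by
      intro x
      obtain ⟨y, rfl⟩ := e.surjective x
      rw [e.symm_apply_apply]; rfl
    ext τ
    rw [Subgroup.mem_comap, mem_induced, mem_induced]
    constructor
    · rintro ⟨σ, ⟨h, hh, -, hσ⟩, hστ⟩
      refine ⟨h, hh, fun x => ?_⟩
      rw [← hval x, hσ, hστ]
      rfl
    · rintro ⟨g, hg, hgτ⟩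
      obtain ⟨σ, hσ, h2⟩ := hQ.exists_reduced S hS hg
        (fun x => if hx : x ∈ S then τ ⟨x, hx⟩ else x) (fun x hx => by
          rw [dif_pos hx]
          have := hgτ (e ⟨x, hx⟩)
          refine this.trans ?_
          show ((e (τ (e.symm (e ⟨x, hx⟩))) : _) : α) = _
          rw [e.symm_apply_apply]; rfl)
      exact ⟨σ, hσ, fun x => by rw [h2 x x.2, dif_pos x.2]⟩
  rw [h1]
  exact Subgroup.index_comap_of_surjective _ e.permCongrHom.surjective

/-- Transitivity passes back from the reduced group to a homogeneous group. -/
theorem IsMaxTwoSubgroup.isMultTransitive_of_reduced {G Q : Subgroup (Perm α)} {k : ℕ}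
    (hQ : IsMaxTwoSubgroup G Q k) (hh : IsHomogeneous G k)
    (ht : IsMultTransitive (reduced G Q) k) : IsMultTransitive G k := by
  obtain ⟨S, -, hS⟩ := exists_superset_card (∅ : Finset (fixedFinset Q)) (by simp)
    (by simpa using hQ.le_card)
  refine hh.isMultTransitive_of_index (hQ.le_card.trans (card_le_univ _))
    (S.map (Function.Embedding.subtype _)) (by rwa [card_map]) ?_
  rw [← hQ.index_induced S hS.ge, Subgroup.index_eq_one]
  exact ht.induced_eq_top S hS.le

theorem IsMaxTwoSubgroup.noInvolutionFixing {G Q : Subgroup (Perm α)} {i : ℕ}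
    (hQ : IsMaxTwoSubgroup G Q i) : NoInvolutionFixing (reduced G Q) i := by
  rintro σ ⟨h, hh, hn, hσ⟩ h2 S hS hfix
  obtain ⟨k, m, ⟨l, hl⟩, hm⟩ := Nat.exists_eq_two_pow_mul_odd (orderOf_pos h).ne'
  -- the odd power `h ^ m` has 2-power order and induces `σ` as well
  have hpow : ∀ n : ℕ, ∀ x : fixedFinset Q, (h ^ n) x = (σ ^ n) x := by
    intro n
    induction n with
    | zero => intro x; rfl
    | succ n ih => intro x; rw [pow_succ', pow_succ', Perm.mul_apply, ih, hσ]; rfl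
  have hσm : σ ^ m = σ := by rw [hl, pow_succ, pow_mul, pow_two, h2, one_pow, one_mul]
  have hz : IsPGroup 2 (Subgroup.zpowers (h ^ m)) := by
    refine IsPGroup.of_card (n := k) ?_
    rw [Nat.card_zpowers, orderOf_pow' _ (by omega), hm, Nat.gcd_mul_left_left,
      Nat.mul_div_cancel _ (by omega)]
  have hle : Subgroup.zpowers (h ^ m) ≤ Subgroup.normalizer (Q : Set (Perm α)) := by
    rw [Subgroup.zpowers_le]; exact Subgroup.pow_mem _ hn m
  have hp := hz.to_sup_of_normal_right' hQ.isPGroup hle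
  have h3 := hQ.max (Subgroup.zpowers (h ^ m) ⊔ Q)
    (sup_le (by rw [Subgroup.zpowers_le]; exact G.pow_mem hh m) hQ.le) hp (by
      rw [← card_map (Function.Embedding.subtype _)] at hS
      refine hS.trans (card_le_card fun x hx => mem_fixedFinset.2 fun q hq => ?_)
      obtain ⟨z, hz, rfl⟩ := mem_map.1 hx
      have hle2 : Subgroup.zpowers (h ^ m) ⊔ Q ≤ MulAction.stabilizer (Perm α) (z : α) := by
        refine sup_le ?_ fun q hq => mem_fixedFinset.1 z.2 q hq
        rw [Subgroup.zpowers_le, MulAction.mem_stabilizer_iff, Perm.smul_def, hpow, hσm, hfix z hz]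
      exact hle2 hq)
  have h4 := Subgroup.eq_of_le_of_card_ge (le_sup_right (a := Subgroup.zpowers (h ^ m))) h3
  have h5 : h ^ m ∈ Q := by
    rw [h4]; exact Subgroup.mem_sup_left (Subgroup.mem_zpowers _)
  ext x
  rw [← hσm, ← hpow, mem_fixedFinset.1 x.2 _ h5]
  rfl

/-- If `Q` is maximal for `k + 1` points but some larger 2-subgroup fixes `k` points, then in the
reduced group every `k`-set is fixed pointwise by an involution: a conjugate of the larger group
fixes the given `k`-set, and `Q` has index 2 in some 2-subgroup of the pointwise stabilizer. -/
theorem IsMaxTwoSubgroup.exists_involution {G Q : Subgroup (Perm α)} {k : ℕ}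
    (hQ : IsMaxTwoSubgroup G Q (k + 1)) (hQ' : ¬ IsMaxTwoSubgroup G Q k)
    (hh : IsHomogeneous G k) (Λ : Finset (fixedFinset Q)) (hΛ : #Λ = k) :
    ∃ σ ∈ reduced G Q, σ * σ = 1 ∧ σ ≠ 1 ∧ ∀ x ∈ Λ, σ x = x := by
  obtain ⟨R, hRG, hR2, hRk, hRQ⟩ : ∃ R ≤ G, IsPGroup 2 R ∧ k ≤ #(fixedFinset R) ∧
      Nat.card Q < Nat.card R := by
    by_contra! hcon
    exact hQ' ⟨hQ.le, hQ.isPGroup, by have := hQ.le_card; omega, hcon⟩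
  set L : Finset α := Λ.map (Function.Embedding.subtype _) with hL
  obtain ⟨M, hMR, hM⟩ := Finset.exists_subset_card_eq hRk
  obtain ⟨g, hg, hgM⟩ := hh M L hM (by rw [hL, card_map, hΛ])
  have hgL := image_eq_of_forall_mem hgM (by rw [hL, card_map]; omega)
  have hR'P : R.map (MulAut.conj g).toMonoidHom ≤ fixer G L := by
    rintro _ ⟨q, hq, rfl⟩
    refine ⟨G.mul_mem (G.mul_mem hg (hRG hq)) (G.inv_mem hg), fun x hx => ?_⟩
    rw [← hgL] at hx
    obtain ⟨z, hz, rfl⟩ := mem_image.1 hx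
    have := mem_fixedFinset.1 (hMR hz) q hq
    simp [this]
  have hQP : Q ≤ fixer G L := by
    refine fun q hq => ⟨hQ.le hq, fun x hx => ?_⟩
    obtain ⟨z, hz, rfl⟩ := mem_map.1 hx
    exact mem_fixedFinset.1 z.2 q hq
  obtain ⟨a, ha⟩ := IsPGroup.iff_card.1 hQ.isPGroup
  obtain ⟨b, hb⟩ := IsPGroup.iff_card.1 hR2
  have hab : a < b := by
    rw [ha, hb] at hRQ
    exact (Nat.pow_lt_pow_iff_right (by norm_num)).1 hRQ
  have hdvd : 2 ^ (a + 1) ∣ Nat.card (fixer G L) := by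
    refine (pow_dvd_pow 2 hab).trans ?_
    rw [← hb, ← Subgroup.card_map_of_injective (K := R) (f := (MulAut.conj g).toMonoidHom)
      (MulAut.conj g).injective]
    exact Subgroup.card_dvd_of_le hR'P
  obtain ⟨K, hK, hQK⟩ := Sylow.exists_subgroup_card_pow_succ hdvd
    (H := Q.subgroupOf (fixer G L))
    (by rw [Nat.card_congr (Subgroup.subgroupOfEquivOfLe hQP).toEquiv, ha])
  set K' := K.map (fixer G L).subtype with hK'
  have hK'card : Nat.card K' = 2 ^ (a + 1) := by
    rw [hK', Subgroup.card_map_of_injective (fixer G L).subtype_injective, hK]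
  have hK'P : K' ≤ fixer G L := by rintro _ ⟨x, -, rfl⟩; exact x.2
  have hQK' : Q ≤ K' := fun x hx => ⟨⟨x, hQP hx⟩, hQK hx, rfl⟩
  have hindex : (Q.subgroupOf K').index = 2 := by
    have := (Q.subgroupOf K').card_mul_index
    rw [Nat.card_congr (Subgroup.subgroupOfEquivOfLe hQK').toEquiv, ha, hK'card, pow_succ] at this
    exact Nat.eq_of_mul_eq_mul_left (by positivity) this
  obtain ⟨y, hyK, hyF⟩ : ∃ y ∈ K', ∃ x ∈ fixedFinset Q, y x ≠ x := by
    by_contra! hcon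
    have h1 := hQ.max K' (hK'P.trans (fixer_le G L)) (IsPGroup.of_card hK'card)
      (hQ.le_card.trans (card_le_card fun x hx => mem_fixedFinset.2 fun q hq => hcon q hq x hx))
    rw [ha, hK'card] at h1
    exact absurd ((Nat.pow_le_pow_iff_right (by norm_num)).1 h1) (by omega)
  have hnormal : (Q.subgroupOf K').Normal := Subgroup.normal_of_index_eq_two hindex
  have hyn : y ∈ Subgroup.normalizer (Q : Set (Perm α)) := by
    rw [Subgroup.mem_normalizer_iff]
    intro q
    constructor
    · intro hq
      exact hnormal.conj_mem ⟨q, hQK' hq⟩ hq ⟨y, hyK⟩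
    · intro hq
      have := hnormal.conj_mem ⟨_, hQK' hq⟩ hq ⟨y, hyK⟩⁻¹
      rw [Subgroup.mem_subgroupOf] at this
      simpa [mul_assoc] using this
  obtain ⟨σ, hσ, hyσ⟩ := exists_mem_reduced (hK'P hyK).1 hyn
  refine ⟨σ, hσ, ?_, ?_, fun x hx => Subtype.ext ?_⟩
  · ext x
    have h1 : y ^ 2 ∈ Q := Subgroup.sq_mem_of_index_two hindex (⟨y, hyK⟩ : K')
    rw [Perm.mul_apply, ← hyσ, ← hyσ, ← Perm.mul_apply, ← pow_two, mem_fixedFinset.1 x.2 _ h1]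
    rfl
  · rintro rfl
    obtain ⟨x, hx, hne⟩ := hyF
    exact hne (hyσ ⟨x, hx⟩)
  · rw [← hyσ]
    exact (hK'P hyK).2 _ (mem_map_of_mem _ hx)

end

/-! ### Transitivity from involutions that fix exactly `k` points -/

section

variable {α : Type*} [DecidableEq α] [Fintype α]

/-- A self-map `Φ` of enumerations of `S`, that is of permutations restricted to `S`, that is
injective on `G`-classes reaches the class of the identity. -/
theorem exists_apply_eq_of_class_injective (G : Subgroup (Perm α)) (S : Finset α)
    (Φ : Perm α → Perm α) (hΦ : ∀ σ τ : Perm α, (∃ g ∈ G, ∀ x ∈ S, g (Φ σ x) = Φ τ x) →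
      ∃ g ∈ G, ∀ x ∈ S, g (σ x) = τ x) :
    ∃ σ, ∃ g ∈ G, ∀ x ∈ S, g (Φ σ x) = x := by
  let s : Setoid (Perm α) :=
    { r := fun σ τ => ∃ g ∈ G, ∀ x ∈ S, g (σ x) = τ x
      iseqv :=
        { refl := fun σ => ⟨1, G.one_mem, fun _ _ => rfl⟩
          symm := by
            rintro σ τ ⟨g, hg, h⟩
            exact ⟨g⁻¹, G.inv_mem hg, fun x hx => by rw [Perm.inv_eq_iff_eq, h x hx]⟩
          trans := by
            rintro σ τ ρ ⟨g, hg, h⟩ ⟨g', hg', h'⟩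
            exact ⟨g' * g, G.mul_mem hg' hg, fun x hx => by
              rw [Perm.mul_apply, h x hx, h' x hx]⟩ } }
  have hinj : Function.Injective (fun q : Quotient s => (Quotient.mk s (Φ q.out))) := by
    intro p q hpq
    rw [← p.out_eq, ← q.out_eq]
    exact Quotient.sound (hΦ _ _ (Quotient.exact hpq))
  obtain ⟨q, hq⟩ := Finite.surjective_of_injective hinj (Quotient.mk s 1)
  exact ⟨q.out, Quotient.exact hq⟩

/-- If every `k`-set is the set of fixed points of an involution, and no involution fixes more, then
a `(k+1)`-homogeneous group is `(k+1)`-transitive.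

Enumerations of `(k+1)`-sets are the permutations `σ` of `α`, restricted to a fixed `(k+1)`-set that
contains `a` and `b`. Let `y` be the involution that fixes the points `σ x` with `x ≠ b`. Replacing
the entries `σ a`, `σ b` by `σ b`, `y (σ b)` is injective on `G`-classes, since the
new entries determine `y` up to conjugation and `σ a` is the remaining fixed point of `y`. By
finiteness it is onto, so that `a` and `b` can be swapped. -/
theorem isMultTransitive_of_involutions {G : Subgroup (Perm α)} {k : ℕ}
    (hh : IsHomogeneous G (k + 1)) (hn : k + 1 ≤ Fintype.card α)
    (hodd : NoInvolutionFixing G (k + 1))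
    (hinv : ∀ Λ : Finset α, #Λ = k → ∃ y ∈ G, y * y = 1 ∧ y ≠ 1 ∧ ∀ x ∈ Λ, y x = x) :
    IsMultTransitive G (k + 1) := by
  refine hh.isMultTransitive_of_swappable hn fun S hS a ha b hb hab => ?_
  choose! Y hYG hY2 hY1 hYfix using hinv
  let Λ : Perm α → Finset α := fun σ => (S.erase b).image σ
  have hΛ : ∀ σ, #(Λ σ) = k := fun σ => by
    rw [card_image_of_injective _ σ.injective, card_erase_of_mem hb, hS]; rfl
  have hYiff : ∀ σ x, Y (Λ σ) x = x ↔ x ∈ Λ σ := by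
    refine fun σ x => ⟨fun hx => ?_, fun hx => hYfix _ (hΛ σ) x hx⟩
    by_contra hxΛ
    refine hY1 _ (hΛ σ) (hodd _ (hYG _ (hΛ σ)) (hY2 _ (hΛ σ)) (insert x (Λ σ))
      (by rw [card_insert_of_notMem hxΛ, hΛ]) fun z hz => ?_)
    rcases mem_insert.1 hz with rfl | hz
    · exact hx
    · exact hYfix _ (hΛ σ) z hz
  have hYY : ∀ σ x, Y (Λ σ) (Y (Λ σ) x) = x := fun σ x => by
    rw [← Perm.mul_apply, hY2 _ (hΛ σ), Perm.one_apply]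
  have hmemΛ : ∀ σ : Perm α, ∀ x ∈ S, x ≠ b → σ x ∈ Λ σ := fun σ x hx hxb =>
    mem_image_of_mem _ (mem_erase.2 ⟨hxb, hx⟩)
  have hbΛ : ∀ σ : Perm α, σ b ∉ Λ σ := by
    intro σ h
    obtain ⟨x, hx, e⟩ := mem_image.1 h
    exact (mem_erase.1 hx).1 (σ.injective e)
  have hzb : ∀ σ : Perm α, Y (Λ σ) (σ b) ≠ σ b := fun σ e => hbΛ σ ((hYiff _ _).1 e)
  have hzΛ : ∀ σ : Perm α, Y (Λ σ) (σ b) ∉ Λ σ := fun σ e => by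
    have := (hYiff _ _).2 e
    rw [hYY] at this
    exact hzb σ this.symm
  let Φ : Perm α → Perm α := fun σ => swap (σ a) (σ b) * swap (σ b) (Y (Λ σ) (σ b)) * σ
  have hza : ∀ σ : Perm α, Y (Λ σ) (σ b) ≠ σ a := fun σ e => hzΛ σ (e ▸ hmemΛ σ a ha hab)
  have hΦa : ∀ σ, Φ σ a = σ b := fun σ => by
    simp only [Φ, Perm.mul_apply]
    rw [swap_apply_of_ne_of_ne (fun e => hab (σ.injective e)) (hza σ).symm, swap_apply_left]
  have hΦb : ∀ σ, Φ σ b = Y (Λ σ) (σ b) := fun σ => by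
    simp only [Φ, Perm.mul_apply]
    rw [swap_apply_left, swap_apply_of_ne_of_ne (hza σ) (hzb σ)]
  have hΦx : ∀ σ, ∀ x ∈ S, x ≠ a → x ≠ b → Φ σ x = σ x := fun σ x hx hxa hxb => by
    have hxz : σ x ≠ Y (Λ σ) (σ b) := fun e => hzΛ σ (e ▸ hmemΛ σ x hx hxb)
    simp only [Φ, Perm.mul_apply]
    rw [swap_apply_of_ne_of_ne (fun e => hxb (σ.injective e)) hxz,
      swap_apply_of_ne_of_ne (fun e => hxa (σ.injective e)) (fun e => hxb (σ.injective e))]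
  have hcancel : ∀ σ τ : Perm α, (∃ g ∈ G, ∀ x ∈ S, g (Φ σ x) = Φ τ x) →
      ∃ g ∈ G, ∀ x ∈ S, g (σ x) = τ x := by
    rintro σ τ ⟨g, hg, h⟩
    have hga := h a ha
    have hgb := h b hb
    rw [hΦa, hΦa] at hga
    rw [hΦb, hΦb] at hgb
    obtain ⟨f, hf, h1, h2⟩ := hodd.lift (hYG _ (hΛ σ)) (hY2 _ (hΛ σ)) (hYG _ (hΛ τ))
      (hY2 _ (hΛ τ)) hg (S.image (Φ σ))
      (by rw [card_image_of_injective _ (Φ σ).injective, hS]) (by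
        intro x hx
        obtain ⟨w, hw, rfl⟩ := mem_image.1 hx
        by_cases hwa : w = a
        · rw [hwa, hΦa, hgb, hga]
        by_cases hwb : w = b
        · rw [hwb, hΦb, hYY, hga, hgb, hYY]
        rw [hΦx σ w hw hwa hwb, (hYiff _ _).2 (hmemΛ σ w hw hwb), ← hΦx σ w hw hwa hwb, h w hw,
          hΦx τ w hw hwa hwb, (hYiff _ _).2 (hmemΛ τ w hw hwb)])
    have h3 : ∀ x ∈ S, x ≠ a → f (σ x) = τ x := by
      intro x hx hxa
      by_cases hxb : x = b
      · rw [hxb, ← hga, ← hΦa, h1 _ (mem_image_of_mem _ ha)]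
      · rw [← hΦx σ x hx hxa hxb, h1 _ (mem_image_of_mem _ hx), h x hx, hΦx τ x hx hxa hxb]
    refine ⟨f, hf, fun x hx => ?_⟩
    by_cases hxa : x = a
    · have h4 : f (σ a) ∈ Λ τ := by
        rw [← hYiff, ← h2, (hYiff _ _).2 (hmemΛ σ a ha hab)]
      obtain ⟨w, hw, e⟩ := mem_image.1 h4
      rw [mem_erase] at hw
      by_cases hwa : w = a
      · rw [hxa, ← e, hwa]
      · rw [← h3 w hw.2 hwa] at e
        exact absurd (σ.injective (f.injective e)) hwa
    · exact h3 x hx hxa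
  obtain ⟨σ, g, hg, h⟩ := exists_apply_eq_of_class_injective G S Φ hcancel
  refine ⟨g * Y (Λ σ) * g⁻¹, G.mul_mem (G.mul_mem hg (hYG _ (hΛ σ))) (G.inv_mem hg),
    fun x hx => ?_⟩
  have e : g⁻¹ x = Φ σ x := by rw [Perm.inv_eq_iff_eq, h x hx]
  rw [Perm.mul_apply, Perm.mul_apply, e]
  by_cases hxa : x = a
  · rw [hxa, hΦa, swap_apply_left, ← hΦb, h b hb]
  by_cases hxb : x = b
  · rw [hxb, hΦb, hYY, swap_apply_right, ← hΦa, h a ha]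
  rw [swap_apply_of_ne_of_ne hxa hxb, hΦx σ x hx hxa hxb, (hYiff _ _).2 (hmemΛ σ x hx hxb),
    ← hΦx σ x hx hxa hxb, h x hx]

/-- The two ways to reduce: either a group that is `k`- and `(k+1)`-homogeneous is
`(k+1)`-transitive, or a 2-subgroup that is maximal for `k + 1` points is so for `k` points. -/
theorem isMultTransitive_or_isMaxTwoSubgroup {G Q : Subgroup (Perm α)} {k : ℕ}
    (hQ : IsMaxTwoSubgroup G Q (k + 1)) (hh : IsHomogeneous G k)
    (hh' : IsHomogeneous G (k + 1)) :
    IsMultTransitive G (k + 1) ∨ IsMaxTwoSubgroup G Q k := by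
  by_cases hQ' : IsMaxTwoSubgroup G Q k
  · exact Or.inr hQ'
  · exact Or.inl (hQ.isMultTransitive_of_reduced hh' (isMultTransitive_of_involutions
      (hQ.isHomogeneous le_rfl hh') (by simpa using hQ.le_card) hQ.noInvolutionFixing
      (fun Λ hΛ => hQ.exists_involution hQ' hh Λ hΛ)))

end

/-! ### Centralizers of involutions in multiply transitive groups -/

section

variable {α : Type*} [DecidableEq α] [Fintype α]

theorem even_card_filter_ne (y : Perm α) (hy : y * y = 1) : Even #{x | y x ≠ x} := by
  have hyy : ∀ x, y (y x) = x := fun x => by rw [← Perm.mul_apply, hy, Perm.one_apply]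
  refine even_card_of_involution _ y (fun x hx => ?_) (fun x hx => ?_) fun x _ => hyy x
  · rw [mem_filter] at hx ⊢
    exact ⟨mem_univ _, fun e => hx.2 (y.injective e)⟩
  · exact (mem_filter.1 hx).2

theorem card_eq_of_fixed_iff (y : Perm α) (Λ : Finset α) (hΛ : ∀ x, y x = x ↔ x ∈ Λ) :
    Fintype.card α = #Λ + #{x | y x ≠ x} := by
  rw [← card_univ, ← card_filter_add_card_filter_not (s := univ) (fun x => y x = x)]
  congr 2
  ext x
  simp [hΛ]

/-- A partial map that commutes with an involution `y` on `K` points is induced by an element of the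
centralizer of `y`. -/
theorem NoInvolutionFixing.exists_commuting {G : Subgroup (Perm α)} {K : ℕ}
    (hodd : NoInvolutionFixing G K) (ht : IsMultTransitive G K) {y : Perm α} (hy : y ∈ G)
    (hy2 : y * y = 1) (S : Finset α) (hS : #S = K) (f : α → α) (hf : Set.InjOn f S)
    (hfy : ∀ s ∈ S, y s ∈ S ∧ f (y s) = y (f s)) :
    ∃ h ∈ G, (∀ s ∈ S, h s = f s) ∧ ∀ z, h (y z) = y (h z) := by
  obtain ⟨g, hg, h1⟩ := ht.exists_eq S f hS.le hf
  obtain ⟨h, hh, h2, h3⟩ := hodd.lift hy hy2 hy hy2 hg S hS.ge (fun s hs => by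
    rw [h1 _ (hfy s hs).1, h1 s hs, (hfy s hs).2])
  exact ⟨h, hh, fun s hs => (h2 s hs).trans (h1 s hs), h3⟩

theorem NoInvolutionFixing.exists_commuting_move {G : Subgroup (Perm α)} {K : ℕ}
    (hodd : NoInvolutionFixing G (K + 2)) (ht : IsMultTransitive G (K + 2)) {y : Perm α}
    (hy : y ∈ G) (hy2 : y * y = 1) (R : Finset α) (hR : #R = K) (hRy : ∀ z ∈ R, y z ∈ R)
    {u w : α} (hu : u ∉ R) (hw : w ∉ R) (hyu : y u ≠ u) (hyw : y w ≠ w) :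
    ∃ h ∈ G, (∀ z ∈ R, h z = z) ∧ h u = w ∧ ∀ z, h (y z) = y (h z) := by
  have hyy : ∀ x, y (y x) = x := fun x => by rw [← Perm.mul_apply, hy2, Perm.one_apply]
  have hyR : ∀ z, z ∉ R → y z ∉ R := fun z hz h => hz (by have := hRy _ h; rwa [hyy] at this)
  have hne : ∀ z ∈ R, z ≠ u ∧ z ≠ y u ∧ z ≠ w ∧ z ≠ y w := fun z hz =>
    ⟨fun e => hu (e ▸ hz), fun e => hyR u hu (e ▸ hz), fun e => hw (e ▸ hz),
      fun e => hyR w hw (e ▸ hz)⟩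
  let f : α → α := fun z => if z = u then w else if z = y u then y w else z
  have fu : f u = w := if_pos rfl
  have fyu : f (y u) = y w := by simp [f, hyu]
  have fR : ∀ z ∈ R, f z = z := fun z hz => by simp [f, (hne z hz).1, (hne z hz).2.1]
  obtain ⟨h, hh, h1, h2⟩ := hodd.exists_commuting ht hy hy2 (insert u (insert (y u) R))
    (by rw [card_insert_of_notMem (by simp [hyu.symm, hu]), card_insert_of_notMem (hyR u hu), hR])
    f (by
      intro a ha b hb hab
      simp only [coe_insert, Set.mem_insert_iff, mem_coe] at ha hb
      rcases ha with rfl | rfl | ha <;> rcases hb with rfl | rfl | hb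
      · rfl
      · rw [fu, fyu] at hab; exact absurd hab.symm hyw
      · rw [fu, fR b hb] at hab; exact absurd hab.symm (hne b hb).2.2.1
      · rw [fu, fyu] at hab; exact absurd hab hyw
      · rfl
      · rw [fyu, fR b hb] at hab; exact absurd hab.symm (hne b hb).2.2.2
      · rw [fu, fR a ha] at hab; exact absurd hab (hne a ha).2.2.1
      · rw [fyu, fR a ha] at hab; exact absurd hab (hne a ha).2.2.2
      · rwa [fR a ha, fR b hb] at hab) (by
      intro s hs
      simp only [mem_insert] at hs ⊢
      rcases hs with rfl | rfl | hs
      · exact ⟨Or.inr (Or.inl rfl), by rw [fu, fyu]⟩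
      · exact ⟨Or.inl (hyy _), by rw [hyy, fu, fyu, hyy]⟩
      · exact ⟨Or.inr (Or.inr (hRy s hs)), by rw [fR s hs, fR _ (hRy s hs)]⟩)
  exact ⟨h, hh, fun z hz => by rw [h1 z (by simp [hz]), fR z hz],
    by rw [h1 u (by simp), fu], h2⟩

theorem IsHomogeneous.index_induced_eq {G : Subgroup (Perm α)} {k : ℕ} (h : IsHomogeneous G k)
    (hk : k ≤ Fintype.card α) {S T : Finset α} (hS : #S = k) (hT : #T = k) :
    (induced G S).index = (induced G T).index := by
  have e1 := h.card_eq S hS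
  rw [← h.card_eq T hT, h.card_fixer_eq hS hT] at e1
  have e2 := Nat.eq_of_mul_eq_mul_left (Nat.choose_pos hk) e1
  have e3 := Nat.eq_of_mul_eq_mul_right Nat.card_pos e2
  have e4 := (induced G S).card_mul_index
  have e5 := (induced G T).card_mul_index
  rw [Nat.card_perm, Nat.card_eq_finsetCard, hS] at e4
  rw [Nat.card_perm, Nat.card_eq_finsetCard, hT, ← e4, e3] at e5
  exact (Nat.eq_of_mul_eq_mul_left Nat.card_pos e5).symm

/-- If among any three points outside `Γ` two are linked, then the group induced on a larger set by
one point has index at most 2. -/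
theorem index_induced_le_two {G : Subgroup (Perm α)} {K : ℕ} (ht : IsMultTransitive G K)
    (Γ : Finset α) (hΓ : #Γ = K) {p : α} (hp : p ∉ Γ)
    (h3 : ∀ u₁ u₂ u₃, u₁ ∉ Γ → u₂ ∉ Γ → u₃ ∉ Γ →
      Linked G Γ u₁ u₂ ∨ Linked G Γ u₁ u₃ ∨ Linked G Γ u₂ u₃) :
    (induced G (insert p Γ)).index ≤ 2 := by
  set S := insert p Γ with hS
  have hpS : p ∈ S := mem_insert_self _ _
  have hΓS : ∀ x ∈ Γ, x ∈ S := fun x hx => mem_insert_of_mem hx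
  -- `τ` is straightened on `Γ` by an element of `G`, and is then described by one point
  have hstr : ∀ τ : Perm S, ∃ g ∈ G, ∀ x, (hx : x ∈ Γ) → g (τ ⟨x, hΓS x hx⟩) = x := by
    intro τ
    obtain ⟨g, hg, h1⟩ := ht.exists_eq Γ (fun x => if hx : x ∈ S then τ ⟨x, hx⟩ else x) hΓ.le (by
      intro a ha b hb hab
      simp only [dif_pos (hΓS a ha), dif_pos (hΓS b hb)] at hab
      exact congrArg Subtype.val (τ.injective (Subtype.ext hab)))
    refine ⟨g⁻¹, G.inv_mem hg, fun x hx => ?_⟩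
    rw [Perm.inv_eq_iff_eq, h1 x hx, dif_pos (hΓS x hx)]
  choose g hgG hg using hstr
  have hpg : ∀ τ : Perm S, g τ (τ ⟨p, hpS⟩) ∉ Γ := by
    intro τ hmem
    have := hg τ _ hmem
    have h2 := τ.injective (Subtype.ext ((g τ).injective this))
    rw [Subtype.mk.injEq] at h2
    rw [h2] at hmem
    exact hp hmem
  have hlink : ∀ τ ρ : Perm S, Linked G Γ (g τ (τ ⟨p, hpS⟩)) (g ρ (ρ ⟨p, hpS⟩)) →
      ρ * τ⁻¹ ∈ induced G S := by
    rintro τ ρ ⟨f, hf, hf1, hf2⟩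
    refine ⟨(g ρ)⁻¹ * f * g τ, G.mul_mem (G.mul_mem (G.inv_mem (hgG ρ)) hf) (hgG τ), fun x => ?_⟩
    obtain ⟨⟨z, hz⟩, rfl⟩ := τ.surjective x
    rw [Perm.mul_apply, Perm.mul_apply, Perm.inv_eq_iff_eq, Perm.mul_apply, inv_apply_self']
    rcases mem_insert.1 hz with rfl | hz'
    · exact hf2
    · rw [hg τ z hz', hf1 z hz', hg ρ z hz']
  by_cases htop : induced G S = ⊤
  · rw [htop, Subgroup.index_top]; omega
  · obtain ⟨a, ha⟩ : ∃ a, a ∉ induced G S := by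
      by_contra! hall
      exact htop (eq_top_iff.2 fun x _ => hall x)
    refine le_of_eq (Subgroup.index_eq_two_iff.2 ⟨a⁻¹, fun b => ?_⟩)
    have h4 := h3 _ _ _ (hpg 1) (hpg a) (hpg b)
    rcases h4 with h | h | h
    · exact absurd (by simpa using hlink _ _ h) ha
    · have hb : b ∈ induced G S := by simpa using hlink _ _ h
      refine Or.inr ⟨hb, fun hba => ha ?_⟩
      simpa using (induced G S).mul_mem ((induced G S).inv_mem hba) hb
    · have hb := hlink _ _ h
      refine Or.inl ⟨hb, fun hb' => ha ?_⟩
      simpa using (induced G S).mul_mem ((induced G S).inv_mem hb) hb'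

/-- The case of an involution that swaps two points of a `K`-set `Γ` and whose fixed points are the
others. -/
theorem linked_of_involution {G : Subgroup (Perm α)} {K : ℕ} (hK : 2 ≤ K)
    (hodd : NoInvolutionFixing G (K + 2)) (ht : IsMultTransitive G (K + 2)) {y : Perm α}
    (hy : y ∈ G) (hy2 : y * y = 1) {x x' : α} (hxx' : x ≠ x') (hyx : y x = x') (Λ : Finset α)
    (hΛ : ∀ z, y z = z ↔ z ∈ Λ) (hΛc : #Λ = K) (u₁ u₂ u₃ : α)
    (h₁ : u₁ ∉ insert x (insert x' Λ)) (h₂ : u₂ ∉ insert x (insert x' Λ))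
    (h₃ : u₃ ∉ insert x (insert x' Λ)) :
    Linked G (insert x (insert x' Λ)) u₁ u₂ ∨ Linked G (insert x (insert x' Λ)) u₁ u₃ ∨
      Linked G (insert x (insert x' Λ)) u₂ u₃ := by
  have hyy : ∀ z, y (y z) = z := fun z => by rw [← Perm.mul_apply, hy2, Perm.one_apply]
  have hyx' : y x' = x := by rw [← hyx, hyy]
  have hxΛ : x ∉ Λ := fun h => hxx' (((hΛ x).2 h).symm.trans hyx)
  have hx'Λ : x' ∉ Λ := fun h => hxx' (hyx'.symm.trans ((hΛ x').2 h))
  obtain ⟨p, hp, q, hq, hpq⟩ := one_lt_card.1 (show 1 < #Λ by omega)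
  set R := insert x (insert x' (Λ \ {p, q})) with hR
  have hRc : #R = K := by
    rw [hR, card_insert_of_notMem (by simp [hxx', hxΛ]), card_insert_of_notMem (by simp [hx'Λ]),
      card_sdiff_of_subset (by simp [insert_subset_iff, hp, hq]), card_pair hpq, hΛc]
    omega
  have hRy : ∀ z ∈ R, y z ∈ R := by
    intro z hz
    rcases mem_insert.1 hz with rfl | hz
    · rw [hyx, hR]; simp
    rcases mem_insert.1 hz with rfl | hz
    · rw [hyx', hR]; simp
    rw [(hΛ z).2 (mem_sdiff.1 hz).1, hR]
    exact mem_insert_of_mem (mem_insert_of_mem hz)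
  have hnR : ∀ u, u ∉ insert x (insert x' Λ) → u ∉ R ∧ y u ≠ u := by
    intro u hu
    simp only [mem_insert, not_or] at hu
    refine ⟨?_, fun e => hu.2.2 ((hΛ u).1 e)⟩
    simp only [hR, mem_insert, mem_sdiff]
    tauto
  have hmove : ∀ u w, u ∉ insert x (insert x' Λ) → w ∉ insert x (insert x' Λ) →
      ∃ h ∈ G, (∀ z ∈ R, h z = z) ∧ h u = w ∧ (h p = p ∧ h q = q ∨ h p = q ∧ h q = p) := by
    intro u w hu hw
    obtain ⟨h, hh, hR', huw, hcomm⟩ := hodd.exists_commuting_move ht hy hy2 R hRc hRy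
      (hnR u hu).1 (hnR w hw).1 (hnR u hu).2 (hnR w hw).2
    have hpres : ∀ z ∈ Λ, h z ∈ Λ := fun z hz => by
      rw [← hΛ, ← hcomm, (hΛ z).2 hz]
    have hpq' : ∀ z ∈ Λ, z = p ∨ z = q → h z = p ∨ h z = q := by
      intro z hz hzpq
      by_contra hcon
      have hzR : h z ∈ R := by
        rw [hR]
        refine mem_insert_of_mem (mem_insert_of_mem (mem_sdiff.2 ⟨hpres z hz, ?_⟩))
        simpa using hcon
      have e := h.injective (hR' _ hzR)
      rw [e] at hcon
      exact hcon hzpq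
    refine ⟨h, hh, hR', huw, ?_⟩
    have hne : h p ≠ h q := fun e => hpq (h.injective e)
    rcases hpq' p hp (Or.inl rfl) with h1 | h1 <;> rcases hpq' q hq (Or.inr rfl) with h2 | h2
    · exact absurd (h1.trans h2.symm) hne
    · exact Or.inl ⟨h1, h2⟩
    · exact Or.inr ⟨h1, h2⟩
    · exact absurd (h1.trans h2.symm) hne
  have hfin : ∀ h : Perm α, (∀ z ∈ R, h z = z) → h p = p → h q = q →
      ∀ z ∈ insert x (insert x' Λ), h z = z := by
    intro h hR' hp' hq' z hz
    by_cases hzp : z = p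
    · rw [hzp, hp']
    by_cases hzq : z = q
    · rw [hzq, hq']
    refine hR' z ?_
    simp only [hR, mem_insert, mem_sdiff, mem_singleton] at hz ⊢
    tauto
  obtain ⟨f, hf, hfR, hf12, hfpq⟩ := hmove u₁ u₂ h₁ h₂
  obtain ⟨g, hg, hgR, hg13, hgpq⟩ := hmove u₁ u₃ h₁ h₃
  rcases hfpq with ⟨h1, h2⟩ | ⟨h1, h2⟩
  · exact Or.inl ⟨f, hf, hfin f hfR h1 h2, hf12⟩
  rcases hgpq with ⟨h3, h4⟩ | ⟨h3, h4⟩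
  · exact Or.inr (Or.inl ⟨g, hg, hfin g hgR h3 h4, hg13⟩)
  · have finv : ∀ {a b}, f a = b → f⁻¹ b = a := fun e => by rw [Perm.inv_eq_iff_eq, e]
    refine Or.inr (Or.inr ⟨g * f⁻¹, G.mul_mem hg (G.inv_mem hf), hfin _ (fun z hz => ?_) ?_ ?_, ?_⟩)
    · rw [Perm.mul_apply, finv (hfR z hz), hgR z hz]
    · rw [Perm.mul_apply, finv h2, h4]
    · rw [Perm.mul_apply, finv h1, h3]
    · rw [Perm.mul_apply, finv hf12, hg13]

end

/-! ### The index of the group induced on a homogeneity set -/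

section

variable {α : Type*} [DecidableEq α] [Fintype α]

/-- Points fixed by the involution `y` can be swapped by elements of its centralizer. -/
theorem swappable_of_fixed {G : Subgroup (Perm α)} {K : ℕ} (hK : 2 ≤ K)
    (hodd : NoInvolutionFixing G (K + 2)) (ht : IsMultTransitive G (K + 2)) {y : Perm α}
    (hy : y ∈ G) (hy2 : y * y = 1) {x x' : α} (hxx' : x ≠ x') (hyx : y x = x') (hyx' : y x' = x)
    (Λ : Finset α) (hΛ : ∀ z, y z = z ↔ z ∈ Λ) (hΛc : #Λ = K + 1)
    (hxΛ : x ∉ Λ) (hx'Λ : x' ∉ Λ) {a b : α} (ha : a ∈ Λ) (hb : b ∈ Λ) (hab : a ≠ b) :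
    Swappable G (insert x (insert x' Λ)) a b := by
  have hyy : ∀ z, y (y z) = z := fun z => by rw [← Perm.mul_apply, hy2, Perm.one_apply]
  obtain ⟨c, hc⟩ : (Λ \ {a, b}).Nonempty := by
    rw [← card_pos, card_sdiff_of_subset (by simp [insert_subset_iff, ha, hb]), card_pair hab]
    omega
  simp only [mem_sdiff, mem_insert, mem_singleton, not_or] at hc
  obtain ⟨hc, hca, hcb⟩ := hc
  set Δ := insert x (insert x' Λ) with hΔ
  have hcΔ : c ∈ Δ := by simp [hΔ, hc]
  have hΔc : #Δ = K + 3 := by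
    rw [hΔ, card_insert_of_notMem (by simp [hxx', hxΛ]), card_insert_of_notMem hx'Λ, hΛc]
  have hxa : x ≠ a := fun e => hxΛ (e ▸ ha)
  have hxb : x ≠ b := fun e => hxΛ (e ▸ hb)
  have hx'a : x' ≠ a := fun e => hx'Λ (e ▸ ha)
  have hx'b : x' ≠ b := fun e => hx'Λ (e ▸ hb)
  have hxc : x ≠ c := fun e => hxΛ (e ▸ hc)
  have hx'c : x' ≠ c := fun e => hx'Λ (e ▸ hc)
  obtain ⟨h, hh, h1, h2⟩ := hodd.exists_commuting ht hy hy2 (Δ.erase c)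
    (by rw [card_erase_of_mem hcΔ, hΔc]; rfl) (swap a b) ((swap a b).injective.injOn) (by
      intro s hs
      rw [mem_erase] at hs
      rcases mem_insert.1 hs.2 with rfl | hs'
      · rw [hyx, swap_apply_of_ne_of_ne hxa hxb, swap_apply_of_ne_of_ne hx'a hx'b, hyx]
        exact ⟨mem_erase.2 ⟨hx'c, by simp [hΔ]⟩, rfl⟩
      rcases mem_insert.1 hs' with rfl | hs'
      · rw [hyx', swap_apply_of_ne_of_ne hxa hxb, swap_apply_of_ne_of_ne hx'a hx'b, hyx']
        exact ⟨mem_erase.2 ⟨hxc, by simp [hΔ]⟩, rfl⟩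
      · rw [(hΛ s).2 hs', (hΛ _).2 (swap_mem_of_mem ha hb hs')]
        exact ⟨mem_erase.2 hs, rfl⟩)
  have hcc : h c = c := by
    by_contra hne
    have hmem : h c ∈ Λ := by rw [← hΛ, ← h2, (hΛ c).2 hc]
    have hsw : swap a b (h c) ∈ Δ.erase c := by
      refine mem_erase.2 ⟨fun e => hne ?_, ?_⟩
      · rw [← swap_apply_self a b (h c), e, swap_apply_of_ne_of_ne hca hcb]
      · exact mem_insert_of_mem (mem_insert_of_mem (swap_mem_of_mem ha hb hmem))
    have h3 := h1 _ hsw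
    rw [swap_apply_self] at h3
    rw [h.injective h3] at hsw
    exact (mem_erase.1 hsw).1 rfl
  refine ⟨h, hh, fun s hs => ?_⟩
  by_cases hsc : s = c
  · rw [hsc, hcc, swap_apply_of_ne_of_ne hca hcb]
  · exact h1 s (mem_erase.2 ⟨hsc, hs⟩)

/-- The case of an involution with `K + 1` fixed points, `3 ≤ K`. Otherwise the transpositions
induced on `insert x (insert x' Λ)` are those within `{x, x'}` and within `Λ`. Two images of this
set, `insert u Γ` and `insert w Γ`, meet it in the same set `Γ` containing `x` and `x'`, which can
be swapped on the second but not on the first; but the centralizer of `y` maps `u` to `w` without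
moving `Γ`. -/
theorem exists_swappable_of_three_le {G : Subgroup (Perm α)} {K : ℕ} (hK : 3 ≤ K)
    (hodd : NoInvolutionFixing G (K + 2)) (ht : IsMultTransitive G (K + 2)) {y : Perm α}
    (hy : y ∈ G) (hy2 : y * y = 1) {x x' : α} (hxx' : x ≠ x') (hyx : y x = x') (hyx' : y x' = x)
    (Λ : Finset α) (hΛ : ∀ z, y z = z ↔ z ∈ Λ) (hΛc : #Λ = K + 1)
    (hxΛ : x ∉ Λ) (hx'Λ : x' ∉ Λ) :
    ∃ c ∈ Λ, Swappable G (insert x (insert x' Λ)) x c := by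
  by_contra! hno
  set Δ := insert x (insert x' Λ) with hΔ
  have hΔc : #Δ = K + 3 := by
    rw [hΔ, card_insert_of_notMem (by simp [hxx', hxΛ]), card_insert_of_notMem hx'Λ, hΛc]
  have hxΔ : x ∈ Δ := by simp [hΔ]
  have hx'Δ : x' ∈ Δ := by simp [hΔ]
  have hΛΔ : ∀ z ∈ Λ, z ∈ Δ := fun z hz => by simp [hΔ, hz]
  have hswx : Swappable G Δ x x' := by
    refine ⟨y, hy, fun z hz => ?_⟩
    rcases mem_insert.1 hz with rfl | hz
    · rw [hyx, swap_apply_left]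
    rcases mem_insert.1 hz with rfl | hz
    · rw [hyx', swap_apply_right]
    · rw [(hΛ z).2 hz, swap_apply_of_ne_of_ne (fun e : z = x => hxΛ (e ▸ hz))
        (fun e : z = x' => hx'Λ (e ▸ hz))]
  have hno' : ∀ c ∈ Λ, ¬ Swappable G Δ x' c := fun c hc h =>
    hno c hc (hswx.trans hxΔ hx'Δ (hΛΔ c hc) h)
  have hswΛ : ∀ a ∈ Λ, ∀ b ∈ Λ, a ≠ b → Swappable G Δ a b := fun a ha b hb hab =>
    swappable_of_fixed (by omega) hodd ht hy hy2 hxx' hyx hyx' Λ hΛ hΛc hxΛ hx'Λ ha hb hab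
  obtain ⟨l₀, hl₀, l₁, hl₁, l₂, hl₂, h01, h02, h12⟩ := two_lt_card.1 (show 2 < #Λ by omega)
  have hxl : ∀ {l}, l ∈ Λ → x ≠ l := fun hl e => hxΛ (e ▸ hl)
  have hx'l : ∀ {l}, l ∈ Λ → x' ≠ l := fun hl e => hx'Λ (e ▸ hl)
  set Γ := Δ.erase l₀ with hΓ
  have hΓc : #Γ = K + 2 := by rw [hΓ, card_erase_of_mem (hΛΔ _ hl₀), hΔc]; rfl
  have hΔΓ : Δ = insert l₀ Γ := (insert_erase (hΛΔ _ hl₀)).symm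
  have hmemΓ : ∀ z, z ∈ Γ ↔ z ≠ l₀ ∧ z ∈ Δ := fun z => mem_erase
  have hxΓ : x ∈ Γ := (hmemΓ x).2 ⟨hxl hl₀, hxΔ⟩
  have hx'Γ : x' ∈ Γ := (hmemΓ x').2 ⟨hx'l hl₀, hx'Δ⟩
  have hl₁Γ : l₁ ∈ Γ := (hmemΓ l₁).2 ⟨h01.symm, hΛΔ _ hl₁⟩
  have hl₂Γ : l₂ ∈ Γ := (hmemΓ l₂).2 ⟨h02.symm, hΛΔ _ hl₂⟩
  -- an element of `G` that permutes `Γ` moves `l₀` out of `Γ`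
  have hout : ∀ (g σ : Perm α), (∀ z ∈ Γ, g z = σ z) → (∀ z ∈ Γ, σ z ∈ Γ) →
      Γ.image g = Γ ∧ g l₀ ∉ Γ := by
    intro g σ h1 h2
    have e : Γ.image g = Γ := image_eq_of_forall_mem (fun z hz => by rw [h1 z hz]; exact h2 z hz)
      le_rfl
    refine ⟨e, fun hmem => ?_⟩
    rw [← e, mem_image] at hmem
    obtain ⟨z, hz, hzl⟩ := hmem
    rw [g.injective hzl] at hz
    exact ((hmemΓ _).1 hz).1 rfl
  obtain ⟨g₁, hg₁, h₁⟩ := ht (swap x' l₁) Γ hΓc.le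
  obtain ⟨g₂, hg₂, h₂⟩ := ht (swap x l₁ * swap x' l₂) Γ hΓc.le
  obtain ⟨e₁, hu⟩ := hout g₁ _ h₁ fun z hz => swap_mem_of_mem hx'Γ hl₁Γ hz
  obtain ⟨e₂, hw⟩ := hout g₂ _ h₂ fun z hz =>
    swap_mem_of_mem hxΓ hl₁Γ (swap_mem_of_mem hx'Γ hl₂Γ hz)
  have h₁x : g₁ x = x := by rw [h₁ x hxΓ, swap_apply_of_ne_of_ne hxx' (hxl hl₁)]
  have h₁l : g₁ l₁ = x' := by rw [h₁ l₁ hl₁Γ, swap_apply_right]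
  have h₂l₁ : g₂ l₁ = x := by
    rw [h₂ l₁ hl₁Γ, Perm.mul_apply, swap_apply_of_ne_of_ne (hx'l hl₁).symm h12, swap_apply_right]
  have h₂l₂ : g₂ l₂ = x' := by
    rw [h₂ l₂ hl₂Γ, Perm.mul_apply, swap_apply_right, swap_apply_of_ne_of_ne hxx'.symm (hx'l hl₁)]
  have hul : g₁ l₀ ≠ l₀ := by
    intro e
    refine hno' l₁ hl₁ ⟨g₁, hg₁, fun z hz => ?_⟩
    by_cases hz0 : z = l₀
    · rw [hz0, e, swap_apply_of_ne_of_ne (hx'l hl₀).symm h01]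
    · exact h₁ z ((hmemΓ z).2 ⟨hz0, hz⟩)
  have hwl : g₂ l₀ ≠ l₀ := by
    intro e
    have h3 := (hswΛ l₁ hl₁ l₀ hl₀ h01.symm).map hg₂
    rw [hΔΓ, image_insert, e₂, e, h₂l₁, ← hΔΓ] at h3
    exact hno l₀ hl₀ h3
  set u := g₁ l₀
  set w := g₂ l₀
  have huΔ : u ∉ Δ := fun h => hu ((hmemΓ _).2 ⟨hul, h⟩)
  have hwΔ : w ∉ Δ := fun h => hw ((hmemΓ _).2 ⟨hwl, h⟩)
  have hyout : ∀ z, z ∉ Δ → y z ≠ z := fun z hz e => hz (hΛΔ z ((hΛ z).1 e))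
  obtain ⟨L, hL₀, hLΛ, hLc⟩ := exists_subsuperset_card_eq (s := {l₀}) (t := Λ) (n := K - 2)
    (by simpa using hl₀) (by simp; omega) (by omega)
  rw [singleton_subset_iff] at hL₀
  have hxL : x ∉ L := fun h => hxΛ (hLΛ h)
  have hx'L : x' ∉ L := fun h => hx'Λ (hLΛ h)
  have hRΔ : insert x (insert x' L) ⊆ Δ := insert_subset_insert _ (insert_subset_insert _ hLΛ)
  obtain ⟨h, hh, hR, huw, hcomm⟩ := hodd.exists_commuting_move ht hy hy2 (insert x (insert x' L))
    (by rw [card_insert_of_notMem (by simp [hxx', hxL]), card_insert_of_notMem hx'L, hLc]; omega)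
    (by
      intro z hz
      rcases mem_insert.1 hz with rfl | hz
      · rw [hyx]; simp
      rcases mem_insert.1 hz with rfl | hz
      · rw [hyx']; simp
      · rw [(hΛ z).2 (hLΛ hz)]; simp [hz])
    (fun hm => huΔ (hRΔ hm)) (fun hm => hwΔ (hRΔ hm)) (hyout u huΔ) (hyout w hwΔ)
  have hhx : h x = x := hR x (by simp)
  have hhx' : h x' = x' := hR x' (by simp)
  have hhl : h l₀ = l₀ := hR l₀ (by simp [hL₀])
  have hhΓ : Γ.image h = Γ := by
    refine image_eq_of_forall_mem (fun z hz => ?_) le_rfl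
    obtain ⟨hzl, hz⟩ := (hmemΓ z).1 hz
    refine (hmemΓ _).2 ⟨fun e => hzl (h.injective (e.trans hhl.symm)), ?_⟩
    rcases mem_insert.1 hz with rfl | hz
    · rwa [hhx]
    rcases mem_insert.1 hz with rfl | hz
    · rwa [hhx']
    · exact hΛΔ _ ((hΛ _).1 (by rw [← hcomm, (hΛ z).2 hz]))
  have s₂ : Swappable G (insert w Γ) x x' := by
    have h3 := (hswΛ l₁ hl₁ l₂ hl₂ h12).map hg₂
    rwa [hΔΓ, image_insert, e₂, h₂l₁, h₂l₂] at h3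
  have s₁ : Swappable G (insert u Γ) x x' := by
    have h3 := s₂.map (G.inv_mem hh)
    have e : (insert w Γ).image ⇑h⁻¹ = insert u Γ := by
      rw [← huw]
      nth_rw 1 [← hhΓ]
      rw [← image_insert, image_image, ← Perm.coe_mul, inv_mul_cancel, Perm.coe_one, image_id]
    rwa [e, Perm.inv_eq_iff_eq.2 hhx.symm, Perm.inv_eq_iff_eq.2 hhx'.symm] at h3
  have h3 := s₁.map (G.inv_mem hg₁)
  have e : (insert u Γ).image ⇑g₁⁻¹ = Δ := by
    rw [hΔΓ]
    nth_rw 1 [← e₁]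
    rw [← image_insert, image_image, ← Perm.coe_mul, inv_mul_cancel, Perm.coe_one, image_id]
  rw [e, Perm.inv_eq_iff_eq.2 h₁x.symm, Perm.inv_eq_iff_eq.2 h₁l.symm] at h3
  exact hno l₁ hl₁ h3

theorem exists_pow_apply_eq {g : Perm α} :
    ∃ h ∈ Subgroup.zpowers g, (∃ e, h ^ 2 ^ e = 1) ∧
      ∀ z, (g ^ 4) z = z → ∃ m, (h ^ m) z = g z := by
  obtain ⟨e, m, ⟨l, hl⟩, hm⟩ := Nat.exists_eq_two_pow_mul_odd (orderOf_pos g).ne'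
  refine ⟨g ^ m, Subgroup.pow_mem _ (Subgroup.mem_zpowers g) m, ⟨e, ?_⟩, fun z hz => ⟨m, ?_⟩⟩
  · rw [← pow_mul, mul_comm, ← hm, pow_orderOf_eq_one]
  · rw [← pow_mul, hl, show (2 * l + 1) * (2 * l + 1) = 4 * (l * l + l) + 1 by ring, pow_succ',
      Perm.mul_apply, pow_mul, pow_apply_eq_self hz]

theorem forall_of_cycle {P : α → Prop} {a b c d z z' : α} (h1 : P a → P b) (h2 : P b → P c)
    (h3 : P c → P d) (h4 : P d → P a) (hz : z ∈ ({a, b, c, d} : Finset α)) (hP : P z)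
    (hz' : z' ∈ ({a, b, c, d} : Finset α)) : P z' := by
  simp only [mem_insert, mem_singleton] at hz hz'
  have ha : P a := by
    rcases hz with rfl | rfl | rfl | rfl
    · exact hP
    · exact h4 (h3 (h2 hP))
    · exact h4 (h3 hP)
    · exact h4 hP
  rcases hz' with rfl | rfl | rfl | rfl
  · exact ha
  · exact h1 ha
  · exact h2 (h1 ha)
  · exact h3 (h2 (h1 ha))

/-- If `n` is odd and `G` is 4-transitive, then an element of 2-power order that permutes four
points cyclically fixes some other point; so if each point of a 5-set can be swapped with another
one, all can. -/
theorem swappable_of_odd {G : Subgroup (Perm α)} (hn : Odd (Fintype.card α))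
    (ht : IsMultTransitive G 4) (hh : IsHomogeneous G 5) (Δ : Finset α) (hΔ : #Δ = 5)
    (hsw : ∀ a ∈ Δ, ∃ b ∈ Δ, b ≠ a ∧ Swappable G Δ a b) {a b : α} (ha : a ∈ Δ) (hb : b ∈ Δ) :
    Swappable G Δ a b := by
  obtain ⟨T, hTΔ, hT⟩ := Finset.exists_subset_card_eq (show 4 ≤ #Δ by omega)
  obtain ⟨t₁, t₂, t₃, t₄, h12, h13, h14, h23, h24, h34, rfl⟩ := card_eq_four.1 hT
  obtain ⟨g, hg, hgt⟩ := ht.exists_map_eq [t₁, t₂, t₃, t₄] [t₂, t₃, t₄, t₁]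
    (by simp [*]) (by simp [*, h12.symm, h13.symm, h14.symm]) rfl le_rfl
  simp only [List.map_cons, List.map_nil, List.cons.injEq, and_true] at hgt
  obtain ⟨g1, g2, g3, g4⟩ := hgt
  obtain ⟨h, hhg, ⟨e, he⟩, hpow⟩ := exists_pow_apply_eq (g := g)
  have hhG : h ∈ G := (Subgroup.zpowers_le.2 hg) hhg
  have hgT : ∀ z ∈ ({t₁, t₂, t₃, t₄} : Finset α), ∃ m, (h ^ m) z = g z := by
    intro z hz
    refine hpow z ?_
    simp only [mem_insert, mem_singleton] at hz
    rcases hz with rfl | rfl | rfl | rfl <;> simp [pow_succ, Perm.mul_apply, g1, g2, g3, g4]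
  obtain ⟨u, hu⟩ := Perm.exists_fixed_point_of_prime (p := 2) (n := e)
    (by rw [← even_iff_two_dvd, Nat.not_even_iff_odd]; exact hn) he
  set T : Finset α := {t₁, t₂, t₃, t₄} with hTdef
  have hhT : ∀ z, z ∈ T → h z ∈ T := by
    obtain ⟨j, rfl⟩ := Subgroup.mem_zpowers_iff.1 hhg
    have hgT' : T.image g = T := by
      refine image_eq_of_forall_mem (fun z hz => ?_) le_rfl
      simp only [hTdef, mem_insert, mem_singleton] at hz ⊢
      rcases hz with rfl | rfl | rfl | rfl <;> simp [g1, g2, g3, g4]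
    have hst : g ∈ setStabilizer G T := ⟨hg, hgT'⟩
    intro z hz
    have := (setStabilizer G T).zpow_mem hst j
    rw [← this.2]
    exact mem_image_of_mem _ hz
  have huT : u ∉ T := by
    intro hu'
    obtain ⟨m, hm⟩ := hgT u hu'
    rw [pow_apply_eq_self hu] at hm
    simp only [hTdef, mem_insert, mem_singleton] at hu'
    rcases hu' with rfl | rfl | rfl | rfl
    · exact h12 (hm.trans g1)
    · exact h23 (hm.trans g2)
    · exact h34 (hm.trans g3)
    · exact h14 (hm.trans g4).symm
  set S := insert u T with hS
  have hSc : #S = 5 := by rw [hS, card_insert_of_notMem huT, hT]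
  have huS : u ∈ S := mem_insert_self _ _
  have hhS : S.image h = S := by
    refine image_eq_of_forall_mem (fun z hz => ?_) le_rfl
    rcases mem_insert.1 hz with rfl | hz
    · rwa [hu]
    · exact mem_insert_of_mem (hhT z hz)
  obtain ⟨f, hf, hfS⟩ := hh Δ S hΔ hSc
  have hfS := image_eq_of_forall_mem hfS (by omega)
  -- a partner of `u`, and hence every point of `T`, can be swapped with `u`
  have hstep : ∀ z, Swappable G S u z → ∀ m, Swappable G S u ((h ^ m) z) := by
    intro z hz m
    induction m with
    | zero => exact hz
    | succ m ih =>
      have := ih.map hhG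
      rwa [hhS, hu, ← Perm.mul_apply, ← pow_succ'] at this
  have hstepg : ∀ z ∈ T, Swappable G S u z → Swappable G S u (g z) := by
    intro z hz hzu
    obtain ⟨m, hm⟩ := hgT z hz
    rw [← hm]
    exact hstep z hzu m
  obtain ⟨v, hv, hvu⟩ : ∃ v ∈ Δ, f v = u := by
    rw [← hfS] at huS
    exact mem_image.1 huS
  obtain ⟨v', hv', hne, hvv'⟩ := hsw v hv
  have hpartner := hvv'.map hf
  rw [hfS, hvu] at hpartner
  have hfv' : f v' ∈ T := by
    have h1 : f v' ∈ S := by rw [← hfS]; exact mem_image_of_mem _ hv'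
    refine (mem_insert.1 h1).resolve_left fun e => hne (f.injective (e.trans hvu.symm))
  have ht₁ : t₁ ∈ T := by simp [hTdef]
  have ht₂ : t₂ ∈ T := by simp [hTdef]
  have ht₃ : t₃ ∈ T := by simp [hTdef]
  have ht₄ : t₄ ∈ T := by simp [hTdef]
  have hall : ∀ z ∈ T, Swappable G S u z := by
    have c1 : Swappable G S u t₁ → Swappable G S u t₂ := fun h => g1 ▸ hstepg _ ht₁ h
    have c2 : Swappable G S u t₂ → Swappable G S u t₃ := fun h => g2 ▸ hstepg _ ht₂ h
    have c3 : Swappable G S u t₃ → Swappable G S u t₄ := fun h => g3 ▸ hstepg _ ht₃ h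
    have c4 : Swappable G S u t₄ → Swappable G S u t₁ := fun h => g4 ▸ hstepg _ ht₄ h
    exact fun z hz => forall_of_cycle c1 c2 c3 c4 hfv' hpartner hz
  have hallS : ∀ z ∈ S, Swappable G S u z := fun z hz => by
    rcases mem_insert.1 hz with rfl | hz
    · exact Swappable.refl _ _ _
    · exact hall z hz
  have hfa : f a ∈ S := by rw [← hfS]; exact mem_image_of_mem _ ha
  have hfb : f b ∈ S := by rw [← hfS]; exact mem_image_of_mem _ hb
  have h5 := (((hallS _ hfa).symm.trans hfa huS hfb (hallS _ hfb))).map (G.inv_mem hf)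
  rw [inv_apply_self', inv_apply_self', ← hfS, image_image, ← Perm.coe_mul, inv_mul_cancel,
    Perm.coe_one, image_id] at h5
  exact h5

/-- In a `k`-homogeneous, `(k-1)`-transitive group in which no involution fixes `k - 1` points,
`5 ≤ k`, the group induced on a `k`-set has index at most 2 in the symmetric group. -/
theorem index_induced_le_two_of_noInvolutionFixing {G : Subgroup (Perm α)} {K : ℕ} (hK : 2 ≤ K)
    (hn : K + 3 ≤ Fintype.card α) (hodd : NoInvolutionFixing G (K + 2))
    (ht : IsMultTransitive G (K + 2)) (hh : IsHomogeneous G (K + 3)) (S : Finset α)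
    (hS : #S = K + 3) : (induced G S).index ≤ 2 := by
  obtain ⟨Γ, hΓS, hΓ⟩ := Finset.exists_subset_card_eq (show K + 2 ≤ #S by omega)
  obtain ⟨x, hx, x', hx', hxx'⟩ := one_lt_card.1 (show 1 < #Γ by omega)
  obtain ⟨g, hg, hgΓ⟩ := ht (swap x x') Γ hΓ.le
  obtain ⟨y, hy, hy2, hyg⟩ := hodd.exists_involution hg Γ hΓ.ge (fun z hz => by
    rw [hgΓ z hz, hgΓ _ (swap_mem_of_mem hx hx' hz), swap_apply_self])
  have hyΓ : ∀ z ∈ Γ, y z = swap x x' z := fun z hz => by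
    rw [hyg z, hgΓ z hz]
    rw [hgΓ z hz, hgΓ _ (swap_mem_of_mem hx hx' hz), swap_apply_self]
  have hyx : y x = x' := by rw [hyΓ x hx, swap_apply_left]
  have hyx' : y x' = x := by rw [hyΓ x' hx', swap_apply_right]
  have hy1 : y ≠ 1 := by rintro rfl; exact hxx' hyx
  set Λ : Finset α := {z | y z = z} with hΛdef
  have hΛ : ∀ z, y z = z ↔ z ∈ Λ := fun z => by simp [hΛdef]
  have hxΛ : x ∉ Λ := fun h => hxx' (((hΛ x).2 h).symm.trans hyx)
  have hx'Λ : x' ∉ Λ := fun h => hxx' (hyx'.symm.trans ((hΛ x').2 h))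
  have hΓΛ : (Γ.erase x).erase x' ⊆ Λ := by
    intro z hz
    rw [mem_erase, mem_erase] at hz
    rw [← hΛ, hyΓ z hz.2.2, swap_apply_of_ne_of_ne hz.2.1 hz.1]
  have hΓ' : #((Γ.erase x).erase x') = K := by
    rw [card_erase_of_mem (mem_erase.2 ⟨hxx'.symm, hx'⟩), card_erase_of_mem hx, hΓ]; rfl
  have hle := card_le_card hΓΛ
  have hlt : #Λ < K + 2 := by
    by_contra hge
    exact hy1 (hodd y hy hy2 Λ (by omega) fun z hz => (hΛ z).2 hz)
  have hcases : #Λ = K ∨ #Λ = K + 1 := by omega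
  rcases hcases with hc | hc
  · have hΓc : #(insert x (insert x' Λ)) = K + 2 := by
      rw [card_insert_of_notMem (by simp [hxx', hxΛ]), card_insert_of_notMem hx'Λ, hc]
    obtain ⟨p, hp⟩ : ∃ p, p ∉ insert x (insert x' Λ) := by
      by_contra! hall
      have := card_univ (α := α)
      rw [← eq_univ_of_forall hall, hΓc] at this
      omega
    rw [hh.index_induced_eq hn hS (T := insert p (insert x (insert x' Λ)))
      (by rw [card_insert_of_notMem hp, hΓc])]
    exact index_induced_le_two ht _ hΓc hp fun u₁ u₂ u₃ =>
      linked_of_involution hK hodd ht hy hy2 hxx' hyx Λ hΛ hc u₁ u₂ u₃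
  · set Δ := insert x (insert x' Λ) with hΔ
    have hΔc : #Δ = K + 3 := by
      rw [hΔ, card_insert_of_notMem (by simp [hxx', hxΛ]), card_insert_of_notMem hx'Λ, hc]
    have hxΔ : x ∈ Δ := by simp [hΔ]
    have hx'Δ : x' ∈ Δ := by simp [hΔ]
    have hΛΔ : ∀ z ∈ Λ, z ∈ Δ := fun z hz => by simp [hΔ, hz]
    have hswx : Swappable G Δ x x' := by
      refine ⟨y, hy, fun z hz => ?_⟩
      rcases mem_insert.1 hz with rfl | hz
      · rw [hyx, swap_apply_left]
      rcases mem_insert.1 hz with rfl | hz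
      · rw [hyx', swap_apply_right]
      · rw [(hΛ z).2 hz, swap_apply_of_ne_of_ne (fun e : z = x => hxΛ (e ▸ hz))
          (fun e : z = x' => hx'Λ (e ▸ hz))]
    have hswΛ : ∀ a ∈ Λ, ∀ b ∈ Λ, a ≠ b → Swappable G Δ a b := fun a ha b hb hab =>
      swappable_of_fixed hK hodd ht hy hy2 hxx' hyx hyx' Λ hΛ hc hxΛ hx'Λ ha hb hab
    have hone : ∃ c ∈ Λ, Swappable G Δ x c := by
      by_cases hK3 : 3 ≤ K
      · exact exists_swappable_of_three_le hK3 hodd ht hy hy2 hxx' hyx hyx' Λ hΛ hc hxΛ hx'Λ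
      · obtain rfl : K = 2 := by omega
        obtain ⟨c, hcΛ⟩ := card_pos.1 (show 0 < #Λ by omega)
        refine ⟨c, hcΛ, swappable_of_odd ?_ ht hh Δ hΔc ?_ hxΔ (hΛΔ c hcΛ)⟩
        · rw [card_eq_of_fixed_iff y Λ hΛ, hc]
          exact Odd.add_even (by decide) (even_card_filter_ne y hy2)
        · intro a ha
          rcases mem_insert.1 ha with rfl | ha'
          · exact ⟨x', hx'Δ, hxx'.symm, hswx⟩
          rcases mem_insert.1 ha' with rfl | ha'
          · exact ⟨x, hxΔ, hxx', hswx.symm⟩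
          · obtain ⟨b, hb, hba⟩ := exists_mem_ne (show 1 < #Λ by omega) a
            exact ⟨b, hΛΔ b hb, hba, hswΛ a ha' b hb hba.symm⟩
    obtain ⟨c, hcΛ, hxc⟩ := hone
    have hallx : ∀ z ∈ Δ, Swappable G Δ x z := by
      intro z hz
      rcases mem_insert.1 hz with rfl | hz'
      · exact Swappable.refl _ _ _
      rcases mem_insert.1 hz' with rfl | hz'
      · exact hswx
      by_cases hzc : z = c
      · rwa [hzc]
      · exact hxc.trans hxΔ (hΛΔ c hcΛ) hz (hswΛ c hcΛ z hz' (Ne.symm hzc))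
    rw [hh.index_induced_eq hn hS hΔc, induced_eq_top_of_swappable (fun a ha b hb _ =>
      (hallx a ha).symm.trans ha hxΔ hb (hallx b hb)), Subgroup.index_top]
    omega

end

/-! ### Four-groups of automorphisms of groups of odd order -/

section

open scoped Pointwise

section FourGroup

variable {O : Type*} [Group O] [Finite O]

theorem exists_sq_eq (hO : Odd (Nat.card O)) (c : O) : ∃ m : ℕ, (c ^ m) * (c ^ m) = c := by
  obtain ⟨l, hl⟩ := hO
  refine ⟨l + 1, ?_⟩
  rw [← pow_add, show l + 1 + (l + 1) = Nat.card O + 1 by omega, pow_succ, pow_card_eq_one',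
    one_mul]

/-- An involutory automorphism `A` acts as inversion modulo `K` on the normalizer of `K`, if `K`
contains its fixed points: `n⁻¹ * A n` has a square root `d` that is inverted by `A`, and
`n * d` is fixed by `A`. -/
theorem mul_apply_mem_of_involutive (hO : Odd (Nat.card O)) {R K : Subgroup O}
    (A : MulAut O) (hA : ∀ o, A (A o) = o) (hR : ∀ o ∈ R, A o ∈ R) (hK : ∀ o ∈ K, A o ∈ K)
    (hfix : ∀ o ∈ R, A o = o → o ∈ K) {n : O} (hn : n ∈ R)
    (hnK : n ∈ Subgroup.normalizer (K : Set O)) : n * A n ∈ K := by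
  obtain ⟨m, hm⟩ := exists_sq_eq hO (n⁻¹ * A n)
  set d := (n⁻¹ * A n) ^ m with hd
  have hdR : d ∈ R := R.pow_mem (R.mul_mem (R.inv_mem hn) (hR n hn)) m
  have hAd : A d = d⁻¹ := by
    rw [hd, map_pow, ← inv_pow, map_mul, map_inv, hA, mul_inv_rev, inv_inv]
  have hAn : A n = n * d * d := by rw [mul_assoc, hm]; group
  have hk : n * d ∈ K := hfix _ (R.mul_mem hn hdR) (by rw [map_mul, hAd, hAn]; group)
  have hdn : d⁻¹ ∈ Subgroup.normalizer (K : Set O) := by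
    have := Subgroup.mul_mem _ (Subgroup.inv_mem _ (Subgroup.le_normalizer hk)) hnK
    rwa [mul_inv_rev, inv_mul_cancel_right] at this
  have h1 := (Subgroup.mem_normalizer_iff.1 hdn (A (n * d))).1 (hK _ hk)
  have h2 : n * A n = (n * d) * (d⁻¹ * A (n * d) * d⁻¹⁻¹) := by
    rw [map_mul, hAd]; group
  rw [h2]
  exact K.mul_mem hk h1

/-- Two commuting involutory automorphisms and their product cannot all act as inversion on a
nontrivial group of odd order. -/
theorem mem_of_mem_normalizer (hO : Odd (Nat.card O)) {R K : Subgroup O}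
    (A B : MulAut O) (hA : ∀ o, A (A o) = o) (hB : ∀ o, B (B o) = o)
    (hAB : ∀ o, A (B o) = B (A o)) (hRA : ∀ o ∈ R, A o ∈ R) (hRB : ∀ o ∈ R, B o ∈ R)
    (hKA : ∀ o ∈ K, A o ∈ K) (hKB : ∀ o ∈ K, B o ∈ K) (hfA : ∀ o ∈ R, A o = o → o ∈ K)
    (hfB : ∀ o ∈ R, B o = o → o ∈ K) (hfAB : ∀ o ∈ R, B (A o) = o → o ∈ K) {n : O} (hn : n ∈ R)
    (hnK : n ∈ Subgroup.normalizer (K : Set O)) : n ∈ K := by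
  have hAn : A n ∈ Subgroup.normalizer (K : Set O) := by
    rw [Subgroup.mem_normalizer_iff] at hnK ⊢
    intro k
    have hKA' : ∀ o, o ∈ K ↔ A o ∈ K := fun o =>
      ⟨hKA o, fun h => by have := hKA _ h; rwa [hA] at this⟩
    rw [hKA' k, hnK, hKA', map_mul, map_mul, map_inv, hA]
  have h1 := mul_apply_mem_of_involutive hO A hA hRA hKA hfA hn hnK
  have h2 := mul_apply_mem_of_involutive hO B hB hRB hKB hfB (hRA n hn) hAn
  have h3 := mul_apply_mem_of_involutive hO (B * A) (fun o => by
      simp only [MulAut.mul_apply]; rw [hAB, hA, hB])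
    (fun o ho => hRB _ (hRA o ho)) (fun o ho => hKB _ (hKA o ho)) hfAB hn hnK
  rw [MulAut.mul_apply] at h3
  -- modulo `K`, both `A n = n⁻¹` and `B (A n) = n⁻¹`, while `B` inverts `A n`
  have h4 : n * n * (n⁻¹ * (n * A n)⁻¹ * n⁻¹⁻¹) ∈ K := by
    have := K.mul_mem h3 (K.inv_mem h2)
    convert this using 1
    group
  have h5 := (Subgroup.mem_normalizer_iff.1 (Subgroup.inv_mem _ hnK) (n * A n)⁻¹).1 (K.inv_mem h1)
  have h6 := K.mul_mem h4 (K.inv_mem h5)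
  rw [mul_inv_cancel_right] at h6
  obtain ⟨m, hm⟩ := exists_sq_eq hO n
  rw [← hm, ← (Commute.refl n).mul_pow]
  exact K.pow_mem h6 m

/-- A subgroup that is invariant under a four-group of automorphisms of a group of odd order and
contains the fixed points of its three involutions is the whole group. Otherwise some invariant
Sylow subgroup `R` is not contained in it, and normalizers grow in `R`. -/
theorem eq_top_of_fixedPoints_mem (hO : Odd (Nat.card O)) (K : Subgroup O)
    (A B : MulAut O) (hA : ∀ o, A (A o) = o) (hB : ∀ o, B (B o) = o)
    (hAB : ∀ o, A (B o) = B (A o)) (hKA : ∀ o ∈ K, A o ∈ K) (hKB : ∀ o ∈ K, B o ∈ K)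
    (hfA : ∀ o, A o = o → o ∈ K) (hfB : ∀ o, B o = o → o ∈ K)
    (hfAB : ∀ o, B (A o) = o → o ∈ K) : K = ⊤ := by
  classical
  by_contra hK
  have hK1 : K.index ≠ 1 := fun h => hK (Subgroup.index_eq_one.1 h)
  obtain ⟨r, hr, hrK⟩ := Nat.exists_prime_and_dvd hK1
  have := Fact.mk hr
  have hA2 : A * A = 1 := by ext o; exact hA o
  have hB2 : B * B = 1 := by ext o; exact hB o
  have hABm : A * B = B * A := by ext o; exact hAB o
  obtain ⟨R, hRA, hRB⟩ : ∃ R : Sylow r O, A • R = R ∧ B • R = R := by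
    have : Fintype (Sylow r O) := Fintype.ofFinite _
    have hodd : Odd (Fintype.card (Sylow r O)) := by
      rw [← Nat.card_eq_fintype_card]
      obtain ⟨P⟩ : Nonempty (Sylow r O) := inferInstance
      exact hO.of_dvd_nat (P.card_dvd_index.trans (Subgroup.index_dvd_card _))
    have hfixA : Odd #{R : Sylow r O | A • R = R} := by
      have h1 := card_filter_add_card_filter_not (s := (univ : Finset (Sylow r O)))
        (fun R => A • R = R)
      have h2 : Even #{R : Sylow r O | ¬ A • R = R} := by
        refine even_card_of_involution _ (fun R => A • R) (fun R hR => ?_)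
          (fun R hR => (mem_filter.1 hR).2) fun R _ => by rw [← mul_smul, hA2, one_smul]
        rw [mem_filter] at hR ⊢
        exact ⟨mem_univ _, fun e => hR.2 (MulAction.injective A e)⟩
      rw [card_univ] at h1
      rw [← h1] at hodd
      exact (Nat.odd_add.1 hodd).2 h2
    by_contra! hno
    rw [← Nat.not_even_iff_odd] at hfixA
    refine hfixA (even_card_of_involution _ (fun R => B • R) (fun R hR => ?_)
      (fun R hR => hno R (mem_filter.1 hR).2) fun R _ => by rw [← mul_smul, hB2, one_smul])
    rw [mem_filter] at hR ⊢
    exact ⟨mem_univ _, by rw [← mul_smul, hABm, mul_smul, hR.2]⟩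
  have hinv : ∀ C : MulAut O, C • R = R → ∀ o ∈ R, C o ∈ R := by
    intro C hC o ho
    have h1 : C • o ∈ ((C • R : Sylow r O) : Subgroup O) := by
      rw [Sylow.pointwise_smul_def]
      exact Subgroup.smul_mem_pointwise_smul _ _ _ ho
    rw [hC] at h1
    exact h1
  have hnot : ¬ (R : Subgroup O) ≤ K := fun h =>
    R.not_dvd_index (hrK.trans (Subgroup.index_dvd_of_le h))
  have hlt : K.subgroupOf R < ⊤ := by
    rw [lt_top_iff_ne_top, Ne, Subgroup.subgroupOf_eq_top]
    exact hnot
  have : Group.IsNilpotent R := R.isPGroup'.isNilpotent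
  obtain ⟨n, hn, hnK⟩ := SetLike.exists_of_lt
    (Group.normalizerCondition_of_isNilpotent (G := R) _ hlt)
  refine hnK (mem_of_mem_normalizer hO (R := R) (K := (R : Subgroup O) ⊓ K) A B hA hB
    hAB (hinv A hRA) (hinv B hRB) (fun o ho => ⟨hinv A hRA o ho.1, hKA o ho.2⟩)
    (fun o ho => ⟨hinv B hRB o ho.1, hKB o ho.2⟩) (fun o ho h => ⟨ho, hfA o h⟩)
    (fun o ho h => ⟨ho, hfB o h⟩) (fun o ho h => ⟨ho, hfAB o h⟩) n.2 ?_).2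
  rw [Subgroup.mem_normalizer_iff] at hn ⊢
  intro k
  have hconj : k ∈ (R : Subgroup O) ↔ (n : O) * k * (n : O)⁻¹ ∈ (R : Subgroup O) := by
    constructor
    · intro hk
      exact (R : Subgroup O).mul_mem ((R : Subgroup O).mul_mem n.2 hk)
        ((R : Subgroup O).inv_mem n.2)
    · intro hk
      have := (R : Subgroup O).mul_mem ((R : Subgroup O).mul_mem
        ((R : Subgroup O).inv_mem n.2) hk) n.2
      simpa [mul_assoc] using this
  constructor
  · rintro ⟨h1, h2⟩
    exact ⟨hconj.1 h1, (hn ⟨k, h1⟩).1 h2⟩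
  · rintro ⟨h1, h2⟩
    exact ⟨hconj.2 h1, (hn ⟨k, hconj.2 h1⟩).2 h2⟩

end FourGroup

end

/-! ### Groups that induce alternating groups -/

section

variable {α : Type*} [DecidableEq α] [Fintype α]

/-- A permutation supported in a `k`-set and agreeing there with an element of `G` is even. -/
def InducesEven (G : Subgroup (Perm α)) (k : ℕ) : Prop :=
  ∀ (S : Finset α) (σ : Perm α), #S = k → (∀ x ∉ S, σ x = x) →
    (∃ g ∈ G, ∀ x ∈ S, g x = σ x) → Perm.sign σ = 1

theorem apply_mem_iff_of_support {S : Finset α} {σ : Perm α} (h : ∀ x ∉ S, σ x = x) (x : α) :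
    σ x ∈ S ↔ x ∈ S := by
  constructor
  · intro hx
    by_contra hxS
    rw [h x hxS] at hx
    exact hxS hx
  · intro hx
    by_contra hxS
    have := σ.injective (h _ hxS)
    rw [this] at hxS
    exact hxS hx

theorem IsHomogeneous.isMultTransitive_or_inducesEven {G : Subgroup (Perm α)} {k : ℕ}
    (hh : IsHomogeneous G k) (hk : k ≤ Fintype.card α)
    (hidx : ∀ S : Finset α, #S = k → (induced G S).index ≤ 2) :
    IsMultTransitive G k ∨
      (InducesEven G k ∧ ∀ S : Finset α, #S = k → (induced G S).index = 2) := by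
  by_cases ht : IsMultTransitive G k
  · exact Or.inl ht
  have h2 : ∀ S : Finset α, #S = k → (induced G S).index = 2 := by
    intro S hS
    have h1 := hidx S hS
    have h0 : (induced G S).index ≠ 0 := Subgroup.index_ne_zero_of_finite
    have h1' : (induced G S).index ≠ 1 := fun h =>
      ht (hh.isMultTransitive_of_index hk S hS h)
    omega
  refine Or.inr ⟨?_, h2⟩
  rintro S σ hS hσ ⟨g, hg, hgσ⟩
  have hiff := apply_mem_iff_of_support hσ
  have hmem : σ.subtypePerm (p := fun x => x ∈ S) hiff ∈ induced G S :=
    ⟨g, hg, fun x => hgσ x x.2⟩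
  rw [Perm.eq_alternatingGroup_of_index_eq_two (h2 S hS), Perm.mem_alternatingGroup] at hmem
  rw [← Perm.sign_subtypePerm σ hiff (fun x hx => by by_contra hxS; exact hx (hσ x hxS))]
  convert hmem

theorem InducesEven.not_swappable {G : Subgroup (Perm α)} {k : ℕ} (h : InducesEven G k)
    {S : Finset α} (hS : #S = k) {a b : α} (ha : a ∈ S) (hb : b ∈ S) (hab : a ≠ b) :
    ¬ Swappable G S a b := by
  rintro ⟨g, hg, h1⟩
  have h2 := h S (swap a b) hS (fun x hx => swap_apply_of_ne_of_ne
    (fun e => hx (e ▸ ha)) (fun e => hx (e ▸ hb))) ⟨g, hg, h1⟩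
  rw [Perm.sign_swap hab] at h2
  exact absurd h2 (by decide)

theorem InducesEven.noInvolutionFixing {G : Subgroup (Perm α)} {K : ℕ}
    (h : InducesEven G (K + 2)) : NoInvolutionFixing G K := by
  intro y hy hy2 S hS hfix
  have hyy : ∀ z, y (y z) = z := fun z => by rw [← Perm.mul_apply, hy2, Perm.one_apply]
  obtain ⟨A, hAS, hA⟩ := Finset.exists_subset_card_eq hS
  by_contra hy1
  obtain ⟨x, hx⟩ : ∃ x, y x ≠ x := by
    by_contra! hall
    exact hy1 (Equiv.ext hall)
  have hxA : x ∉ A := fun hxA => hx (hfix x (hAS hxA))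
  have hyxA : y x ∉ A := fun hxA => hx (by have := hfix _ (hAS hxA); rw [hyy] at this; exact this.symm)
  refine h.not_swappable (S := insert x (insert (y x) A)) ?_ (by simp) (by simp) (Ne.symm hx)
    ⟨y, hy, fun z hz => ?_⟩
  · rw [card_insert_of_notMem (by simp [hx.symm, hxA]), card_insert_of_notMem hyxA, hA]
  · rcases mem_insert.1 hz with rfl | hz
    · rw [swap_apply_left]
    rcases mem_insert.1 hz with rfl | hz
    · rw [swap_apply_right, hyy]
    · rw [hfix z (hAS hz), swap_apply_of_ne_of_ne (fun e : z = x => hxA (e ▸ hz))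
        (fun e : z = y x => hyxA (e ▸ hz))]

/-- In a `(K+2)`-transitive group that induces even permutations on `(K+3)`-sets, some involution
swaps two given points and fixes exactly `K` points. -/
theorem InducesEven.exists_involution {G : Subgroup (Perm α)} {K : ℕ}
    (h : InducesEven G (K + 3)) (ht : IsMultTransitive G (K + 2)) (Γ : Finset α)
    (hΓ : #Γ = K + 2) {x x' : α} (hx : x ∈ Γ) (hx' : x' ∈ Γ) (hxx' : x ≠ x') :
    ∃ y ∈ G, y * y = 1 ∧ y x = x' ∧ y x' = x ∧ #{z | y z = z} = K := by
  have hodd : NoInvolutionFixing G (K + 1) := h.noInvolutionFixing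
  obtain ⟨g, hg, hgΓ⟩ := ht (swap x x') Γ hΓ.le
  have hgg : ∀ z ∈ Γ, g (g z) = z := fun z hz => by
    rw [hgΓ z hz, hgΓ _ (swap_mem_of_mem hx hx' hz), swap_apply_self]
  obtain ⟨y, hy, hy2, hyg⟩ := hodd.exists_involution hg Γ (by omega) hgg
  have hyΓ : ∀ z ∈ Γ, y z = swap x x' z := fun z hz => by
    rw [hyg z (hgg z hz), hgΓ z hz]
  have hyx : y x = x' := by rw [hyΓ x hx, swap_apply_left]
  have hyx' : y x' = x := by rw [hyΓ x' hx', swap_apply_right]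
  refine ⟨y, hy, hy2, hyx, hyx', le_antisymm ?_ ?_⟩
  · by_contra hgt
    have := hodd y hy hy2 {z | y z = z} (by omega) (fun z hz => (mem_filter.1 hz).2)
    rw [this] at hyx
    exact hxx' hyx
  · have hΓ' : #((Γ.erase x).erase x') = K := by
      rw [card_erase_of_mem (mem_erase.2 ⟨hxx'.symm, hx'⟩), card_erase_of_mem hx, hΓ]; rfl
    rw [← hΓ']
    refine card_le_card fun z hz => ?_
    rw [mem_erase, mem_erase] at hz
    rw [mem_filter, hyΓ z hz.2.2, swap_apply_of_ne_of_ne hz.2.1 hz.1]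
    exact ⟨mem_univ _, rfl⟩

/-- An involution with `K` fixed points and at least three 2-cycles induces an odd permutation on
the union of three 2-cycles and all but three of the fixed points. -/
theorem not_inducesEven_of_three_le {G : Subgroup (Perm α)} {K : ℕ} (hK : 3 ≤ K)
    (hn : K + 5 ≤ Fintype.card α) (ht : IsMultTransitive G (K + 2)) :
    ¬ InducesEven G (K + 3) := by
  intro h
  obtain ⟨Γ, -, hΓ⟩ := exists_superset_card (∅ : Finset α) (k := K + 2) (by simp) (by omega)
  obtain ⟨x, hx, x', hx', hxx'⟩ := one_lt_card.1 (show 1 < #Γ by omega)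
  obtain ⟨y, hy, hy2, -, -, hΛ⟩ := h.exists_involution ht Γ hΓ hx hx' hxx'
  have hyy : ∀ z, y (y z) = z := fun z => by rw [← Perm.mul_apply, hy2, Perm.one_apply]
  have hcard := card_eq_of_fixed_iff y {z | y z = z} (fun z => by simp)
  have hpick : ∀ A : Finset α, #A < #{z | y z ≠ z} → ∃ z, y z ≠ z ∧ z ∉ A := by
    intro A hA
    obtain ⟨z, hz, hzA⟩ := exists_mem_notMem_of_card_lt_card hA
    exact ⟨z, (mem_filter.1 hz).2, hzA⟩
  obtain ⟨p, hp, -⟩ := hpick ∅ (by simp only [card_empty]; omega)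
  obtain ⟨q, hq, hqA⟩ := hpick {p, y p} (lt_of_le_of_lt card_le_two (by omega))
  have heven := even_card_filter_ne y hy2
  obtain ⟨r, hr, hrA⟩ := hpick {p, y p, q, y q} (lt_of_le_of_lt card_le_four (by
    obtain ⟨j, hj⟩ := heven; omega))
  have hsymm : ∀ {a b}, y a = b → a = y b := fun e => by rw [← e, hyy]
  simp only [mem_insert, mem_singleton, not_or] at hqA hrA
  obtain ⟨hqp, hqyp⟩ := hqA
  obtain ⟨hrp, hryp, hrq, hryq⟩ := hrA
  have hyqp : y q ≠ p := fun e => hqyp (hsymm e)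
  have hyrp : y r ≠ p := fun e => hryp (hsymm e)
  have hyrq : y r ≠ q := fun e => hryq (hsymm e)
  have hyqyp : y q ≠ y p := fun e => hqp (y.injective e)
  have hyryp : y r ≠ y p := fun e => hrp (y.injective e)
  have hyryq : y r ≠ y q := fun e => hrq (y.injective e)
  obtain ⟨L, hLΛ, hL⟩ := Finset.exists_subset_card_eq (show K - 3 ≤ #{z | y z = z} by omega)
  have hLfix : ∀ z ∈ L, y z = z := fun z hz => (mem_filter.1 (hLΛ hz)).2
  have hne : ∀ z ∈ L, ∀ a, y a ≠ a → z ≠ a ∧ z ≠ y a := fun z hz a ha =>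
    ⟨fun e => ha (e ▸ hLfix z hz), fun e => ha (by
      have := hLfix z hz
      rw [e, hyy] at this
      exact this.symm)⟩
  set T : Finset α := {p, y p, q, y q, r, y r} with hT
  have hTL : Disjoint T L := by
    rw [Finset.disjoint_right]
    intro z hz hzT
    have h1 := hne z hz p hp
    have h2 := hne z hz q hq
    have h3 := hne z hz r hr
    simp only [hT, mem_insert, mem_singleton] at hzT
    tauto
  have hTc : #T = 6 := by
    have hnd : [p, y p, q, y q, r, y r].Nodup := by
      simp [hp.symm, hq.symm, hr.symm, Ne.symm hqp, Ne.symm hqyp, Ne.symm hrp, Ne.symm hryp,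
        Ne.symm hrq, Ne.symm hryq, hyqp.symm, hyrp.symm, hyrq.symm, hyqyp.symm, hyryp.symm,
        hyryq.symm]
    have := List.toFinset_card_of_nodup hnd
    simp only [List.toFinset_cons, List.toFinset_nil, insert_empty_eq] at this
    exact this
  have hsign : Perm.sign (swap p (y p) * swap q (y q) * swap r (y r)) = -1 := by
    rw [Perm.sign_mul, Perm.sign_mul, Perm.sign_swap hp.symm, Perm.sign_swap hq.symm,
      Perm.sign_swap hr.symm]
    rfl
  have h1 := h (T ∪ L) (swap p (y p) * swap q (y q) * swap r (y r))
    (by rw [card_union_of_disjoint hTL, hTc, hL]; omega) (fun z hz => by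
      simp only [hT, mem_union, mem_insert, mem_singleton, not_or] at hz
      obtain ⟨⟨z1, z2, z3, z4, z5, z6⟩, -⟩ := hz
      simp only [Perm.mul_apply]
      rw [swap_apply_of_ne_of_ne z5 z6, swap_apply_of_ne_of_ne z3 z4,
        swap_apply_of_ne_of_ne z1 z2]) ⟨y, hy, fun z hz => by
      rcases mem_union.1 hz with hz | hz
      · simp only [Perm.mul_apply]
        simp only [hT, mem_insert, mem_singleton] at hz
        rcases hz with e | e | e | e | e | e <;> rw [e]
        · rw [swap_apply_of_ne_of_ne (Ne.symm hrp) hyrp.symm,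
            swap_apply_of_ne_of_ne (Ne.symm hqp) hyqp.symm, swap_apply_left]
        · rw [swap_apply_of_ne_of_ne (Ne.symm hryp) hyryp.symm,
            swap_apply_of_ne_of_ne (Ne.symm hqyp) hyqyp.symm, swap_apply_right, hyy]
        · rw [swap_apply_of_ne_of_ne (Ne.symm hrq) hyrq.symm, swap_apply_left,
            swap_apply_of_ne_of_ne hyqp hyqyp]
        · rw [swap_apply_of_ne_of_ne (Ne.symm hryq) hyryq.symm, swap_apply_right,
            swap_apply_of_ne_of_ne hqp hqyp, hyy]
        · rw [swap_apply_left, swap_apply_of_ne_of_ne hyrq hyryq,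
            swap_apply_of_ne_of_ne hyrp hyryp]
        · rw [swap_apply_right, swap_apply_of_ne_of_ne hrq hryq,
            swap_apply_of_ne_of_ne hrp hryp, hyy]
      · have h1 := hne z hz p hp
        have h2 := hne z hz q hq
        have h3 := hne z hz r hr
        simp only [Perm.mul_apply]
        rw [swap_apply_of_ne_of_ne h3.1 h3.2, swap_apply_of_ne_of_ne h2.1 h2.2,
          swap_apply_of_ne_of_ne h1.1 h1.2, hLfix z hz]⟩
  rw [hsign] at h1
  exact absurd h1 (by decide)

end

/-! ### Homogeneity together with transitivity of one degree less -/

section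

variable {α : Type*} [DecidableEq α] [Fintype α]

/-- If the square of the product of two involutions fixes at least `m` points, an odd power of the
product is an involution that commutes with the first one; it agrees with the product on the points
fixed by its square. -/
theorem NoInvolutionFixing.exists_commuting_involution {G : Subgroup (Perm α)} {m : ℕ}
    (h : NoInvolutionFixing G m) {a e : Perm α} (ha : a ∈ G) (he : e ∈ G) (ha2 : a * a = 1)
    (he2 : e * e = 1) (S : Finset α) (hS : m ≤ #S) (hfix : ∀ z ∈ S, a (e (a (e z))) = z) :
    ∃ b ∈ G, b * b = 1 ∧ (∀ z, a (b z) = b (a z)) ∧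
      ∀ z, a (e (a (e z))) = z → b z = a (e z) := by
  have hc := G.mul_mem ha he
  obtain ⟨l, hl⟩ := h.odd_orderOf (G.mul_mem hc hc) S hS hfix
  have ha_inv : a⁻¹ = a := inv_eq_of_mul_eq_one_left ha2
  have he_inv : e⁻¹ = e := inv_eq_of_mul_eq_one_left he2
  have hsemi : SemiconjBy a (a * e) (a * e)⁻¹ := by
    rw [SemiconjBy, mul_inv_rev, ha_inv, he_inv, ← mul_assoc, ha2, one_mul, mul_assoc, ha2,
      mul_one]
  have hb2 : (a * e) ^ (2 * l + 1) * (a * e) ^ (2 * l + 1) = 1 := by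
    rw [← (Commute.refl (a * e)).mul_pow, ← hl, pow_orderOf_eq_one]
  refine ⟨(a * e) ^ (2 * l + 1), G.pow_mem hc _, hb2, fun z => ?_, fun z hz => ?_⟩
  · have h1 := (hsemi.pow_right (2 * l + 1)).eq
    rw [inv_pow, inv_eq_of_mul_eq_one_left hb2] at h1
    exact congrArg (fun p : Perm α => p z) h1
  · rw [pow_succ', Perm.mul_apply, pow_mul, pow_two, pow_apply_eq_self hz]
    rfl

/-- In the 4-transitive case all involutions with two 2-cycles are conjugate, by rigidity, to one
with exactly two fixed points. -/
theorem InducesEven.card_fixed_eq_two {G : Subgroup (Perm α)} (hn : 10 ≤ Fintype.card α)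
    (h : InducesEven G 5) (ht : IsMultTransitive G 4) {a : Perm α} (ha : a ∈ G)
    (ha2 : a * a = 1) {p s : α} (hp : a p ≠ p) (hs : a s ≠ s) (hsp : s ≠ p) (hsap : s ≠ a p) :
    #{z | a z = z} = 2 := by
  have haa : ∀ z, a (a z) = z := fun z => by rw [← Perm.mul_apply, ha2, Perm.one_apply]
  obtain ⟨Γ, -, hΓ⟩ := exists_superset_card (∅ : Finset α) (k := 4) (by simp) (by omega)
  obtain ⟨x, hx, x', hx', hxx'⟩ := one_lt_card.1 (show 1 < #Γ by omega)
  obtain ⟨c, hc, hc2, hcx, hcx', hc2c⟩ := h.exists_involution (K := 2) ht Γ hΓ hx hx' hxx'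
  have hcc : ∀ z, c (c z) = z := fun z => by rw [← Perm.mul_apply, hc2, Perm.one_apply]
  have hcard := card_eq_of_fixed_iff c {z | c z = z} (fun z => by simp)
  obtain ⟨q, hq, hqx⟩ := exists_mem_notMem_of_card_lt_card
    (show #({x, x'} : Finset α) < #{z | c z ≠ z} from lt_of_le_of_lt card_le_two (by omega))
  have hq := (mem_filter.1 hq).2
  simp only [mem_insert, mem_singleton, not_or] at hqx
  have hcqx : c q ≠ x := fun e => hqx.2 (by rw [← hcx, ← e, hcc])
  have hcqx' : c q ≠ x' := fun e => hqx.1 (by rw [← hcx', ← e, hcc])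
  have hasp : a s ≠ p := fun e => hsap (by rw [← e, haa])
  have hasap : a s ≠ a p := fun e => hsp (a.injective e)
  obtain ⟨g, hg, hgm⟩ := ht.exists_map_eq [x, x', q, c q] [p, a p, s, a s]
    (by simp [hxx', Ne.symm hqx.1, Ne.symm hqx.2, hq.symm, hcqx.symm, hcqx'.symm])
    (by simp [hp.symm, hsp.symm, hsap.symm, hs.symm, hasp.symm, hasap.symm]) rfl le_rfl
  simp only [List.map_cons, List.map_nil, List.cons.injEq, and_true] at hgm
  obtain ⟨g1, g2, g3, g4⟩ := hgm
  have hodd : NoInvolutionFixing G 3 := h.noInvolutionFixing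
  obtain ⟨f, hf, -, hfc⟩ := hodd.lift hc hc2 ha ha2 hg {x, x', q, c q} (by
    rw [card_insert_of_notMem (by simp [hxx', Ne.symm hqx.1, hcqx.symm]),
      card_insert_of_notMem (by simp [Ne.symm hqx.2, hcqx'.symm]), card_pair hq.symm]
    omega) (by
      intro z hz
      simp only [mem_insert, mem_singleton] at hz
      rcases hz with e | e | e | e <;> rw [e]
      · rw [hcx, g1, g2]
      · rw [hcx', g1, g2, haa]
      · rw [g3, g4]
      · rw [hcc, g3, g4, haa])
  rw [← hc2c, ← card_image_of_injective (univ.filter fun z => c z = z) f.injective]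
  congr 1
  ext z
  obtain ⟨w, rfl⟩ := f.surjective z
  simp only [mem_filter, mem_univ, true_and, mem_image, f.injective.eq_iff, exists_eq_right]
  rw [← hfc, f.injective.eq_iff]

theorem InducesEven.not_fourCycle {G : Subgroup (Perm α)} (h : InducesEven G 5)
    {t₁ t₂ t₃ t₄ f : α} (hnd : [f, t₁, t₂, t₃, t₄].Nodup) {z : Perm α} (hz : z ∈ G)
    (z1 : z t₁ = t₂) (z2 : z t₂ = t₃) (z3 : z t₃ = t₄) (z4 : z t₄ = t₁) : z f ≠ f := by
  intro zf
  have hc : #({f, t₁, t₂, t₃, t₄} : Finset α) = 5 := by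
    have := List.toFinset_card_of_nodup hnd
    simp only [List.toFinset_cons, List.toFinset_nil, insert_empty_eq] at this
    exact this
  simp only [List.nodup_cons, List.mem_cons, not_or, List.not_mem_nil, not_false_eq_true,
    and_true] at hnd
  obtain ⟨⟨f1, f2, f3, f4⟩, ⟨h12, h13, h14⟩, ⟨h23, h24⟩, h34, -⟩ := hnd
  have h1 := h {f, t₁, t₂, t₃, t₄} (swap t₁ t₂ * swap t₂ t₃ * swap t₃ t₄) hc (fun w hw => by
    simp only [mem_insert, mem_singleton, not_or] at hw
    simp only [Perm.mul_apply]
    rw [swap_apply_of_ne_of_ne hw.2.2.2.1 hw.2.2.2.2, swap_apply_of_ne_of_ne hw.2.2.1 hw.2.2.2.1,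
      swap_apply_of_ne_of_ne hw.2.1 hw.2.2.1]) ⟨z, hz, fun w hw => by
    simp only [mem_insert, mem_singleton] at hw
    simp only [Perm.mul_apply]
    rcases hw with e | e | e | e | e <;> rw [e]
    · rw [zf, swap_apply_of_ne_of_ne f3 f4, swap_apply_of_ne_of_ne f2 f3,
        swap_apply_of_ne_of_ne f1 f2]
    · rw [z1, swap_apply_of_ne_of_ne h13 h14, swap_apply_of_ne_of_ne h12 h13, swap_apply_left]
    · rw [z2, swap_apply_of_ne_of_ne h23 h24, swap_apply_left,
        swap_apply_of_ne_of_ne (Ne.symm h13) (Ne.symm h23)]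
    · rw [z3, swap_apply_left, swap_apply_of_ne_of_ne (Ne.symm h24) (Ne.symm h34),
        swap_apply_of_ne_of_ne (Ne.symm h14) (Ne.symm h24)]
    · rw [z4, swap_apply_right, swap_apply_right, swap_apply_right]⟩
  rw [Perm.sign_mul, Perm.sign_mul, Perm.sign_swap h12, Perm.sign_swap h23,
    Perm.sign_swap h34] at h1
  exact absurd h1 (by decide)

/-- Conjugation by `a`, as an automorphism of the pointwise stabilizer of an `a`-invariant set. -/
def conjFixer (G : Subgroup (Perm α)) (T : Finset α) (a : Perm α) (ha : a ∈ G)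
    (haT : ∀ t, a t ∈ T ↔ t ∈ T) : MulAut (fixer G T) where
  toFun o := ⟨a * o * a⁻¹, G.mul_mem (G.mul_mem ha o.2.1) (G.inv_mem ha), fun t ht => by
    have h1 : a⁻¹ t ∈ T := by rw [← haT]; simpa using ht
    rw [Perm.mul_apply, Perm.mul_apply, o.2.2 _ h1]; simp⟩
  invFun o := ⟨a⁻¹ * o * a, G.mul_mem (G.mul_mem (G.inv_mem ha) o.2.1) ha, fun t ht => by
    rw [Perm.mul_apply, Perm.mul_apply, o.2.2 _ ((haT t).2 ht), inv_apply_self']⟩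
  left_inv o := Subtype.ext (by simp [mul_assoc])
  right_inv o := Subtype.ext (by simp [mul_assoc])
  map_mul' o o' := Subtype.ext (by simp [mul_assoc])

theorem conjFixer_apply {G : Subgroup (Perm α)} {T : Finset α} {a : Perm α} (ha : a ∈ G)
    (haT : ∀ t, a t ∈ T ↔ t ∈ T) (ha2 : a * a = 1) (o : fixer G T) (z : α) :
    (conjFixer G T a ha haT o : Perm α) z = a ((o : Perm α) (a z)) := by
  show (a * o * a⁻¹ : Perm α) z = _
  rw [inv_eq_of_mul_eq_one_left ha2]
  rfl

theorem NoInvolutionFixing.odd_card_fixer {G : Subgroup (Perm α)} {m : ℕ}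
    (h : NoInvolutionFixing G m) (T : Finset α) (hT : m ≤ #T) : Odd (Nat.card (fixer G T)) := by
  rw [← Nat.not_even_iff_odd, even_iff_two_dvd]
  intro h2
  obtain ⟨o, ho⟩ := exists_prime_orderOf_dvd_card' 2 h2
  have h1 := h.odd_orderOf o.2.1 T hT o.2.2
  rw [Subgroup.orderOf_coe, ho] at h1
  exact absurd h1 (by decide)

/-- Let `a`, `b` be commuting involutions such that `a`, `b` and `a * b` all permute `T`, with the
same two fixed points outside `T`. If the pointwise stabilizer of `T` does not link these two
points, it fixes the first. -/
theorem linked_self_of_fourGroup {G : Subgroup (Perm α)} {m : ℕ} (h : NoInvolutionFixing G m)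
    (T : Finset α) (hT : m ≤ #T) {a b : Perm α} (ha : a ∈ G) (hb : b ∈ G) (ha2 : a * a = 1)
    (hb2 : b * b = 1) (hab : ∀ z, a (b z) = b (a z)) (haT : ∀ t, a t ∈ T ↔ t ∈ T)
    (hbT : ∀ t, b t ∈ T ↔ t ∈ T) {f₁ f₂ : α} (hfa : ∀ z, a z = z ↔ z = f₁ ∨ z = f₂)
    (hfb : ∀ z, b z = z ↔ z = f₁ ∨ z = f₂) (hfab : ∀ z, b (a z) = z ↔ z = f₁ ∨ z = f₂)
    (hnl : ¬ Linked G T f₁ f₂) {w : α} (hw : Linked G T f₁ w) : w = f₁ := by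
  have haa : ∀ z, a (a z) = z := fun z => by rw [← Perm.mul_apply, ha2, Perm.one_apply]
  have hbb : ∀ z, b (b z) = z := fun z => by rw [← Perm.mul_apply, hb2, Perm.one_apply]
  have ha1 : a f₁ = f₁ := (hfa _).2 (Or.inl rfl)
  have hb1 : b f₁ = f₁ := (hfb _).2 (Or.inl rfl)
  let A := conjFixer G T a ha haT
  let B := conjFixer G T b hb hbT
  have hA : ∀ o z, (A o : Perm α) z = a ((o : Perm α) (a z)) := conjFixer_apply ha haT ha2
  have hB : ∀ o z, (B o : Perm α) z = b ((o : Perm α) (b z)) := conjFixer_apply hb hbT hb2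
  let K : Subgroup (fixer G T) := (MulAction.stabilizer (Perm α) f₁).subgroupOf (fixer G T)
  have hK : ∀ o : fixer G T, o ∈ K ↔ (o : Perm α) f₁ = f₁ := fun o => Iff.rfl
  have hone : ∀ o : fixer G T, ((o : Perm α) f₁ = f₁ ∨ (o : Perm α) f₁ = f₂) → o ∈ K := by
    rintro o (ho | ho)
    · exact (hK o).2 ho
    · exact absurd ⟨o, o.2.1, o.2.2, ho⟩ hnl
  have htop := eq_top_of_fixedPoints_mem (h.odd_card_fixer T hT) K A B
    (fun o => Subtype.ext (Equiv.ext fun z => by rw [hA, hA, haa, haa]))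
    (fun o => Subtype.ext (Equiv.ext fun z => by rw [hB, hB, hbb, hbb]))
    (fun o => Subtype.ext (Equiv.ext fun z => by rw [hA, hB, hB, hA, hab, hab]))
    (fun o ho => by rw [hK, hA, ha1, (hK o).1 ho, ha1])
    (fun o ho => by rw [hK, hB, hb1, (hK o).1 ho, hb1])
    (fun o ho => hone o ((hfa _).1 (by nth_rw 2 [← ho]; rw [hA, ha1])))
    (fun o ho => hone o ((hfb _).1 (by nth_rw 2 [← ho]; rw [hB, hb1])))
    (fun o ho => hone o ((hfab _).1 (by nth_rw 2 [← ho]; rw [hB, hb1, hA, ha1])))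
  obtain ⟨g, hg, hgT, rfl⟩ := hw
  have hmem : (⟨g, hg, hgT⟩ : fixer G T) ∈ K := by rw [htop]; trivial
  exact hmem

theorem not_inducesEven_five {G : Subgroup (Perm α)} (hn : 10 ≤ Fintype.card α)
    (ht : IsMultTransitive G 4) (hh : IsHomogeneous G 5)
    (hidx : ∀ S : Finset α, #S = 5 → (induced G S).index = 2) : ¬ InducesEven G 5 := by
  intro h
  have hodd : NoInvolutionFixing G 3 := h.noInvolutionFixing
  obtain ⟨T, -, hT⟩ := exists_superset_card (∅ : Finset α) (k := 4) (by simp) (by omega)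
  obtain ⟨t₁, t₂, t₃, t₄, h12, h13, h14, h23, h24, h34, hTeq⟩ := card_eq_four.1 hT
  have hTmem : ∀ t, t ∈ T ↔ t = t₁ ∨ t = t₂ ∨ t = t₃ ∨ t = t₄ := by
    intro t; rw [hTeq]; simp only [mem_insert, mem_singleton]
  have hmaps : ∀ p : Perm α, (∀ t ∈ T, p t ∈ T) → ∀ t, p t ∈ T ↔ t ∈ T := by
    intro p hp t
    have e := image_eq_of_forall_mem hp le_rfl
    constructor
    · intro hpt
      rw [← e, mem_image] at hpt
      obtain ⟨s, hs, hst⟩ := hpt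
      rwa [← p.injective hst]
    · exact hp t
  -- a 4-cycle `z` on `T` with `z ^ 4 = 1`
  obtain ⟨z₀, hz₀, hz₀T⟩ := ht.exists_map_eq [t₁, t₂, t₃, t₄] [t₂, t₃, t₄, t₁]
    (by simp [*]) (by simp [*, h12.symm, h13.symm, h14.symm]) rfl le_rfl
  simp only [List.map_cons, List.map_nil, List.cons.injEq, and_true] at hz₀T
  obtain ⟨y1, y2, y3, y4⟩ := hz₀T
  have hz₀4 : ∀ t ∈ T, (z₀ ^ 4) t = t := by
    intro t ht
    rw [hTmem] at ht
    rcases ht with rfl | rfl | rfl | rfl <;> simp [pow_succ, Perm.mul_apply, y1, y2, y3, y4]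
  obtain ⟨l, hl⟩ := hodd.odd_orderOf (G.pow_mem hz₀ 4) T (by omega) hz₀4
  obtain ⟨z, hz, hz4, hzT⟩ : ∃ z ∈ G, z ^ 4 = 1 ∧ ∀ t ∈ T, z t = z₀ t := by
    refine ⟨z₀ ^ ((2 * l + 1) * (2 * l + 1)), G.pow_mem hz₀ _, ?_, fun t ht => ?_⟩
    · rw [← pow_mul, mul_comm, pow_mul, pow_mul, ← hl, pow_orderOf_eq_one, one_pow]
    · rw [show (2 * l + 1) * (2 * l + 1) = 4 * (l * l + l) + 1 by ring, pow_succ',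
        Perm.mul_apply, pow_mul, pow_apply_eq_self (hz₀4 t ht)]
  have z1 : z t₁ = t₂ := by rw [hzT t₁ (by simp [hTmem]), y1]
  have z2 : z t₂ = t₃ := by rw [hzT t₂ (by simp [hTmem]), y2]
  have z3 : z t₃ = t₄ := by rw [hzT t₃ (by simp [hTmem]), y3]
  have z4 : z t₄ = t₁ := by rw [hzT t₄ (by simp [hTmem]), y4]
  set a := z * z with ha_def
  have ha : a ∈ G := G.mul_mem hz hz
  have ha2 : a * a = 1 := by rw [ha_def, ← hz4]; rfl
  have haz : ∀ w, a w = z (z w) := fun w => rfl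
  have a1 : a t₁ = t₃ := by rw [haz, z1, z2]
  have a2 : a t₂ = t₄ := by rw [haz, z2, z3]
  have a3 : a t₃ = t₁ := by rw [haz, z3, z4]
  have a4 : a t₄ = t₂ := by rw [haz, z4, z1]
  have haT : ∀ t ∈ T, a t ∈ T := by
    intro t ht
    rw [hTmem] at ht ⊢
    rcases ht with rfl | rfl | rfl | rfl <;> simp [a1, a2, a3, a4]
  obtain ⟨f₁, f₂, hf12, hfa⟩ := card_eq_two.1 (h.card_fixed_eq_two hn ht ha ha2 (p := t₁) (s := t₂)
    (by rw [a1]; exact h13.symm) (by rw [a2]; exact h24.symm) h12.symm (by rwa [a1]))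
  have hfa : ∀ w, a w = w ↔ w = f₁ ∨ w = f₂ := by
    intro w
    have : w ∈ ({w | a w = w} : Finset α) ↔ w = f₁ ∨ w = f₂ := by rw [hfa]; simp
    simpa using this
  have hnotT : ∀ w, a w = w → w ∉ T := by
    intro w hw hwT
    rw [hTmem] at hwT
    rcases hwT with rfl | rfl | rfl | rfl
    · exact h13 (hw.symm.trans a1)
    · exact h24 (hw.symm.trans a2)
    · exact h13 (a3.symm.trans hw)
    · exact h24 (a4.symm.trans hw)
  have hnd : ∀ w, w ∉ T → [w, t₁, t₂, t₃, t₄].Nodup := by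
    intro w hw
    rw [hTmem] at hw
    simp only [not_or] at hw
    simp [*]
  have hf₁ : a f₁ = f₁ := (hfa _).2 (Or.inl rfl)
  have hf₂ : a f₂ = f₂ := (hfa _).2 (Or.inr rfl)
  have hzf : ∀ w, a w = w → z w ≠ w := fun w hw =>
    h.not_fourCycle (hnd w (hnotT w hw)) hz z1 z2 z3 z4
  have hzf₁ : z f₁ = f₂ := ((hfa _).1 (by
    show z (z (z f₁)) = z f₁
    rw [← haz f₁, hf₁])).resolve_left (hzf f₁ hf₁)
  have hzf₂ : z f₂ = f₁ := by rw [← hzf₁, ← haz, hf₁]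
  -- a Klein four-group on `T` that contains `a`
  obtain ⟨e₀, he₀, he₀T⟩ := ht.exists_map_eq [t₁, t₂, t₃, t₄] [t₂, t₁, t₄, t₃]
    (by simp [*]) (by simp [*, h12.symm, h34.symm]) rfl le_rfl
  simp only [List.map_cons, List.map_nil, List.cons.injEq, and_true] at he₀T
  obtain ⟨x1, x2, x3, x4⟩ := he₀T
  have he₀2 : ∀ t ∈ T, e₀ (e₀ t) = t := by
    intro t ht
    rw [hTmem] at ht
    rcases ht with rfl | rfl | rfl | rfl <;> simp [x1, x2, x3, x4]
  obtain ⟨e, he, he2, heT⟩ := hodd.exists_involution he₀ T (by omega) he₀2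
  have e1 : e t₁ = t₂ := by rw [heT _ (he₀2 _ (by simp [hTmem])), x1]
  have e2 : e t₂ = t₁ := by rw [heT _ (he₀2 _ (by simp [hTmem])), x2]
  have e3 : e t₃ = t₄ := by rw [heT _ (he₀2 _ (by simp [hTmem])), x3]
  have e4 : e t₄ = t₃ := by rw [heT _ (he₀2 _ (by simp [hTmem])), x4]
  have hae : ∀ t ∈ T, a (e (a (e t))) = t := by
    intro t ht
    rw [hTmem] at ht
    rcases ht with rfl | rfl | rfl | rfl <;> simp only [e1, e2, e3, e4, a1, a2, a3, a4]
  obtain ⟨b, hb, hb2, hab, hbe⟩ := hodd.exists_commuting_involution ha he ha2 he2 T (by omega) hae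
  have b1 : b t₁ = t₄ := by rw [hbe _ (hae _ (by simp [hTmem])), e1, a2]
  have b2 : b t₂ = t₃ := by rw [hbe _ (hae _ (by simp [hTmem])), e2, a1]
  have b3 : b t₃ = t₂ := by rw [hbe _ (hae _ (by simp [hTmem])), e3, a4]
  have b4 : b t₄ = t₁ := by rw [hbe _ (hae _ (by simp [hTmem])), e4, a3]
  have hbT : ∀ t ∈ T, b t ∈ T := by
    intro t ht
    rw [hTmem] at ht ⊢
    rcases ht with rfl | rfl | rfl | rfl <;> simp [b1, b2, b3, b4]
  have hbf₁ : b f₁ = f₁ := by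
    refine ((hfa _).1 (by rw [hab, hf₁])).resolve_right fun hbf => ?_
    -- otherwise `z * b` fixes `f₁` and is a transposition on `T`
    have hf₁T := hnotT f₁ hf₁
    have hf₁T' := hf₁T
    rw [hTmem] at hf₁T'
    simp only [not_or] at hf₁T'
    refine h.not_swappable (S := insert f₁ T) (by rw [card_insert_of_notMem hf₁T, hT]) (a := t₂)
      (b := t₄) (by simp [hTmem]) (by simp [hTmem]) h24 ⟨z * b, G.mul_mem hz hb, fun w hw => ?_⟩
    rw [mem_insert, hTmem] at hw
    rw [Perm.mul_apply]
    rcases hw with e | e | e | e | e <;> rw [e]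
    · rw [hbf, hzf₂, swap_apply_of_ne_of_ne hf₁T'.2.1 hf₁T'.2.2.2]
    · rw [b1, z4, swap_apply_of_ne_of_ne h12 h14]
    · rw [b2, z3, swap_apply_left]
    · rw [b3, z2, swap_apply_of_ne_of_ne h23.symm h34]
    · rw [b4, z1, swap_apply_right]
  have hbf₂ : b f₂ = f₂ := by
    refine ((hfa _).1 (by rw [hab, hf₂])).resolve_left fun hbf => hf12 ?_
    exact b.injective (hbf₁.trans hbf.symm)
  have hfix : ∀ c ∈ G, c * c = 1 → (∃ p s, c p ≠ p ∧ c s ≠ s ∧ s ≠ p ∧ s ≠ c p) → c f₁ = f₁ →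
      c f₂ = f₂ → ∀ w, c w = w ↔ w = f₁ ∨ w = f₂ := by
    rintro c hc hc2 ⟨p, s, hp, hs, hsp, hscp⟩ hcf₁ hcf₂ w
    have h1 := h.card_fixed_eq_two hn ht hc hc2 hp hs hsp hscp
    have h2 : ({f₁, f₂} : Finset α) = univ.filter (fun w => c w = w) := by
      refine eq_of_subset_of_card_le ?_ (by rw [h1, card_pair hf12])
      intro w hw
      simp only [mem_insert, mem_singleton] at hw
      rw [mem_filter]
      rcases hw with rfl | rfl
      · exact ⟨mem_univ _, hcf₁⟩
      · exact ⟨mem_univ _, hcf₂⟩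
    have h3 : w ∈ ({w | c w = w} : Finset α) ↔ w = f₁ ∨ w = f₂ := by rw [← h2]; simp
    simpa using h3
  have hfb := hfix b hb hb2 ⟨t₁, t₂, by rw [b1]; exact h14.symm, by rw [b2]; exact h23.symm,
    h12.symm, by rwa [b1]⟩ hbf₁ hbf₂
  have hba2 : b * a * (b * a) = 1 := by
    have hcomm : a * b = b * a := Equiv.ext hab
    rw [mul_assoc, ← mul_assoc a b a, hcomm, mul_assoc, ha2, mul_one, hb2]
  have hfab := hfix (b * a) (G.mul_mem hb ha) hba2 ⟨t₁, t₃,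
    by rw [Perm.mul_apply, a1, b3]; exact h12.symm, by rw [Perm.mul_apply, a3, b1]; exact h34.symm,
    h13.symm, by rw [Perm.mul_apply, a1, b3]; exact h23.symm⟩
    (by rw [Perm.mul_apply, hf₁, hbf₁]) (by rw [Perm.mul_apply, hf₂, hbf₂])
  have hnl : ¬ Linked G T f₁ f₂ := by
    rintro ⟨o, ho, hoT, hof⟩
    refine h.not_fourCycle (hnd f₁ (hnotT _ hf₁)) (G.mul_mem hz ho) (t₁ := t₁) (t₂ := t₂)
      (t₃ := t₃) (t₄ := t₄) ?_ ?_ ?_ ?_ ?_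
    · rw [Perm.mul_apply, hoT t₁ (by simp [hTmem]), z1]
    · rw [Perm.mul_apply, hoT t₂ (by simp [hTmem]), z2]
    · rw [Perm.mul_apply, hoT t₃ (by simp [hTmem]), z3]
    · rw [Perm.mul_apply, hoT t₄ (by simp [hTmem]), z4]
    · rw [Perm.mul_apply, hof, hzf₂]
  have hclass : {w | Linked G T f₁ w} = {f₁} := by
    ext w
    constructor
    · exact linked_self_of_fourGroup hodd T (by omega) ha hb ha2 hb2 hab (hmaps a haT)
        (hmaps b hbT) hfa hfb hfab hnl
    · rintro rfl
      exact Linked.refl _ _ _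
  -- links are trivial, so that the group induced on a 5-set has index `n - 4`
  obtain ⟨S, -, hS⟩ := exists_superset_card (∅ : Finset α) (k := 5) (by simp) (by omega)
  obtain ⟨v, hv, hr⟩ := exists_ncard_linked_eq ht hh (by omega) S hS
  have hv1 := hv T hT f₁ (hnotT _ hf₁)
  rw [hclass, Set.ncard_singleton] at hv1
  rw [← hv1, hidx S hS] at hr
  omega

/-- The alternating case is impossible, so that index at most 2 means transitivity. -/
theorem isMultTransitive_of_index_le_two {G : Subgroup (Perm α)} {K : ℕ} (hK : 2 ≤ K)
    (hn : 2 * (K + 3) ≤ Fintype.card α) (ht : IsMultTransitive G (K + 2))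
    (hh : IsHomogeneous G (K + 3))
    (hidx : ∀ S : Finset α, #S = K + 3 → (induced G S).index ≤ 2) :
    IsMultTransitive G (K + 3) := by
  rcases hh.isMultTransitive_or_inducesEven (by omega) hidx with h | ⟨h, h2⟩
  · exact h
  · exfalso
    by_cases hK3 : 3 ≤ K
    · exact not_inducesEven_of_three_le hK3 (by omega) ht h
    · obtain rfl : K = 2 := by omega
      exact not_inducesEven_five (by omega) ht hh h2 h

end

/-! ### Homogeneous groups of degree at least ten are 4-transitive -/

section

variable {α : Type*} [DecidableEq α] [Fintype α]

/-- If a 2-subgroup that is maximal for five points is maximal for three points, and `G` is not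
4-transitive, then the reduced group has the same parameters as `G` and hence the same degree, so
that the 2-subgroup is trivial. -/
theorem IsMaxTwoSubgroup.noInvolutionFixing_three {G Q : Subgroup (Perm α)}
    (hn : 10 ≤ Fintype.card α) (hQ5 : IsMaxTwoSubgroup G Q 5) (hQ : IsMaxTwoSubgroup G Q 3)
    (ht : IsMultTransitive G 3) (h4 : IsHomogeneous G 4) (h5 : IsHomogeneous G 5)
    (hnt : ¬ IsMultTransitive G 4) : NoInvolutionFixing G 3 := by
  have hF : Fintype.card (fixedFinset Q) = #(fixedFinset Q) := Fintype.card_coe _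
  have hF5 := hQ5.le_card
  have ht' : IsMultTransitive (reduced G Q) 3 := hQ.isMultTransitive le_rfl hQ.le_card ht
  have h4' : IsHomogeneous (reduced G Q) 4 := hQ.isHomogeneous (by omega) h4
  have h5' : IsHomogeneous (reduced G Q) 5 := hQ.isHomogeneous (by omega) h5
  obtain ⟨S, -, hS⟩ := exists_superset_card (∅ : Finset (fixedFinset Q)) (k := 4) (by simp)
    (by omega)
  obtain ⟨Θ, -, hΘ⟩ := exists_superset_card (∅ : Finset (fixedFinset Q)) (k := 5) (by simp)
    (by omega)
  obtain ⟨v', hv', hr'⟩ := exists_ncard_linked_eq ht' h4' (by omega) S hS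
  obtain ⟨v, hv, hr⟩ := exists_ncard_linked_eq ht h4 (by omega)
    (S.map (Function.Embedding.subtype _)) (by rwa [card_map])
  have hq' := linkCount_mul h5' (by omega) hv' Θ hΘ
  have hq := linkCount_mul h5 (by omega) hv (Θ.map (Function.Embedding.subtype _))
    (by rwa [card_map])
  rw [hQ.linkCount_eq Θ (by omega), ← hr'] at hq'
  rw [hQ.index_induced S (by omega)] at hq' hr'
  rw [← hr] at hq
  have hne : (induced G (S.map (Function.Embedding.subtype _))).index ≠ 1 := fun h =>
    hnt (h4.isMultTransitive_of_index (by omega) _ (by rwa [card_map]) h)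
  have h0 : (induced G (S.map (Function.Embedding.subtype _))).index ≠ 0 :=
    Subgroup.index_ne_zero_of_finite
  generalize (induced G (S.map (Function.Embedding.subtype _))).index = r at *
  generalize linkCount G (Θ.map (Function.Embedding.subtype _)) = q at *
  have hvv : v = v' := by
    obtain ⟨r, rfl⟩ : ∃ r', r = r' + 2 := ⟨r - 2, by omega⟩
    obtain ⟨w, rfl⟩ : ∃ w, v = w + 1 := Nat.exists_eq_succ_of_ne_zero (by rintro rfl; omega)
    obtain ⟨w', rfl⟩ : ∃ w, v' = w + 1 := Nat.exists_eq_succ_of_ne_zero (by rintro rfl; omega)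
    have e : ∀ w, (r + 2) * (w + 1) - 1 = (r + 2) * w + r + 1 := fun w => by
      rw [show (r + 2) * (w + 1) = (r + 2) * w + r + 1 + 1 by ring]; rfl
    rw [e, Nat.add_sub_cancel] at hq hq'
    rcases Nat.eq_zero_or_pos q with rfl | hq0
    · omega
    · have h1 : q * 20 * (w * ((r + 2) * w' + r + 1)) = q * 20 * (w' * ((r + 2) * w + r + 1)) := by
        calc q * 20 * (w * ((r + 2) * w' + r + 1))
            = ((3 + 1) * (3 + 2) * w) * (q * ((r + 2) * w' + r + 1)) := by ring
          _ = (q * ((r + 2) * w + r + 1)) * ((3 + 1) * (3 + 2) * w') := by rw [hq, hq']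
          _ = q * 20 * (w' * ((r + 2) * w + r + 1)) := by ring
      have h2 := Nat.eq_of_mul_eq_mul_left (by positivity) h1
      have h3 : w * (r + 1) = w' * (r + 1) := by
        have e1 : w * ((r + 2) * w' + r + 1) = (r + 2) * (w * w') + w * (r + 1) := by ring
        have e2 : w' * ((r + 2) * w + r + 1) = (r + 2) * (w * w') + w' * (r + 1) := by ring
        omega
      have h4 := Nat.eq_of_mul_eq_mul_right (by omega) h3
      omega
  rw [hvv, hr'] at hr
  have huniv : fixedFinset Q = univ := by
    rw [← card_eq_iff_eq_univ]; omega
  have hQ1 : Nat.card Q = 1 := by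
    rw [Subgroup.card_eq_one, Subgroup.eq_bot_iff_forall]
    intro q hq
    refine Equiv.ext fun x => mem_fixedFinset.1 ?_ q hq
    rw [huniv]
    exact mem_univ x
  intro g hg hg2 A hA hfix
  have h1 := hQ.max (Subgroup.zpowers g) (Subgroup.zpowers_le.2 hg) (by
      have hd : orderOf g ∣ 2 ^ 1 := orderOf_dvd_of_pow_eq_one (by rw [pow_one, pow_two, hg2])
      obtain ⟨j, -, hj⟩ := (Nat.dvd_prime_pow Nat.prime_two).1 hd
      exact IsPGroup.of_card (n := j) (by rw [Nat.card_zpowers, hj]))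
    (hA.trans (card_le_card fun x hx => mem_fixedFinset.2 fun q hq => by
      have hle : Subgroup.zpowers g ≤ MulAction.stabilizer (Perm α) x :=
        Subgroup.zpowers_le.2 (hfix x hx)
      exact hle hq))
  rw [hQ1, Nat.card_zpowers] at h1
  exact orderOf_eq_one_iff.1 (le_antisymm h1 (orderOf_pos g))

theorem four_dvd_card {X : Type*} [Group X] [Finite X] {a b : X} (ha : a * a = 1) (hb : b * b = 1)
    (hab : a * b = b * a) (ha1 : a ≠ 1) (hb1 : b ≠ 1) (hne : a ≠ b) : 4 ∣ Nat.card X := by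
  have hbab : b * (a * b) = a := by rw [hab, ← mul_assoc, hb, one_mul]
  have haab : a * (a * b) = b := by rw [← mul_assoc, ha, one_mul]
  have haba : a * b * a = b := by rw [hab, mul_assoc, ha, mul_one]
  have habb : a * b * b = a := by rw [mul_assoc, hb, mul_one]
  have habab : a * b * (a * b) = 1 := by rw [mul_assoc, hbab, ha]
  have ha_inv : a⁻¹ = a := inv_eq_of_mul_eq_one_left ha
  have hb_inv : b⁻¹ = b := inv_eq_of_mul_eq_one_left hb
  let V : Subgroup X :=
    { carrier := {1, a, b, a * b}
      mul_mem' := by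
        rintro x y (rfl | rfl | rfl | rfl) (rfl | rfl | rfl | rfl) <;>
          simp only [one_mul, mul_one, ha, hb, hbab, haab, haba, habb, habab, ← hab,
            Set.mem_insert_iff, Set.mem_singleton_iff, true_or, or_true]
      one_mem' := Or.inl rfl
      inv_mem' := by
        rintro x (rfl | rfl | rfl | rfl) <;>
          simp only [inv_one, mul_inv_rev, ha_inv, hb_inv, ← hab, Set.mem_insert_iff,
            Set.mem_singleton_iff, true_or, or_true] }
  have hV : Nat.card V = 4 := by
    classical
    have h1 : (V : Set X) = ({1, a, b, a * b} : Finset X) := by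
      simp only [coe_insert, coe_singleton]; rfl
    rw [← SetLike.coe_sort_coe, Nat.card_coe_set_eq, h1, Set.ncard_coe_finset,
      card_insert_of_notMem, card_insert_of_notMem, card_insert_of_notMem, card_singleton]
    · simpa using ha1
    · simp [hne, hb1]
    · simp only [mem_insert, mem_singleton, not_or]
      refine ⟨ha1.symm, hb1.symm, fun h => hne ?_⟩
      rw [← ha_inv, eq_comm]
      exact (inv_eq_of_mul_eq_one_right h.symm).symm
  rw [← hV]
  exact Subgroup.card_subgroup_dvd_card V

theorem index_dvd_six {G : Subgroup (Perm α)} {S : Finset α} (hS : #S = 4)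
    (h : 4 ∣ Nat.card (induced G S)) : (induced G S).index ∣ 6 := by
  obtain ⟨m, hm⟩ := h
  have h1 := (induced G S).card_mul_index
  rw [Nat.card_perm, Nat.card_eq_finsetCard, hS, hm, show Nat.factorial 4 = 4 * 6 from rfl,
    mul_assoc] at h1
  exact ⟨m, by rw [mul_comm]; exact (Nat.eq_of_mul_eq_mul_left (by norm_num) h1).symm⟩

/-- Two commuting involutions that, together with their product, move all points of `R`, partition
`R` into 4-sets. -/
theorem four_dvd_card_of_fixedPointFree (R : Finset α) {y b : Perm α} (hy2 : y * y = 1)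
    (hb2 : b * b = 1) (hyb : ∀ z, y (b z) = b (y z)) (hyR : ∀ z ∈ R, y z ∈ R)
    (hbR : ∀ z ∈ R, b z ∈ R) (hy : ∀ z ∈ R, y z ≠ z) (hb : ∀ z ∈ R, b z ≠ z)
    (hby : ∀ z ∈ R, b z ≠ y z) : 4 ∣ #R := by
  have hyy : ∀ z, y (y z) = z := fun z => by rw [← Perm.mul_apply, hy2, Perm.one_apply]
  have hbb : ∀ z, b (b z) = z := fun z => by rw [← Perm.mul_apply, hb2, Perm.one_apply]
  let p : α → Finset α := fun z => {z, y z}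
  have hp : ∀ z w, p z = p w ↔ w = z ∨ w = y z := by
    intro z w
    constructor
    · intro h
      have : w ∈ p z := by rw [h]; simp [p]
      simpa [p] using this
    · rintro (rfl | rfl)
      · rfl
      · simp only [p, hyy]; exact pair_comm _ _
  have hfib : ∀ P ∈ R.image p, #{z ∈ R | p z = P} = 2 := by
    intro P hP
    obtain ⟨w, hw, rfl⟩ := mem_image.1 hP
    have : {z ∈ R | p z = p w} = {w, y w} := by
      ext z
      simp only [mem_filter, mem_insert, mem_singleton, eq_comm (a := p z), hp w z]
      constructor
      · exact fun h => h.2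
      · rintro (rfl | rfl)
        · exact ⟨hw, Or.inl rfl⟩
        · exact ⟨hyR w hw, Or.inr rfl⟩
    rw [this, card_pair (hy w hw).symm]
  have hcard : #R = #(R.image p) * 2 := by
    rw [card_eq_sum_card_image p R, sum_congr rfl hfib, sum_const, smul_eq_mul]
  have hpb : ∀ z, (p z).image b = p (b z) := fun z => by
    simp only [p, image_insert, image_singleton, hyb]
  obtain ⟨j, hj⟩ : Even #(R.image p) := by
    refine even_card_of_involution _ (fun P => P.image b) ?_ ?_ ?_
    · intro P hP
      obtain ⟨w, hw, rfl⟩ := mem_image.1 hP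
      simp only [hpb]
      exact mem_image_of_mem _ (hbR w hw)
    · intro P hP
      obtain ⟨w, hw, rfl⟩ := mem_image.1 hP
      simp only [hpb]
      intro h
      rcases (hp _ _).1 h with h | h
      · exact hb w hw h.symm
      · have h' := congrArg y h
        rw [hyy] at h'
        exact hby w hw h'.symm
    · intro P hP
      obtain ⟨w, hw, rfl⟩ := mem_image.1 hP
      simp only [hpb, hbb]
  exact ⟨j, by omega⟩

/-- If an involution fixes exactly one point, then all double transpositions are induced. The map
that sends `(p, q, r, s)` to `(q, r, s, y s)`, where the involution `y` fixes `p` and swaps `q` and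
`r`, is injective on classes of 4-tuples. -/
theorem double_swap_of_card_fixed_eq_one {G : Subgroup (Perm α)} (ht : IsMultTransitive G 3)
    (hodd : NoInvolutionFixing G 3) {y : Perm α} (hy : y ∈ G) (hy2 : y * y = 1) {l x x' : α}
    (hfix : ∀ z, y z = z ↔ z = l) (hyx : y x = x') (hxx' : x ≠ x') {p q r s : α}
    (hnd : [p, q, r, s].Nodup) :
    ∃ g ∈ G, g p = q ∧ g q = p ∧ g r = s ∧ g s = r := by
  have hyy : ∀ z, y (y z) = z := fun z => by rw [← Perm.mul_apply, hy2, Perm.one_apply]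
  have hyl : y l = l := (hfix l).2 rfl
  have hlx : l ≠ x := fun e => hxx' (by rw [← hyx, ← e, hyl])
  have hlx' : l ≠ x' := fun e => hlx (by rw [← hyl, e, ← hyx, hyy])
  simp only [List.nodup_cons, List.mem_cons, not_or, List.not_mem_nil, not_false_eq_true,
    and_true, List.nodup_nil] at hnd
  obtain ⟨⟨hpq, hpr, hps⟩, ⟨hqr, hqs⟩, hrs⟩ := hnd
  have hY : ∀ σ : Perm α, ∃ Y ∈ G, Y * Y = 1 ∧ (∀ z, Y z = z ↔ z = σ p) ∧ Y (σ q) = σ r := by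
    intro σ
    obtain ⟨g, hg, hgl⟩ := ht.exists_map_eq [l, x, x'] [σ p, σ q, σ r] (by simp [*])
      (by simp [*]) rfl le_rfl
    simp only [List.map_cons, List.map_nil, List.cons.injEq, and_true] at hgl
    obtain ⟨g1, g2, g3⟩ := hgl
    refine ⟨g * y * g⁻¹, G.mul_mem (G.mul_mem hg hy) (G.inv_mem hg), ?_, fun z => ?_, ?_⟩
    · rw [show g * y * g⁻¹ * (g * y * g⁻¹) = g * (y * y) * g⁻¹ by group, hy2]; simp
    · obtain ⟨w, rfl⟩ := g.surjective z
      rw [Perm.mul_apply, Perm.mul_apply, inv_apply_self', g.injective.eq_iff, hfix, ← g1,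
        g.injective.eq_iff]
    · rw [Perm.mul_apply, Perm.mul_apply, ← g2, inv_apply_self', hyx, g3]
  choose Y hYG hY2 hYfix hYq using hY
  have hYY : ∀ σ z, Y σ (Y σ z) = z := fun σ z => by
    rw [← Perm.mul_apply, hY2, Perm.one_apply]
  have hYr : ∀ σ, Y σ (σ r) = σ q := fun σ => by rw [← hYq, hYY]
  have hΦ : ∀ σ : Perm α, ∃ Φ : Perm α,
      Φ p = σ q ∧ Φ q = σ r ∧ Φ r = σ s ∧ Φ s = Y σ (σ s) := by
    intro σ
    have h1 : σ q ≠ Y σ (σ s) := fun e => hrs (σ.injective (by rw [← hYq, e, hYY]))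
    have h2 : σ r ≠ Y σ (σ s) := fun e => hqs (σ.injective (by rw [← hYr, e, hYY]))
    have h3 : σ s ≠ Y σ (σ s) := fun e => hps (σ.injective ((hYfix _ _).1 e.symm)).symm
    obtain ⟨Φ, h⟩ := exists_perm_map_eq [p, q, r, s] [σ q, σ r, σ s, Y σ (σ s)]
      (by simp [*]) (by simp [*]) rfl
    simp only [List.map_cons, List.map_nil, List.cons.injEq, and_true] at h
    exact ⟨Φ, h⟩
  choose Φ hΦp hΦq hΦr hΦs using hΦ
  obtain ⟨σ, g, hg, h⟩ := exists_apply_eq_of_class_injective G {p, q, r, s} Φ (by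
    rintro σ τ ⟨g, hg, h⟩
    have e1 := h p (by simp)
    have e2 := h q (by simp)
    have e3 := h r (by simp)
    have e4 := h s (by simp)
    rw [hΦp, hΦp] at e1
    rw [hΦq, hΦq] at e2
    rw [hΦr, hΦr] at e3
    rw [hΦs, hΦs] at e4
    obtain ⟨f, hf, hfS, hfY⟩ := hodd.lift (hYG σ) (hY2 σ) (hYG τ) (hY2 τ) hg {σ q, σ r, σ s}
      (by rw [card_insert_of_notMem (by simp [hqr, hqs]), card_pair (by simp [hrs])]) (by
        intro z hz
        simp only [mem_insert, mem_singleton] at hz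
        rcases hz with e | e | e <;> rw [e]
        · rw [hYq, e2, e1, hYq]
        · rw [hYr, e1, e2, hYr]
        · rw [e4, e3])
    refine ⟨f, hf, fun z hz => ?_⟩
    simp only [mem_insert, mem_singleton] at hz
    rcases hz with e | e | e | e <;> rw [e]
    · rw [← hYfix, ← hfY, (hYfix _ _).2 rfl]
    · rw [hfS _ (by simp), e1]
    · rw [hfS _ (by simp), e2]
    · rw [hfS _ (by simp), e3])
  have e1 := h p (by simp)
  have e2 := h q (by simp)
  have e3 := h r (by simp)
  have e4 := h s (by simp)
  rw [hΦp] at e1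
  rw [hΦq] at e2
  rw [hΦr] at e3
  rw [hΦs] at e4
  have ginv : ∀ {a b}, g a = b → g⁻¹ b = a := fun e => by rw [Perm.inv_eq_iff_eq, e]
  refine ⟨g * Y σ * g⁻¹, G.mul_mem (G.mul_mem hg (hYG σ)) (G.inv_mem hg), ?_, ?_, ?_, ?_⟩ <;>
    rw [Perm.mul_apply, Perm.mul_apply]
  · rw [ginv e1, hYq, e2]
  · rw [ginv e2, hYr, e1]
  · rw [ginv e3, e4]
  · rw [ginv e4, hYY, e3]

/-- In that case the group induced on a 4-set is transitive, and the degree is odd, which the index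
equation excludes. -/
theorem isMultTransitive_four_of_card_fixed_eq_one {G : Subgroup (Perm α)}
    (hn : 10 ≤ Fintype.card α) (ht : IsMultTransitive G 3) (h4 : IsHomogeneous G 4)
    (h5 : IsHomogeneous G 5) (hodd : NoInvolutionFixing G 3) {y : Perm α} (hy : y ∈ G)
    (hy2 : y * y = 1) {l x x' : α} (hfix : ∀ z, y z = z ↔ z = l) (hyx : y x = x')
    (hxx' : x ≠ x') : IsMultTransitive G 4 := by
  obtain ⟨S, -, hS⟩ := exists_superset_card (∅ : Finset α) (k := 4) (by simp) (by omega)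
  by_contra hnt
  have htrans : MulAction.IsPretransitive (induced G S) S := by
    refine ⟨fun p q => ?_⟩
    by_cases hpq : p = q
    · exact ⟨1, by rw [one_smul, hpq]⟩
    have hpq' : (p : α) ≠ q := fun e => hpq (Subtype.ext e)
    obtain ⟨r, s, hrs, hR⟩ := card_eq_two.1 (show #(S \ {(p : α), (q : α)}) = 2 by
      rw [card_sdiff_of_subset (by simp [insert_subset_iff]), card_pair hpq', hS])
    have hSmem : ∀ z, z ∈ S ↔ z = p ∨ z = q ∨ z = r ∨ z = s := by
      intro z
      have h1 : z ∈ S \ {(p : α), (q : α)} ↔ z = r ∨ z = s := by rw [hR]; simp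
      simp only [mem_sdiff, mem_insert, mem_singleton] at h1
      constructor
      · tauto
      · rintro (rfl | rfl | h | h)
        · exact p.2
        · exact q.2
        · exact (h1.2 (Or.inl h)).1
        · exact (h1.2 (Or.inr h)).1
    have hr : r ∈ S \ {(p : α), (q : α)} := by rw [hR]; simp
    have hs : s ∈ S \ {(p : α), (q : α)} := by rw [hR]; simp
    simp only [mem_sdiff, mem_insert, mem_singleton, not_or] at hr hs
    obtain ⟨g, hg, g1, g2, g3, g4⟩ := double_swap_of_card_fixed_eq_one ht hodd hy hy2 hfix hyx hxx'
      (p := p) (q := q) (r := r) (s := s) (by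
        simp [hpq', hrs, Ne.symm hr.2.1, Ne.symm hr.2.2, Ne.symm hs.2.1, Ne.symm hs.2.2])
    have hgS : ∀ z : S, g z ∈ S := by
      rintro ⟨z, hz⟩
      rw [hSmem] at hz ⊢
      rcases hz with rfl | rfl | rfl | rfl <;> simp [g1, g2, g3, g4]
    refine ⟨⟨Equiv.ofBijective (fun z => ⟨g z, hgS z⟩) (Finite.injective_iff_bijective.1
      fun z w h => Subtype.ext (g.injective (congrArg Subtype.val h))), g, hg, fun z => rfl⟩,
      Subtype.ext g1⟩
  have hdvd : 4 ∣ Nat.card (induced G S) := by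
    obtain ⟨p, hp⟩ := card_pos.1 (show 0 < #S by omega)
    rw [← hS, ← Nat.card_eq_finsetCard,
      ← MulAction.index_stabilizer_of_transitive (induced G S) (⟨p, hp⟩ : S)]
    exact Subgroup.index_dvd_card _
  have h24 := (index_eq_three_of_dvd_six hn ht h4 h5 S hS (index_dvd_six hS hdvd)
    fun h => hnt (h4.isMultTransitive_of_index (by omega) S hS h)).2
  have hcard := card_eq_of_fixed_iff y {l} (fun z => by rw [hfix, mem_singleton])
  obtain ⟨j, hj⟩ := even_card_filter_ne y hy2
  rw [card_singleton, h24, hj] at hcard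
  omega

end

/-! ### Exchanges within a 4-set -/

section

variable {α : Type*} [DecidableEq α] [Fintype α]

/-- Some element of `G` exchanges `p` and `q` and fixes `r` and `s`. -/
def Exchange (G : Subgroup (Perm α)) (p q r s : α) : Prop :=
  ∃ g ∈ G, g p = q ∧ g q = p ∧ g r = r ∧ g s = s

theorem Exchange.symm {G : Subgroup (Perm α)} {p q r s : α} (h : Exchange G p q r s) :
    Exchange G q p r s := by
  obtain ⟨g, hg, h1, h2, h3, h4⟩ := h
  exact ⟨g, hg, h2, h1, h3, h4⟩

theorem Exchange.symm_right {G : Subgroup (Perm α)} {p q r s : α} (h : Exchange G p q r s) :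
    Exchange G p q s r := by
  obtain ⟨g, hg, h1, h2, h3, h4⟩ := h
  exact ⟨g, hg, h1, h2, h4, h3⟩

theorem Exchange.map {G : Subgroup (Perm α)} {p q r s : α} (h : Exchange G p q r s) {f : Perm α}
    (hf : f ∈ G) : Exchange G (f p) (f q) (f r) (f s) := by
  obtain ⟨g, hg, h1, h2, h3, h4⟩ := h
  refine ⟨f * g * f⁻¹, G.mul_mem (G.mul_mem hf hg) (G.inv_mem hf), ?_, ?_, ?_, ?_⟩ <;>
    simp [h1, h2, h3, h4]

theorem Exchange.swappable {G : Subgroup (Perm α)} {p q r s : α} (hnd : [p, q, r, s].Nodup)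
    (h : Exchange G p q r s) : Swappable G {p, q, r, s} p q := by
  obtain ⟨g, hg, h1, h2, h3, h4⟩ := h
  simp only [List.nodup_cons, List.mem_cons, not_or, List.not_mem_nil, not_false_eq_true,
    and_true, List.nodup_nil] at hnd
  obtain ⟨⟨hpq, hpr, hps⟩, ⟨hqr, hqs⟩, hrs⟩ := hnd
  refine ⟨g, hg, fun x hx => ?_⟩
  simp only [mem_insert, mem_singleton] at hx
  rcases hx with e | e | e | e <;> rw [e]
  · rw [h1, swap_apply_left]
  · rw [h2, swap_apply_right]
  · rw [h3, swap_apply_of_ne_of_ne (Ne.symm hpr) (Ne.symm hqr)]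
  · rw [h4, swap_apply_of_ne_of_ne (Ne.symm hps) (Ne.symm hqs)]

theorem card_eq_four_of_nodup {p q r s : α} (hnd : [p, q, r, s].Nodup) :
    #({p, q, r, s} : Finset α) = 4 := by
  have := List.toFinset_card_of_nodup hnd
  simp only [List.toFinset_cons, List.toFinset_nil, insert_empty_eq] at this
  exact this

/-- If on one 4-set every point is exchanged with another one, then this holds on each 4-set. -/
theorem IsHomogeneous.exchange {G : Subgroup (Perm α)} (h4 : IsHomogeneous G 4) {a b c d : α}
    (hnd₀ : [a, b, c, d].Nodup) (h : Exchange G a b c d) (h' : Exchange G c d a b)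
    {p q r s : α} (hnd : [p, q, r, s].Nodup) :
    Exchange G p q r s ∨ Exchange G p r q s ∨ Exchange G p s q r := by
  have key : ∀ z ∈ ({a, b, c, d} : Finset α), ∃ k ∈ G, k z ∈ ({a, b, c, d} : Finset α) ∧ k z ≠ z ∧
      k (k z) = z ∧ ∀ w ∈ ({a, b, c, d} : Finset α), w ≠ z → w ≠ k z → k w = w := by
    simp only [List.nodup_cons, List.mem_cons, not_or, List.not_mem_nil, not_false_eq_true,
      and_true, List.nodup_nil] at hnd₀
    obtain ⟨⟨hab, hac, had⟩, ⟨hbc, hbd⟩, hcd⟩ := hnd₀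
    obtain ⟨g, hg, g1, g2, g3, g4⟩ := h
    obtain ⟨f, hf, f1, f2, f3, f4⟩ := h'
    intro z hz
    simp only [mem_insert, mem_singleton] at hz
    rcases hz with e | e | e | e <;> rw [e]
    · refine ⟨g, hg, by simp [g1], by rw [g1]; exact Ne.symm hab, by rw [g1, g2], fun w hw => ?_⟩
      simp only [mem_insert, mem_singleton] at hw
      rw [g1]
      rcases hw with e | e | e | e <;> rw [e] <;> simp [g3, g4]
    · refine ⟨g, hg, by simp [g2], by rw [g2]; exact hab, by rw [g2, g1], fun w hw => ?_⟩
      simp only [mem_insert, mem_singleton] at hw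
      rw [g2]
      rcases hw with e | e | e | e <;> rw [e] <;> simp [g3, g4]
    · refine ⟨f, hf, by simp [f1], by rw [f1]; exact Ne.symm hcd, by rw [f1, f2], fun w hw => ?_⟩
      simp only [mem_insert, mem_singleton] at hw
      rw [f1]
      rcases hw with e | e | e | e <;> rw [e] <;> simp [f3, f4]
    · refine ⟨f, hf, by simp [f2], by rw [f2]; exact hcd, by rw [f2, f1], fun w hw => ?_⟩
      simp only [mem_insert, mem_singleton] at hw
      rw [f2]
      rcases hw with e | e | e | e <;> rw [e] <;> simp [f3, f4]
  obtain ⟨g, hg, hgS⟩ := h4 {p, q, r, s} {a, b, c, d} (card_eq_four_of_nodup hnd)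
    (card_eq_four_of_nodup hnd₀)
  have himg := image_eq_of_forall_mem hgS
    (by rw [card_eq_four_of_nodup hnd, card_eq_four_of_nodup hnd₀])
  obtain ⟨k, hk, k1, k2, k3, k4⟩ := key (g p) (hgS p (by simp))
  simp only [List.nodup_cons, List.mem_cons, not_or, List.not_mem_nil, not_false_eq_true,
    and_true, List.nodup_nil] at hnd
  obtain ⟨⟨hpq, hpr, hps⟩, ⟨hqr, hqs⟩, hrs⟩ := hnd
  rw [← himg] at k1
  obtain ⟨t, ht, htk⟩ := mem_image.1 k1
  have hm : g⁻¹ * k * g ∈ G := G.mul_mem (G.mul_mem (G.inv_mem hg) hk) hg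
  have e1 : (g⁻¹ * k * g) p = t := by
    rw [Perm.mul_apply, Perm.mul_apply, ← htk, inv_apply_self']
  have e2 : (g⁻¹ * k * g) t = p := by
    rw [Perm.mul_apply, Perm.mul_apply, htk, k3, inv_apply_self']
  have e3 : ∀ w ∈ ({p, q, r, s} : Finset α), w ≠ p → w ≠ t → (g⁻¹ * k * g) w = w := by
    intro w hw hwp hwt
    rw [Perm.mul_apply, Perm.mul_apply, k4 (g w) (hgS w hw) (g.injective.ne hwp)
      (by rw [← htk]; exact g.injective.ne hwt), inv_apply_self']
  simp only [mem_insert, mem_singleton] at ht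
  rcases ht with e | e | e | e <;> rw [e] at e1 e2 e3 htk
  · exact absurd htk.symm k2
  · exact Or.inl ⟨_, hm, e1, e2, e3 r (by simp) (Ne.symm hpr) (Ne.symm hqr),
      e3 s (by simp) (Ne.symm hps) (Ne.symm hqs)⟩
  · exact Or.inr (Or.inl ⟨_, hm, e1, e2, e3 q (by simp) (Ne.symm hpq) hqr,
      e3 s (by simp) (Ne.symm hps) (Ne.symm hrs)⟩)
  · exact Or.inr (Or.inr ⟨_, hm, e1, e2, e3 q (by simp) (Ne.symm hpq) hqs,
      e3 r (by simp) (Ne.symm hpr) hrs⟩)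

/-- If moreover some point is exchanged with two points of a 4-set, then all transpositions of
that set are induced. -/
theorem IsHomogeneous.isMultTransitive_of_exchange {G : Subgroup (Perm α)}
    (h4 : IsHomogeneous G 4) (hn : 4 ≤ Fintype.card α)
    (hE : ∀ {p q r s : α}, [p, q, r, s].Nodup →
      Exchange G p q r s ∨ Exchange G p r q s ∨ Exchange G p s q r)
    {p q r s : α} (hnd : [p, q, r, s].Nodup) (h : Exchange G p q r s) (h' : Exchange G p r q s) :
    IsMultTransitive G 4 := by
  have perm : ∀ {a b c d : α}, [a, b, c, d].Perm [p, q, r, s] → Exchange G a b c d →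
      Swappable G {p, q, r, s} a b := by
    intro a b c d hp hx
    have h1 := hx.swappable (hp.nodup_iff.2 hnd)
    have h2 : ({a, b, c, d} : Finset α) = {p, q, r, s} := by
      have := List.toFinset_eq_of_perm _ _ hp
      simpa only [List.toFinset_cons, List.toFinset_nil, insert_empty_eq] using this
    rwa [h2] at h1
  have hpq := perm (List.Perm.refl _) h
  have hpr : Swappable G {p, q, r, s} p r := perm (by grind) h'
  have hps : Swappable G {p, q, r, s} p s := by
    have hP : [s, p, q, r].Perm [p, q, r, s] := by grind
    rcases hE (hP.nodup_iff.2 hnd) with hx | hx | hx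
    · exact (perm hP hx).symm
    · exact hpq.trans (by simp) (by simp) (by simp)
        (perm (show [s, q, p, r].Perm [p, q, r, s] by grind) hx).symm
    · exact hpr.trans (by simp) (by simp) (by simp)
        (perm (show [s, r, p, q].Perm [p, q, r, s] by grind) hx).symm
  have hall : ∀ z ∈ ({p, q, r, s} : Finset α), Swappable G {p, q, r, s} p z := by
    intro z hz
    simp only [mem_insert, mem_singleton] at hz
    rcases hz with e | e | e | e <;> rw [e]
    · exact Swappable.refl _ _ _
    · exact hpq
    · exact hpr
    · exact hps
  exact h4.isMultTransitive hn {p, q, r, s} (card_eq_four_of_nodup hnd)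
    (induced_eq_top_of_swappable fun a ha b hb _ =>
      (hall a ha).symm.trans ha (by simp) hb (hall b hb))

/-- Two 4-tuples whose first two points are exchanged lie in the same orbit, provided that the
target also admits a double transposition interchanging the two pairs. -/
theorem IsHomogeneous.exists_map_of_exchange {G : Subgroup (Perm α)} (h4 : IsHomogeneous G 4)
    (hU : ∀ {p q r s : α}, [p, q, r, s].Nodup → Exchange G p q r s → ¬ Exchange G p r q s)
    {a b c d : α} (hnd₀ : [a, b, c, d].Nodup) (h : Exchange G a b c d)
    {p q r s : α} (hnd : [p, q, r, s].Nodup) (hp : Exchange G p q r s) (hr : Exchange G r s p q)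
    {y : Perm α} (hy : y ∈ G) (y1 : y p = r) (y2 : y r = p) (y3 : y q = s) (y4 : y s = q) :
    ∃ f ∈ G, f a = p ∧ f b = q ∧ f c = r ∧ f d = s := by
  obtain ⟨g, hg, hgS⟩ := h4 {a, b, c, d} {p, q, r, s} (card_eq_four_of_nodup hnd₀)
    (card_eq_four_of_nodup hnd)
  obtain ⟨e, he, e1, e2, e3, e4⟩ := hp
  obtain ⟨e', he', e1', e2', e3', e4'⟩ := id hr
  have hp : Exchange G p q r s := ⟨e, he, e1, e2, e3, e4⟩
  have hyS : ∀ z ∈ ({p, q, r, s} : Finset α), y z ∈ ({p, q, r, s} : Finset α) := by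
    intro z hz
    simp only [mem_insert, mem_singleton] at hz ⊢
    rcases hz with e | e | e | e <;> rw [e] <;> simp [y1, y2, y3, y4]
  have heS : ∀ z ∈ ({p, q, r, s} : Finset α), e z ∈ ({p, q, r, s} : Finset α) := by
    intro z hz
    simp only [mem_insert, mem_singleton] at hz ⊢
    rcases hz with h | h | h | h <;> rw [h] <;> simp [e1, e2, e3, e4]
  obtain ⟨g, hg, hgS, hga⟩ : ∃ g ∈ G, (∀ z ∈ ({a, b, c, d} : Finset α),
      g z ∈ ({p, q, r, s} : Finset α)) ∧ (g a = p ∨ g a = q) := by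
    have := hgS a (by simp)
    simp only [mem_insert, mem_singleton] at this
    rcases this with h | h | h | h
    · exact ⟨g, hg, hgS, Or.inl h⟩
    · exact ⟨g, hg, hgS, Or.inr h⟩
    · exact ⟨y * g, G.mul_mem hy hg, fun z hz => hyS _ (hgS z hz), Or.inl (by simp [h, y2])⟩
    · exact ⟨y * g, G.mul_mem hy hg, fun z hz => hyS _ (hgS z hz), Or.inr (by simp [h, y4])⟩
  obtain ⟨g, hg, hgS, hga⟩ : ∃ g ∈ G, (∀ z ∈ ({a, b, c, d} : Finset α),
      g z ∈ ({p, q, r, s} : Finset α)) ∧ g a = p := by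
    rcases hga with h | h
    · exact ⟨g, hg, hgS, h⟩
    · exact ⟨e * g, G.mul_mem he hg, fun z hz => heS _ (hgS z hz), by simp [h, e2]⟩
  have hne : ∀ {u v}, u ≠ v → g u ≠ g v := fun h => g.injective.ne h
  have hx := h.map hg
  rw [hga] at hx
  have hb := hgS b (by simp)
  have hc := hgS c (by simp)
  have hd := hgS d (by simp)
  have hndg : [p, g b, g c, g d].Nodup := by
    have := hnd₀.map g.injective
    simpa only [List.map_cons, List.map_nil, hga] using this
  have hnd' := hnd
  have hndg' := hndg
  simp only [List.nodup_cons, List.mem_cons, not_or, List.not_mem_nil, not_false_eq_true,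
    and_true, List.nodup_nil] at hnd' hndg'
  obtain ⟨⟨hpq, hpr, hps⟩, ⟨hqr, hqs⟩, hrs⟩ := hnd'
  obtain ⟨⟨hab, hac, had⟩, ⟨hbc, hbd⟩, hcd⟩ := hndg'
  simp only [mem_insert, mem_singleton] at hb hc hd
  have hgb : g b = q := by
    rcases hb with h | h | h | h
    · exact absurd h.symm hab
    · exact h
    · rw [h] at hx hbc hbd hndg
      exfalso
      have : Exchange G p r q s := by
        rcases hc with h' | h' | h' | h' <;> rcases hd with h'' | h'' | h'' | h'' <;>
          rw [h', h''] at hx hndg <;> first | exact hx | exact hx.symm_right | simp at hndg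
      exact hU hnd hp this
    · rw [h] at hx hbc hbd hndg
      exfalso
      have : Exchange G p s q r := by
        rcases hc with h' | h' | h' | h' <;> rcases hd with h'' | h'' | h'' | h'' <;>
          rw [h', h''] at hx hndg <;> first | exact hx | exact hx.symm_right | simp at hndg
      exact hU (show [p, q, s, r].Nodup by simp [hpq, hpr, hps, hqr, hqs, Ne.symm hrs])
        hp.symm_right this
  rw [hgb] at hab hbc hbd
  rcases hc with h | h | h | h
  · exact absurd h.symm hac
  · exact absurd h.symm hbc
  · refine ⟨g, hg, hga, hgb, h, ?_⟩
    rcases hd with h' | h' | h' | h'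
    · exact absurd h'.symm had
    · exact absurd h'.symm hbd
    · exact absurd (h.trans h'.symm) hcd
    · exact h'
  · refine ⟨e' * g, G.mul_mem he' hg, ?_, ?_, ?_, ?_⟩ <;> rw [Perm.mul_apply]
    · rw [hga, e3']
    · rw [hgb, e4']
    · rw [h, e2']
    · rcases hd with h' | h' | h' | h'
      · exact absurd h'.symm had
      · exact absurd h'.symm hbd
      · rw [h', e1']
      · exact absurd (h.trans h'.symm) hcd

open Classical in
/-- In degree 24, for any three points there are exactly seven further points exchanged with the
first of them while the other two are fixed. -/
theorem card_exchange_eq_seven {G : Subgroup (Perm α)} (hcard : Fintype.card α = 24)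
    (ht : IsMultTransitive G 3)
    (hE : ∀ {p q r s : α}, [p, q, r, s].Nodup →
      Exchange G p q r s ∨ Exchange G p r q s ∨ Exchange G p s q r)
    (hU : ∀ {p q r s : α}, [p, q, r, s].Nodup → Exchange G p q r s → ¬ Exchange G p r q s)
    {a d e : α} (hnd : [a, d, e].Nodup) :
    #(univ.filter fun b => b ≠ a ∧ Exchange G a b d e) = 7 := by
  let N : α → α → α → Finset α := fun a d e => univ.filter fun b => b ≠ a ∧ Exchange G a b d e
  have hle : ∀ {a d e a' d' e' : α}, [a, d, e].Nodup → [a', d', e'].Nodup →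
      #(N a d e) ≤ #(N a' d' e') := by
    intro a d e a' d' e' h h'
    obtain ⟨g, hg, hgl⟩ := ht.exists_map_eq [a, d, e] [a', d', e'] h h' rfl le_rfl
    simp only [List.map_cons, List.map_nil, List.cons.injEq, and_true] at hgl
    obtain ⟨g1, g2, g3⟩ := hgl
    refine card_le_card_of_injOn g ?_ g.injective.injOn
    intro b hb
    simp only [N, coe_filter, mem_univ, true_and, Set.mem_ofPred_eq] at hb ⊢
    refine ⟨by rw [← g1]; exact g.injective.ne hb.1, ?_⟩
    have := hb.2.map hg
    rwa [g1, g2, g3] at this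
  have hnd' := hnd
  simp only [List.nodup_cons, List.mem_cons, not_or, List.not_mem_nil, not_false_eq_true,
    and_true, List.nodup_nil] at hnd'
  obtain ⟨⟨had, hae⟩, hde⟩ := hnd'
  have h1 : #(N d a e) = #(N a d e) :=
    le_antisymm (hle (by simp [Ne.symm had, hde, hae]) hnd) (hle hnd (by simp [Ne.symm had, hde, hae]))
  have h2 : #(N e a d) = #(N a d e) :=
    le_antisymm (hle (by simp [Ne.symm hae, Ne.symm hde, had]) hnd)
      (hle hnd (by simp [Ne.symm hae, Ne.symm hde, had]))
  -- each of the other 21 points is exchanged with exactly one of the three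
  have hmem : ∀ {a d e b : α}, d ≠ a → e ≠ a → b ∈ N a d e →
      b ≠ a ∧ b ≠ d ∧ b ≠ e ∧ Exchange G a b d e := by
    intro a d e b had hae hb
    obtain ⟨hba, hx⟩ := (mem_filter.1 hb).2
    obtain ⟨g, hg, g1, g2, g3, g4⟩ := id hx
    exact ⟨hba, fun h => had (by rw [← g2, h, g3]), fun h => hae (by rw [← g2, h, g4]), hx⟩
  have hunion : N a d e ∪ (N d a e ∪ N e a d) = univ \ {a, d, e} := by
    ext b
    simp only [mem_union, mem_sdiff, mem_univ, true_and, mem_insert, mem_singleton, not_or]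
    constructor
    · rintro (h | h | h)
      · obtain ⟨h1, h2, h3, -⟩ := hmem (Ne.symm had) (Ne.symm hae) h
        exact ⟨h1, h2, h3⟩
      · obtain ⟨h1, h2, h3, -⟩ := hmem had (Ne.symm hde) h
        exact ⟨h2, h1, h3⟩
      · obtain ⟨h1, h2, h3, -⟩ := hmem hae hde h
        exact ⟨h2, h3, h1⟩
    · rintro ⟨h1, h2, h3⟩
      rcases hE (p := b) (q := a) (r := d) (s := e) (by simp [*]) with h | h | h
      · exact Or.inl (mem_filter.2 ⟨mem_univ _, h1, h.symm⟩)
      · exact Or.inr (Or.inl (mem_filter.2 ⟨mem_univ _, h2, h.symm⟩))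
      · exact Or.inr (Or.inr (mem_filter.2 ⟨mem_univ _, h3, h.symm⟩))
  have hd1 : Disjoint (N d a e) (N e a d) := by
    rw [disjoint_left]
    intro b hb hb'
    obtain ⟨h1, h2, h3, hx⟩ := hmem had (Ne.symm hde) hb
    obtain ⟨-, -, -, hx'⟩ := hmem hae hde hb'
    exact hU (show [b, d, e, a].Nodup by simp [h1, h2, h3, hde, Ne.symm had, Ne.symm hae])
      hx.symm.symm_right hx'.symm.symm_right
  have hd2 : Disjoint (N a d e) (N d a e ∪ N e a d) := by
    rw [disjoint_left]
    intro b hb hb'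
    obtain ⟨h1, h2, h3, hx⟩ := hmem (Ne.symm had) (Ne.symm hae) hb
    rcases mem_union.1 hb' with hb' | hb'
    · obtain ⟨-, -, -, hx'⟩ := hmem had (Ne.symm hde) hb'
      exact hU (show [b, a, d, e].Nodup by simp [h1, h2, h3, hde, had, hae]) hx.symm hx'.symm
    · obtain ⟨-, -, -, hx'⟩ := hmem hae hde hb'
      exact hU (show [b, a, e, d].Nodup by simp [h1, h2, h3, Ne.symm hde, had, hae])
        hx.symm.symm_right hx'.symm
  have hc : #(univ \ ({a, d, e} : Finset α)) = 21 := by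
    have := List.toFinset_card_of_nodup hnd
    simp only [List.toFinset_cons, List.toFinset_nil, insert_empty_eq, List.length_cons,
      List.length_nil] at this
    rw [card_sdiff_of_subset (subset_univ _), this, card_univ, hcard]
  rw [← hunion, card_union_of_disjoint hd2, card_union_of_disjoint hd1, h1, h2] at hc
  show #(N a d e) = 7
  omega

end

/-! ### Involutions with two fixed points -/

section

variable {α : Type*} [DecidableEq α] [Fintype α]

/-- Some 2-cycle `(w, y w)` is fixed by an element that exchanges the points of the 2-cycle
`(x, x')`. Otherwise each of the 20 points off `x, x', k, l` is exchanged with one of the two fixed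
points `k`, `l`, while `x` and `x'` are fixed; but there are only 14 such points. -/
theorem exists_exchange_orbit {G : Subgroup (Perm α)} (hcard : Fintype.card α = 24)
    (ht : IsMultTransitive G 3) (h4 : IsHomogeneous G 4)
    (hE : ∀ {p q r s : α}, [p, q, r, s].Nodup →
      Exchange G p q r s ∨ Exchange G p r q s ∨ Exchange G p s q r)
    (hU : ∀ {p q r s : α}, [p, q, r, s].Nodup → Exchange G p q r s → ¬ Exchange G p r q s)
    (hodd : NoInvolutionFixing G 3) {y : Perm α} (hy : y ∈ G) (hy2 : y * y = 1) {k l x x' : α}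
    (hnd : [x, x', k, l].Nodup) (hfix : ∀ z, y z = z ↔ z = k ∨ z = l) (hyx : y x = x') :
    ∃ w, w ∉ ({x, x', k, l} : Finset α) ∧ Exchange G x x' w (y w) := by
  classical
  by_contra! hno
  have hyy : ∀ z, y (y z) = z := fun z => by rw [← Perm.mul_apply, hy2, Perm.one_apply]
  have hyx' : y x' = x := by rw [← hyx, hyy]
  have hC : ∀ {p q r s : α}, [p, q, r, s].Nodup → Exchange G p q r s → Exchange G r s p q := by
    intro p q r s hnd h
    have hnd' := hnd
    simp only [List.nodup_cons, List.mem_cons, not_or, List.not_mem_nil, not_false_eq_true,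
      and_true, List.nodup_nil] at hnd'
    obtain ⟨⟨hpq, hpr, hps⟩, ⟨hqr, hqs⟩, hrs⟩ := hnd'
    rcases hE (p := r) (q := s) (r := p) (s := q) (by
      simp [hpq, hrs, Ne.symm hpr, Ne.symm hps, Ne.symm hqr, Ne.symm hqs]) with h' | h' | h'
    · exact h'
    · exact absurd h'.symm.symm_right (hU hnd h)
    · exact absurd h'.symm.symm_right
        (hU (p := q) (q := p) (r := r) (s := s) (by simp [*, Ne.symm hpq]) h.symm)
  -- every 2-cycle of `y` off the 4-set has a point exchanged with `x`
  have hpart : ∀ w, w ∉ ({x, x', k, l} : Finset α) → ∃ u, (u = w ∨ u = y w) ∧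
      [x, u, x', y u].Nodup ∧ Exchange G x u x' (y u) := by
    intro w hw
    have hx1 := hno w hw
    simp only [mem_insert, mem_singleton, not_or] at hw
    obtain ⟨w1, w2, w3, w4⟩ := hw
    have w5 : y w ≠ w := fun h => by rcases (hfix w).1 h with h | h <;> contradiction
    have w6 : y w ≠ x := fun h => w2 (by rw [← hyx, ← h, hyy])
    have w7 : y w ≠ x' := fun h => w1 (by rw [← hyx', ← h, hyy])
    have hxx' : x ≠ x' := by
      simp only [List.nodup_cons, List.mem_cons, not_or] at hnd
      exact hnd.1.1
    rcases hE (p := x) (q := x') (r := w) (s := y w) (by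
      simp [hxx', Ne.symm w1, Ne.symm w2, Ne.symm w5, Ne.symm w6, Ne.symm w7]) with h | h | h
    · exact absurd h hx1
    · exact ⟨w, Or.inl rfl, by simp [hxx', Ne.symm w1, w2, Ne.symm w5, Ne.symm w6, Ne.symm w7], h⟩
    · refine ⟨y w, Or.inr rfl, ?_, by rwa [hyy]⟩
      rw [hyy]
      simp [hxx', Ne.symm w1, Ne.symm w2, w5, Ne.symm w6, w7]
  have hnd' := hnd
  simp only [List.nodup_cons, List.mem_cons, not_or, List.not_mem_nil, not_false_eq_true,
    and_true, List.nodup_nil] at hnd'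
  obtain ⟨⟨hxx', hxk, hxl⟩, ⟨hxk', hxl'⟩, hkl⟩ := hnd'
  have hseven : ∀ i, i = k ∨ i = l →
      #(univ.filter fun b => b ≠ i ∧ Exchange G i b x x') = 7 := by
    rintro i (h | h) <;> rw [h]
    · exact card_exchange_eq_seven hcard ht hE hU
        (by simp [Ne.symm hxk, Ne.symm hxk', hxx'])
    · exact card_exchange_eq_seven hcard ht hE hU
        (by simp [Ne.symm hxl, Ne.symm hxl', hxx'])
  obtain ⟨w₀, hw₀, hw₀x⟩ : ∃ w₀, w₀ ∉ ({x, x', k, l} : Finset α) ∧ Exchange G k w₀ x x' := by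
    obtain ⟨w₀, hw, hwl⟩ := exists_mem_ne (show 1 <
      #(univ.filter fun b => b ≠ k ∧ Exchange G k b x x') by rw [hseven k (Or.inl rfl)]; norm_num) l
    obtain ⟨hwk, hx⟩ := (mem_filter.1 hw).2
    obtain ⟨g, -, g1, g2, g3, g4⟩ := id hx
    refine ⟨w₀, ?_, hx⟩
    simp only [mem_insert, mem_singleton, not_or]
    exact ⟨fun h => hxk (by rw [← g2, h, g3]), fun h => hxk' (by rw [← g2, h, g4]), hwk, hwl⟩
  obtain ⟨u, hu, hund, hux⟩ := hpart w₀ hw₀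
  have hall : ∀ w, w ∉ ({x, x', k, l} : Finset α) →
      Exchange G k w x x' ∨ Exchange G l w x x' := by
    intro w hw
    obtain ⟨v, hv, hvnd, hvx⟩ := hpart w hw
    obtain ⟨f, hf, f1, f2, f3, f4⟩ := h4.exists_map_of_exchange hU hund hux hvnd hvx (hC hvnd hvx)
      hy hyx hyx' rfl (hyy v)
    obtain ⟨h, hh, hS, hcomm⟩ := hodd.lift hy hy2 hy hy2 hf {x, u, x', y u}
      (by rw [card_eq_four_of_nodup hund]; norm_num) (by
        intro z hz
        simp only [mem_insert, mem_singleton] at hz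
        rcases hz with e | e | e | e <;> rw [e]
        · rw [hyx, f3, f1, hyx]
        · rw [f4, f2]
        · rw [hyx', f1, f3, hyx']
        · rw [hyy, f2, f4, hyy])
    have hk : h k = k ∨ h k = l := by
      rw [← hfix, ← hcomm, (hfix k).2 (Or.inl rfl)]
    have h1 : Exchange G (h k) (h w₀) x x' := by
      have := hw₀x.map hh
      rwa [hS x (by simp), f1, hS x' (by simp), f3] at this
    have h2 : h u = v := by rw [hS u (by simp), f2]
    have h3 : h w₀ = w ∨ h w₀ = y w := by
      have h4 : h w₀ = v ∨ h w₀ = y v := by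
        rcases hu with e | e
        · left; rw [← e, h2]
        · right; rw [← h2, ← hcomm, e, hyy]
      rcases hv with e | e
      · rwa [e] at h4
      · rw [e, hyy] at h4
        exact h4.symm
    have h4 : Exchange G (h k) w x x' := by
      rcases h3 with e | e
      · rwa [e] at h1
      · have h5 := h1.map hy
        rw [e, hyy, hyx, hyx', ← hcomm, (hfix k).2 (Or.inl rfl)] at h5
        exact h5.symm_right
    rcases hk with e | e <;> rw [e] at h4
    · exact Or.inl h4
    · exact Or.inr h4
  have hsub : univ \ ({x, x', k, l} : Finset α) ⊆
      (univ.filter fun b => b ≠ k ∧ Exchange G k b x x') ∪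
        (univ.filter fun b => b ≠ l ∧ Exchange G l b x x') := by
    intro w hw
    have hw' := (mem_sdiff.1 hw).2
    have hw'' := hw'
    simp only [mem_insert, mem_singleton, not_or] at hw''
    rw [mem_union, mem_filter, mem_filter]
    rcases hall w hw' with h | h
    · exact Or.inl ⟨mem_univ _, hw''.2.2.1, h⟩
    · exact Or.inr ⟨mem_univ _, hw''.2.2.2, h⟩
  have h1 := (card_le_card hsub).trans (card_union_le _ _)
  rw [card_sdiff_of_subset (subset_univ _), card_eq_four_of_nodup hnd, card_univ, hcard,
    hseven k (Or.inl rfl), hseven l (Or.inr rfl)] at h1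
  omega

/-- If an involution fixes exactly two points, the degree is 24, and one finds commuting
involutions `y`, `b` such that `y`, `b` and `y * b` fix disjoint pairs of points; they act freely on
the remaining 18 points, but 4 does not divide 18. -/
theorem isMultTransitive_four_of_card_fixed_eq_two {G : Subgroup (Perm α)}
    (hn : 10 ≤ Fintype.card α) (ht : IsMultTransitive G 3) (h4 : IsHomogeneous G 4)
    (h5 : IsHomogeneous G 5) (hodd : NoInvolutionFixing G 3) {y : Perm α} (hy : y ∈ G)
    (hy2 : y * y = 1) {k l x x' : α} (hnd : [x, x', k, l].Nodup)
    (hfix : ∀ z, y z = z ↔ z = k ∨ z = l) (hyx : y x = x') : IsMultTransitive G 4 := by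
  by_contra hnt
  have hyy : ∀ z, y (y z) = z := fun z => by rw [← Perm.mul_apply, hy2, Perm.one_apply]
  have hyx' : y x' = x := by rw [← hyx, hyy]
  have hyk : y k = k := (hfix k).2 (Or.inl rfl)
  have hyl : y l = l := (hfix l).2 (Or.inr rfl)
  have hnd' := hnd
  simp only [List.nodup_cons, List.mem_cons, not_or, List.not_mem_nil, not_false_eq_true,
    and_true, List.nodup_nil] at hnd'
  obtain ⟨⟨hxx', hxk, hxl⟩, ⟨hxk', hxl'⟩, hkl⟩ := hnd'
  have hX : Exchange G x x' k l := ⟨y, hy, hyx, hyx', hyk, hyl⟩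
  have hX' : Exchange G k l x x' := by
    obtain ⟨g, hg, hgl⟩ := ht.exists_map_eq [x, x', k] [x, x', l] (by simp [*]) (by simp [*])
      rfl le_rfl
    simp only [List.map_cons, List.map_nil, List.cons.injEq, and_true] at hgl
    obtain ⟨g1, g2, g3⟩ := hgl
    obtain ⟨f, hf, hfS, hcomm⟩ := hodd.lift hy hy2 hy hy2 hg {x, x', k}
      (by rw [card_insert_of_notMem (by simp [*]), card_pair hxk']) (by
        intro z hz
        simp only [mem_insert, mem_singleton] at hz
        rcases hz with e | e | e <;> rw [e]
        · rw [hyx, g2, g1, hyx]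
        · rw [hyx', g1, g2, hyx']
        · rw [hyk, g3, hyl])
    have f3 : f k = l := by rw [hfS k (by simp), g3]
    have f4 : f l = k := by
      have h1 : f l = k ∨ f l = l := by rw [← hfix, ← hcomm, hyl]
      rcases h1 with h1 | h1
      · exact h1
      · exact absurd (f.injective (f3.trans h1.symm)) hkl
    exact ⟨f, hf, f3, f4, by rw [hfS x (by simp), g1], by rw [hfS x' (by simp), g2]⟩
  have hcard : Fintype.card α = 24 := by
    have hdvd : 4 ∣ Nat.card (induced G {x, x', k, l}) := by
      have h1 := hX.swappable hnd
      have h2 : Swappable G {x, x', k, l} k l := by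
        have := hX'.swappable (p := k) (q := l) (r := x) (s := x')
          (by simp [hkl, hxx', Ne.symm hxk, Ne.symm hxl, Ne.symm hxk', Ne.symm hxl'])
        rwa [show ({k, l, x, x'} : Finset α) = {x, x', k, l} by ext z; simp; tauto] at this
      rw [swappable_iff_swap_mem_induced (by simp) (by simp)] at h1 h2
      have e : ∀ {X : Type _} [DecidableEq X] {a b c d : X}, a ≠ b → a ≠ c → a ≠ d → b ≠ c →
          b ≠ d → c ≠ d → swap a b ≠ 1 ∧ swap a b * swap c d = swap c d * swap a b ∧
            swap a b ≠ swap c d := by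
        intro X _ a b c d hab hac had hbc hbd hcd
        refine ⟨fun h => hab (swap_eq_refl_iff.1 h), ?_, fun h => ?_⟩
        · exact (Perm.disjoint_swap_swap (by simp [*])).commute
        · have := congrArg (fun f : Perm X => f a) h
          simp only [swap_apply_left, swap_apply_of_ne_of_ne hac had] at this
          exact hab this.symm
      obtain ⟨e1, e2, e3⟩ := e (a := (⟨x, by simp⟩ : ({x, x', k, l} : Finset α)))
        (b := ⟨x', by simp⟩) (c := ⟨k, by simp⟩) (d := ⟨l, by simp⟩) (by simpa using hxx')
        (by simpa using hxk) (by simpa using hxl) (by simpa using hxk') (by simpa using hxl')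
        (by simpa using hkl)
      refine four_dvd_card (a := (⟨_, h1⟩ : induced G {x, x', k, l})) (b := ⟨_, h2⟩)
        (Subtype.ext (swap_mul_self _ _)) (Subtype.ext (swap_mul_self _ _)) (Subtype.ext e2)
        (fun h => e1 (congrArg Subtype.val h))
        (fun h => hkl ?_) (fun h => e3 (congrArg Subtype.val h))
      have := swap_eq_refl_iff.1 (congrArg Subtype.val h)
      exact congrArg Subtype.val this
    exact (index_eq_three_of_dvd_six hn ht h4 h5 _ (card_eq_four_of_nodup hnd)
      (index_dvd_six (card_eq_four_of_nodup hnd) hdvd) fun h =>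
        hnt (h4.isMultTransitive_of_index (by omega) _ (card_eq_four_of_nodup hnd) h)).2
  have hE : ∀ {p q r s : α}, [p, q, r, s].Nodup →
      Exchange G p q r s ∨ Exchange G p r q s ∨ Exchange G p s q r :=
    fun h => h4.exchange hnd hX hX' h
  have hU : ∀ {p q r s : α}, [p, q, r, s].Nodup → Exchange G p q r s → ¬ Exchange G p r q s :=
    fun h h1 h2 => hnt (h4.isMultTransitive_of_exchange (by omega) hE h h1 h2)
  obtain ⟨w, hw, g, hg, g1, g2, g3, g4⟩ :=
    exists_exchange_orbit hcard ht h4 hE hU hodd hy hy2 hnd hfix hyx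
  simp only [mem_insert, mem_singleton, not_or] at hw
  obtain ⟨w1, w2, w3, w4⟩ := hw
  have w5 : y w ≠ w := fun h => by rcases (hfix w).1 h with h | h <;> contradiction
  have w6 : y w ≠ x := fun h => w2 (by rw [← hyx, ← h, hyy])
  have w7 : y w ≠ x' := fun h => w1 (by rw [← hyx', ← h, hyy])
  have w8 : y w ≠ k := fun h => w3 (by rw [← hyk, ← h, hyy])
  have w9 : y w ≠ l := fun h => w4 (by rw [← hyl, ← h, hyy])
  obtain ⟨a, ha, ha2, hag⟩ := hodd.exists_involution hg {x, x', w}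
    (by rw [card_insert_of_notMem (by simp [hxx', Ne.symm w1]), card_pair (Ne.symm w2)]) (by
      intro z hz
      simp only [mem_insert, mem_singleton] at hz
      rcases hz with e | e | e <;> rw [e]
      · rw [g1, g2]
      · rw [g2, g1]
      · rw [g3, g3])
  have a1 : a x = x' := by rw [hag x (by rw [g1, g2]), g1]
  have a2 : a x' = x := by rw [hag x' (by rw [g2, g1]), g2]
  have a3 : a w = w := by rw [hag w (by rw [g3, g3]), g3]
  have a4 : a (y w) = y w := by rw [hag (y w) (by rw [g4, g4]), g4]
  have hya1 : y (a (y (a x))) = x := by rw [a1, hyx', a1, hyx']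
  have hya2 : y (a (y (a x'))) = x' := by rw [a2, hyx, a2, hyx]
  have hya3 : y (a (y (a w))) = w := by rw [a3, a4, hyy]
  have hya4 : y (a (y (a (y w)))) = y w := by rw [a4, hyy, a3]
  obtain ⟨b, hb, hb2, hyb, hbya⟩ := hodd.exists_commuting_involution hy ha hy2 ha2 {x, x', w}
    (by rw [card_insert_of_notMem (by simp [hxx', Ne.symm w1]), card_pair (Ne.symm w2)]) (by
      intro z hz
      simp only [mem_insert, mem_singleton] at hz
      rcases hz with e | e | e <;> rw [e] <;> assumption)
  have b1 : b x = x := by rw [hbya x hya1, a1, hyx']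
  have b2 : b x' = x' := by rw [hbya x' hya2, a2, hyx]
  have b3 : b w = y w := by rw [hbya w hya3, a3]
  have b4 : b (y w) = w := by rw [hbya (y w) hya4, a4, hyy]
  have hbb : ∀ z, b (b z) = z := fun z => by rw [← Perm.mul_apply, hb2, Perm.one_apply]
  -- an involution of `G` other than the identity fixes at most two points
  have htwo : ∀ {c : Perm α} {p q r z : α}, c ∈ G → c * c = 1 → p ≠ q → c p = p → c q = q →
      c r ≠ r → c z = z → z = p ∨ z = q := by
    intro c p q r z hc hc2 hpq h1 h2 h3 h4
    by_contra! hz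
    have := hodd c hc hc2 {z, p, q}
      (by rw [card_insert_of_notMem (by simp [hz]), card_pair hpq]) (by
        intro u hu
        simp only [mem_insert, mem_singleton] at hu
        rcases hu with e | e | e <;> rw [e] <;> assumption)
    rw [this] at h3
    exact h3 rfl
  have hbfix : ∀ z, b z = z → z = x ∨ z = x' := fun z hz =>
    htwo hb hb2 hxx' b1 b2 (by rw [b3]; exact w5) hz
  have hybfix : ∀ z, b z = y z → z = w ∨ z = y w := by
    intro z hz
    refine htwo (c := y * b) (r := x) (G.mul_mem hy hb) ?_ (Ne.symm w5) ?_ ?_ ?_ ?_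
    · ext u
      rw [Perm.mul_apply, Perm.mul_apply, Perm.mul_apply, hyb, hyy, hbb, Perm.one_apply]
    · rw [Perm.mul_apply, b3, hyy]
    · rw [Perm.mul_apply, b4]
    · rw [Perm.mul_apply, b1, hyx]; exact Ne.symm hxx'
    · rw [Perm.mul_apply, hz, hyy]
  have hbkl : ∀ z, z = k ∨ z = l → b z = k ∨ b z = l := by
    intro z hz
    rw [← hfix] at hz ⊢
    rw [hyb, hz]
  have hnd6 : [x, x', w, y w, k, l].Nodup := by
    simp [hxx', hxk, hxl, hxk', hxl', hkl, Ne.symm w1, Ne.symm w2, w3, w4, Ne.symm w5, Ne.symm w6,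
      Ne.symm w7, w8, w9]
  have hc6 : #({x, x', w, y w, k, l} : Finset α) = 6 := by
    have := List.toFinset_card_of_nodup hnd6
    simp only [List.toFinset_cons, List.toFinset_nil, insert_empty_eq] at this
    exact this
  have hstab : ∀ {c : Perm α}, (∀ z, c (c z) = z) →
      (∀ z ∈ ({x, x', w, y w, k, l} : Finset α), c z ∈ ({x, x', w, y w, k, l} : Finset α)) →
      ∀ z ∈ univ \ ({x, x', w, y w, k, l} : Finset α),
        c z ∈ univ \ ({x, x', w, y w, k, l} : Finset α) := by
    intro c hcc h z hz
    rw [mem_sdiff] at hz ⊢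
    refine ⟨mem_univ _, fun h' => hz.2 ?_⟩
    have := h _ h'
    rwa [hcc] at this
  have hdvd := four_dvd_card_of_fixedPointFree (univ \ ({x, x', w, y w, k, l} : Finset α)) hy2 hb2
    hyb (hstab hyy (by
      intro z hz
      simp only [mem_insert, mem_singleton] at hz ⊢
      rcases hz with e | e | e | e | e | e <;> rw [e] <;> simp [hyx, hyx', hyy, hyk, hyl]))
    (hstab hbb (by
      intro z hz
      simp only [mem_insert, mem_singleton] at hz ⊢
      rcases hz with e | e | e | e | e | e <;> rw [e]
      · simp [b1]
      · simp [b2]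
      · simp [b3]
      · simp [b4]
      · rcases hbkl k (Or.inl rfl) with h | h <;> simp [h]
      · rcases hbkl l (Or.inr rfl) with h | h <;> simp [h]))
    (by
      intro z hz h
      refine (mem_sdiff.1 hz).2 ?_
      rcases (hfix z).1 h with h | h <;> simp [h])
    (by
      intro z hz h
      refine (mem_sdiff.1 hz).2 ?_
      rcases hbfix z h with h | h <;> simp [h])
    (by
      intro z hz h
      refine (mem_sdiff.1 hz).2 ?_
      rcases hybfix z h with h | h <;> simp [h])
  rw [card_sdiff_of_subset (subset_univ _), hc6, card_univ, hcard] at hdvd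
  omega

theorem isMultTransitive_one {G : Subgroup (Perm α)} (hn : 1 ≤ Fintype.card α)
    (h1 : IsHomogeneous G 1) : IsMultTransitive G 1 := by
  refine h1.isMultTransitive_of_swappable hn fun S hS a ha b hb hab => ?_
  exact absurd (card_le_one.1 hS.le a ha b hb) hab

/-- A group of degree at least 10 that is `i`-homogeneous for all `i ≤ 5` is 4-transitive. -/
theorem isMultTransitive_four {G : Subgroup (Perm α)} (hn : 10 ≤ Fintype.card α)
    (hh : ∀ i ≤ 5, IsHomogeneous G i) : IsMultTransitive G 4 := by
  have ht := isMultTransitive_three hn (isMultTransitive_two hn (isMultTransitive_one (by omega)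
    (hh 1 (by norm_num))) (hh 2 (by norm_num)) (hh 3 (by norm_num))) (hh 3 (by norm_num))
    (hh 4 (by norm_num))
  have h4 := hh 4 (by norm_num)
  have h5 := hh 5 le_rfl
  by_contra hnt
  obtain ⟨Q, hQ5⟩ := exists_isMaxTwoSubgroup G (i := 5) (by omega)
  have hQ4 : IsMaxTwoSubgroup G Q 4 :=
    (isMultTransitive_or_isMaxTwoSubgroup hQ5 h4 h5).resolve_left fun h => hnt (h.mono (by norm_num))
  have hQ3 : IsMaxTwoSubgroup G Q 3 :=
    (isMultTransitive_or_isMaxTwoSubgroup hQ4 (hh 3 (by norm_num)) h4).resolve_left hnt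
  have hodd := hQ5.noInvolutionFixing_three hn hQ3 ht h4 h5 hnt
  obtain ⟨S, -, hS⟩ := exists_superset_card (∅ : Finset α) (k := 3) (by simp) (by omega)
  obtain ⟨x, x', l, hxx', hxl, hxl', rfl⟩ := card_eq_three.1 hS
  obtain ⟨g, hg, hgl⟩ := ht.exists_map_eq [x, x', l] [x', x, l] (by simp [*])
    (by simp [*, Ne.symm hxx']) rfl le_rfl
  simp only [List.map_cons, List.map_nil, List.cons.injEq, and_true] at hgl
  obtain ⟨g1, g2, g3⟩ := hgl
  obtain ⟨y, hy, hy2, hyg⟩ := hodd.exists_involution hg {x, x', l} hS.ge (by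
    intro z hz
    simp only [mem_insert, mem_singleton] at hz
    rcases hz with e | e | e <;> rw [e]
    · rw [g1, g2]
    · rw [g2, g1]
    · rw [g3, g3])
  have hyx : y x = x' := by rw [hyg x (by rw [g1, g2]), g1]
  have hyl : y l = l := by rw [hyg l (by rw [g3, g3]), g3]
  have hyx' : y x' = x := by rw [hyg x' (by rw [g2, g1]), g2]
  by_cases hk : ∃ k, k ≠ l ∧ y k = k
  · obtain ⟨k, hkl, hyk⟩ := hk
    refine hnt (isMultTransitive_four_of_card_fixed_eq_two hn ht h4 h5 hodd hy hy2
      (x := x) (x' := x') (k := k) (l := l) ?_ (fun z => ⟨fun hz => ?_, ?_⟩) hyx)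
    · have h1 : x ≠ k := fun h => hxx' (by rw [← hyx, h, hyk])
      have h2 : x' ≠ k := fun h => hxx' (by rw [← hyx', h, hyk])
      simp [*]
    · by_contra! hz'
      have := hodd y hy hy2 {z, k, l}
        (by rw [card_insert_of_notMem (by simp [hz']), card_pair hkl]) (by
          intro u hu
          simp only [mem_insert, mem_singleton] at hu
          rcases hu with e | e | e <;> rw [e] <;> assumption)
      rw [this] at hyx
      exact hxx' hyx
    · rintro (h | h) <;> rw [h] <;> assumption
  · push Not at hk
    exact hnt (isMultTransitive_four_of_card_fixed_eq_one hn ht h4 h5 hodd hy hy2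
      (fun z => ⟨fun hz => by_contra fun h => hk z h hz, fun h => by rw [h, hyl]⟩) hyx hxx')

end

/-! ### The Livingstone-Wagner theorem -/

section

variable {α : Type*} [DecidableEq α] [Fintype α]

/-- **Livingstone-Wagner.** A group of degree at least `2 * k`, `5 ≤ k`, that is `i`-homogeneous for
all `i ≤ k`, is `k`-transitive. The case `k = 4`, which needs 5-homogeneity and degree at least 10,
is included as the base of the induction. -/
theorem isMultTransitive_of_isHomogeneous {G : Subgroup (Perm α)} {k : ℕ} (hk : 4 ≤ k)
    (hn : 2 * k ≤ Fintype.card α) (hn' : 10 ≤ Fintype.card α)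
    (hh : ∀ i ≤ max k 5, IsHomogeneous G i) : IsMultTransitive G k := by
  induction k, hk using Nat.le_induction with
  | base => exact isMultTransitive_four hn' hh
  | succ k hk ih =>
    have ht : IsMultTransitive G k :=
      ih (by omega) fun i hi => hh i (hi.trans (max_le_max (Nat.le_succ k) le_rfl))
    obtain ⟨K, rfl⟩ : ∃ K, k = K + 2 := ⟨k - 2, by omega⟩
    have hh2 : IsHomogeneous G (K + 2) := hh _ (by omega)
    have hh3 : IsHomogeneous G (K + 3) := hh _ (by omega)
    obtain ⟨Q, hQ⟩ := exists_isMaxTwoSubgroup G (i := K + 3) (by omega)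
    rcases isMultTransitive_or_isMaxTwoSubgroup hQ hh2 hh3 with h | hQ'
    · exact h
    have hcard : Fintype.card (fixedFinset Q) = #(fixedFinset Q) := Fintype.card_coe _
    have hle := hQ.le_card
    obtain ⟨S₀, -, hS₀⟩ := exists_superset_card (∅ : Finset (fixedFinset Q)) (k := K + 3)
      (by simp) (by omega)
    have hidx : (induced (reduced G Q) S₀).index ≤ 2 :=
      index_induced_le_two_of_noInvolutionFixing (by omega) (by omega) hQ'.noInvolutionFixing
        (hQ'.isMultTransitive le_rfl hQ'.le_card ht) (hQ'.isHomogeneous (by omega) hh3) S₀ hS₀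
    rw [hQ'.index_induced S₀ (by omega)] at hidx
    refine isMultTransitive_of_index_le_two (by omega) (by omega) ht hh3 fun S hS => ?_
    rwa [hh3.index_induced_eq (by omega) hS (T := S₀.map (Function.Embedding.subtype _))
      (by rw [card_map, hS₀])]

end

/-! ### Orbit counts relative to a small invariant set -/

section

variable {α : Type*} [DecidableEq α] [Fintype α]

theorem cls_image {H : Subgroup (Perm α)} {h : Perm α} (hh : h ∈ H) (S : Finset α) :
    cls H (S.image h) = cls H S := ((cls_eq_iff H _ _).2 ⟨h, hh, rfl⟩).symm

/-- An `H`-invariant function takes at most as many values as there are orbits. -/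
theorem ncard_image_le_orbs {X : Type*} {H : Subgroup (Perm α)} (F : Set (Finset α))
    (φ : Finset α → X) (hφ : ∀ h ∈ H, ∀ S, φ (S.image h) = φ S) : (φ '' F).ncard ≤ orbs H F := by
  have hf : Function.FactorsThrough φ (cls H) := by
    intro S T hST
    obtain ⟨h, hh, rfl⟩ := (cls_eq_iff H S T).1 hST
    exact (hφ h hh S).symm
  have : φ '' F = Function.extend (cls H) φ (fun _ => φ ∅) '' (cls H '' F) := by
    rw [Set.image_image]
    exact Set.image_congr fun S _ => (hf.extend_apply _ S).symm
  rw [this]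
  exact Set.ncard_image_le (Set.toFinite _)

theorem cls_eq_of_orbs_le_one {H : Subgroup (Perm α)} {F : Set (Finset α)} (h : orbs H F ≤ 1)
    {S T : Finset α} (hS : S ∈ F) (hT : T ∈ F) : cls H S = cls H T :=
  (Set.ncard_le_one (Set.toFinite _)).1 h _ (Set.mem_image_of_mem _ hS) _
    (Set.mem_image_of_mem _ hT)

theorem image_inter_of_invariant {B : Finset α} {h : Perm α} (hB : ∀ b, h b ∈ B ↔ b ∈ B)
    (S : Finset α) : S.image h ∩ B = (S ∩ B).image h := by
  ext x
  simp only [mem_inter, mem_image]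
  constructor
  · rintro ⟨⟨z, hz, rfl⟩, hx⟩
    exact ⟨z, ⟨hz, (hB z).1 hx⟩, rfl⟩
  · rintro ⟨z, ⟨hz, hz'⟩, rfl⟩
    exact ⟨⟨z, hz, rfl⟩, (hB z).2 hz'⟩

theorem image_sdiff_of_invariant {B : Finset α} {h : Perm α} (hB : ∀ b, h b ∈ B ↔ b ∈ B)
    (S : Finset α) : S.image h \ B = (S \ B).image h := by
  ext x
  simp only [mem_sdiff, mem_image]
  constructor
  · rintro ⟨⟨z, hz, rfl⟩, hx⟩
    exact ⟨z, ⟨hz, fun h' => hx ((hB z).2 h')⟩, rfl⟩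
  · rintro ⟨z, ⟨hz, hz'⟩, rfl⟩
    exact ⟨⟨z, hz, rfl⟩, fun h' => hz' ((hB z).1 h')⟩

theorem mem_layer_zero {B S : Finset α} {k : ℕ} :
    S ∈ layer B 0 k ↔ Disjoint S B ∧ #S = k := by
  have h1 : S ∈ layer B 0 k ↔ #(S ∩ B) = 0 ∧ #(S \ B) = k := Iff.rfl
  rw [h1, card_eq_zero, ← disjoint_iff_inter_eq_empty]
  constructor
  · rintro ⟨h, h'⟩
    rw [sdiff_eq_self_of_disjoint h] at h'
    exact ⟨h, h'⟩
  · rintro ⟨h, h'⟩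
    rw [sdiff_eq_self_of_disjoint h]
    exact ⟨h, h'⟩

theorem union_mem_layer {B T R : Finset α} (hT : T ⊆ B) (hR : Disjoint R B) :
    T ∪ R ∈ layer B #T #R ∧ (T ∪ R) ∩ B = T ∧ (T ∪ R) \ B = R := by
  have h1 : (T ∪ R) ∩ B = T := by
    rw [union_inter_distrib_right, disjoint_iff_inter_eq_empty.1 hR, union_empty,
      inter_eq_left.2 hT]
  have h2 : (T ∪ R) \ B = R := by
    rw [union_sdiff_distrib, sdiff_eq_empty_iff_subset.2 hT, empty_union,
      sdiff_eq_self_of_disjoint hR]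
  exact ⟨⟨by rw [h1], by rw [h2]⟩, h1, h2⟩

theorem orbs_union {H : Subgroup (Perm α)} {F F' : Set (Finset α)}
    (h : ∀ S ∈ F, ∀ T ∈ F', cls H S ≠ cls H T) : orbs H (F ∪ F') = orbs H F + orbs H F' := by
  unfold orbs
  rw [Set.image_union, Set.ncard_union_eq _ (Set.toFinite _) (Set.toFinite _)]
  rw [Set.disjoint_left]
  rintro _ ⟨S, hS, rfl⟩ ⟨T, hT, e⟩
  exact h S hS T hT e.symm

theorem cls_ne_of_mem_layer {H : Subgroup (Perm α)} {B : Finset α}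
    (hB : ∀ h ∈ H, ∀ b, h b ∈ B ↔ b ∈ B) {i j k l : ℕ} (hij : i ≠ j) {S T : Finset α}
    (hS : S ∈ layer B i k) (hT : T ∈ layer B j l) : cls H S ≠ cls H T := by
  intro hST
  obtain ⟨h, hh, rfl⟩ := (cls_eq_iff H S T).1 hST
  have := hT.1
  rw [image_inter_of_invariant (hB h hh), card_image_of_injective _ h.injective, hS.1] at this
  exact hij this

theorem numOrbits_of_card_eq_one {H : Subgroup (Perm α)} {B : Finset α}
    (hB : ∀ h ∈ H, ∀ b, h b ∈ B ↔ b ∈ B) (hc : #B = 1) (k : ℕ) :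
    OrbitCorollary.numOrbits H (k + 1) = orbs H (layer B 0 (k + 1)) + orbs H (layer B 1 k) := by
  rw [numOrbits_eq_orbs, ← orbs_union fun S hS T hT =>
    cls_ne_of_mem_layer hB (by norm_num) hS hT]
  congr 1
  ext S
  have h1 := card_inter_add_card_sdiff S B
  have h2 : #(S ∩ B) ≤ 1 := hc ▸ card_le_card inter_subset_right
  simp only [layer, Set.mem_union, Set.mem_ofPred_eq]
  omega

theorem numOrbits_of_card_eq_two {H : Subgroup (Perm α)} {B : Finset α}
    (hB : ∀ h ∈ H, ∀ b, h b ∈ B ↔ b ∈ B) (hc : #B = 2) (k : ℕ) :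
    OrbitCorollary.numOrbits H (k + 2) = orbs H (layer B 0 (k + 2)) +
      orbs H (layer B 1 (k + 1)) + orbs H (layer B 2 k) := by
  rw [numOrbits_eq_orbs, ← orbs_union fun S hS T hT =>
    cls_ne_of_mem_layer hB (by norm_num) hS hT, ← orbs_union (by
      rintro S (hS | hS) T hT
      · exact cls_ne_of_mem_layer hB (by norm_num) hS hT
      · exact cls_ne_of_mem_layer hB (by norm_num) hS hT)]
  congr 1
  ext S
  have h1 := card_inter_add_card_sdiff S B
  have h2 : #(S ∩ B) ≤ 2 := hc ▸ card_le_card inter_subset_right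
  simp only [layer, Set.mem_union, Set.mem_ofPred_eq]
  omega

/-- Adjoining the invariant set `B` does not change the number of orbits. -/
theorem orbs_layer_card {H : Subgroup (Perm α)} {B : Finset α}
    (hB : ∀ h ∈ H, ∀ b, h b ∈ B ↔ b ∈ B) (k : ℕ) :
    orbs H (layer B #B k) = orbs H (layer B 0 k) := by
  have hBi : ∀ h ∈ H, B.image h = B := fun h hh => by
    have := image_inter_of_invariant (hB h hh) B
    rw [inter_self] at this
    rw [← this]
    exact eq_of_subset_of_card_le (by rw [this]; intro x hx; obtain ⟨z, hz, rfl⟩ := mem_image.1 hx;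
                                      exact (hB h hh z).2 hz)
      (by rw [this, card_image_of_injective _ h.injective])
  apply le_antisymm
  · refine le_trans (Set.ncard_le_ncard ?_ (Set.toFinite _))
      (ncard_image_le_orbs (layer B 0 k) (fun S => cls H (S ∪ B)) fun h hh S => ?_)
    · rintro _ ⟨S, hS, rfl⟩
      have hBS : B ⊆ S := by
        rw [← inter_eq_right]
        exact eq_of_subset_of_card_le inter_subset_right hS.1.ge
      refine ⟨S \ B, mem_layer_zero.2 ⟨sdiff_disjoint, hS.2⟩, ?_⟩
      simp only [sdiff_union_of_subset hBS]
    · have : S.image h ∪ B = (S ∪ B).image h := by rw [image_union, hBi h hh]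
      simp only [this, cls_image hh]
  · refine le_trans (Set.ncard_le_ncard ?_ (Set.toFinite _))
      (ncard_image_le_orbs (layer B #B k) (fun S => cls H (S \ B)) fun h hh S => ?_)
    · rintro _ ⟨S, hS, rfl⟩
      obtain ⟨h1, h2⟩ := mem_layer_zero.1 hS
      obtain ⟨h3, -, h4⟩ := union_mem_layer (subset_refl B) h1
      rw [h2] at h3
      exact ⟨B ∪ S, h3, by simp only [h4]⟩
    · simp only [image_sdiff_of_invariant (hB h hh), cls_image hh]

/-- Without fixed points, each orbit of points gives an orbit of pairs inside it, and two distinct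
orbits of points give a further orbit of pairs. -/
theorem orbs_layer_one_le_one {H : Subgroup (Perm α)} {B : Finset α}
    (hB : ∀ h ∈ H, ∀ b, h b ∈ B ↔ b ∈ B) (hfix : ∀ u, u ∉ B → ∃ h ∈ H, h u ≠ u)
    (h : orbs H (layer B 0 2) ≤ orbs H (layer B 0 1)) : orbs H (layer B 0 1) ≤ 1 := by
  by_contra! hlt
  let φ : Finset α → Set (Set (Finset α)) := fun S => {c | ∃ u ∈ S \ B, cls H {u} = c}
  have hφ : ∀ h ∈ H, ∀ S, φ (S.image h) = φ S := by
    intro h hh S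
    have e : ∀ u, cls H {h u} = cls H {u} := fun u => by
      rw [← cls_image hh {u}, image_singleton]
    ext c
    simp only [φ, Set.mem_ofPred_eq, image_sdiff_of_invariant (hB h hh), mem_image]
    constructor
    · rintro ⟨_, ⟨u, hu, rfl⟩, rfl⟩
      exact ⟨u, hu, (e u).symm⟩
    · rintro ⟨u, hu, rfl⟩
      exact ⟨h u, ⟨u, hu, rfl⟩, e u⟩
  have hpair : ∀ u v, u ∉ B → v ∉ B → u ≠ v →
      {u, v} ∈ layer B 0 2 ∧ φ {u, v} = {cls H {u}, cls H {v}} := by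
    intro u v hu hv huv
    have hd : Disjoint ({u, v} : Finset α) B := by
      rw [disjoint_left]
      intro z hz
      simp only [mem_insert, mem_singleton] at hz
      rcases hz with e | e <;> rwa [e]
    refine ⟨mem_layer_zero.2 ⟨hd, card_pair huv⟩, ?_⟩
    ext c
    simp only [φ, sdiff_eq_self_of_disjoint hd, Set.mem_ofPred_eq, mem_insert, mem_singleton,
      exists_eq_or_imp, exists_eq_left, Set.mem_insert_iff, Set.mem_singleton_iff,
      eq_comm (b := c)]
  obtain ⟨c, d, hc, hd, hcd⟩ := (Set.one_lt_ncard_iff (Set.toFinite _)).1 hlt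
  obtain ⟨S, hS, rfl⟩ := hc
  obtain ⟨T, hT, rfl⟩ := hd
  obtain ⟨hS, hS1⟩ := mem_layer_zero.1 hS
  obtain ⟨hT, hT1⟩ := mem_layer_zero.1 hT
  obtain ⟨u, rfl⟩ := card_eq_one.1 hS1
  obtain ⟨v, rfl⟩ := card_eq_one.1 hT1
  rw [disjoint_singleton_left] at hS hT
  have hsub : insert {cls H {u}, cls H {v}} ((fun c => {c}) '' (cls H '' layer B 0 1)) ⊆
      φ '' layer B 0 2 := by
    rintro _ (rfl | ⟨_, ⟨R, hR, rfl⟩, rfl⟩)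
    · obtain ⟨h1, h2⟩ := hpair u v hS hT (fun e => hcd (by rw [e]))
      exact ⟨_, h1, h2⟩
    · obtain ⟨hR, hR1⟩ := mem_layer_zero.1 hR
      obtain ⟨w, rfl⟩ := card_eq_one.1 hR1
      rw [disjoint_singleton_left] at hR
      obtain ⟨f, hf, hfw⟩ := hfix w hR
      obtain ⟨h1, h2⟩ := hpair (f w) w (fun h' => hR ((hB f hf w).1 h')) hR hfw
      refine ⟨_, h1, ?_⟩
      rw [h2, ← image_singleton, cls_image hf, Set.pair_eq_singleton]
  have h1 := (Set.ncard_le_ncard hsub (Set.toFinite _)).trans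
    (ncard_image_le_orbs (layer B 0 2) φ hφ)
  rw [Set.ncard_insert_of_notMem, Set.ncard_image_of_injective _ Set.singleton_injective] at h1
  · have : (cls H '' layer B 0 1).ncard = orbs H (layer B 0 1) := rfl
    omega
  · rintro ⟨c, -, hc⟩
    have h1 : cls H {u} ∈ ({c} : Set (Set (Finset α))) := by rw [show ({c} : Set _) = _ from hc]; simp
    have h2 : cls H {v} ∈ ({c} : Set (Set (Finset α))) := by rw [show ({c} : Set _) = _ from hc]; simp
    exact hcd ((Set.mem_singleton_iff.1 h1).trans (Set.mem_singleton_iff.1 h2).symm)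

theorem orbs_layer_one_one_le_two {H : Subgroup (Perm α)} {b b' u : α}
    (hB : ∀ h ∈ H, ∀ z, h z ∈ ({b, b'} : Finset α) ↔ z ∈ ({b, b'} : Finset α))
    (hu : u ∉ ({b, b'} : Finset α)) (h1 : orbs H (layer {b, b'} 0 1) ≤ 1) :
    cls H '' layer {b, b'} 1 1 ⊆ {cls H {b, u}, cls H {b', u}} := by
  rintro _ ⟨S, ⟨hS, hS'⟩, rfl⟩
  obtain ⟨β, hβ⟩ := card_eq_one.1 hS
  obtain ⟨w, hw⟩ := card_eq_one.1 hS'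
  have hSe : S = {β, w} := by
    rw [← sdiff_union_inter S {b, b'}, hβ, hw, union_comm]; rfl
  have hwB : w ∉ ({b, b'} : Finset α) :=
    (mem_sdiff.1 (show w ∈ S \ {b, b'} by rw [hw]; exact mem_singleton_self w)).2
  have hβB : β ∈ ({b, b'} : Finset α) :=
    (mem_inter.1 (show β ∈ S ∩ {b, b'} by rw [hβ]; exact mem_singleton_self β)).2
  have hl : ∀ z, z ∉ ({b, b'} : Finset α) → {z} ∈ layer {b, b'} 0 1 := fun z hz =>
    mem_layer_zero.2 ⟨disjoint_singleton_left.2 hz, card_singleton z⟩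
  obtain ⟨h, hh, e⟩ := (cls_eq_iff H _ _).1 (cls_eq_of_orbs_le_one h1 (hl w hwB) (hl u hu))
  rw [image_singleton, singleton_inj] at e
  rw [hSe, ← cls_image hh {β, w}, image_insert, image_singleton, e]
  have := (hB h hh β).2 hβB
  simp only [mem_insert, mem_singleton] at this
  rcases this with e | e <;> rw [e] <;> simp

/-- If `H` exchanges the two points of `B` and there are two orbits on the pairs `{β, u}`,
`β ∈ B`, `u ∉ B`, then these colour the points outside `B`, and an element that exchanges the points
of `B` exchanges the colours. The sets `{β, u, v}` carry three patterns of colours. -/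
theorem three_le_orbs_layer_one_two {H : Subgroup (Perm α)} {b b' : α}
    (hbb : b ≠ b') (hB : ∀ h ∈ H, ∀ z, h z ∈ ({b, b'} : Finset α) ↔ z ∈ ({b, b'} : Finset α))
    (hn : 3 ≤ #({b, b'} : Finset α)ᶜ) (h1 : orbs H (layer {b, b'} 0 1) ≤ 1)
    (h2 : 2 ≤ orbs H (layer {b, b'} 1 1)) {g : Perm α} (hg : g ∈ H) (hgb : g b = b') :
    3 ≤ orbs H (layer {b, b'} 1 2) := by
  set B : Finset α := {b, b'} with hBdef
  let χ : α → α → Set (Finset α) := fun β u => cls H {β, u}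
  have hχ : ∀ h ∈ H, ∀ β u, χ (h β) (h u) = χ β u := fun h hh β u => by
    simp only [χ]
    rw [← cls_image hh {β, u}, image_insert, image_singleton]
  have hgb' : g b' = b := by
    have := (hB g hg b').2 (by simp [hBdef])
    simp only [hBdef, mem_insert, mem_singleton] at this
    exact this.resolve_right fun h => hbb (g.injective (hgb.trans h.symm))
  let φ : Finset α → Set (Set (Finset α)) := fun S => {c | ∃ β ∈ S ∩ B, ∃ u ∈ S \ B, χ β u = c}
  have hφ : ∀ h ∈ H, ∀ S, φ (S.image h) = φ S := by
    intro h hh S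
    ext c
    simp only [φ, Set.mem_ofPred_eq, image_sdiff_of_invariant (hB h hh),
      image_inter_of_invariant (hB h hh), mem_image]
    constructor
    · rintro ⟨_, ⟨β, hβ, rfl⟩, _, ⟨u, hu, rfl⟩, rfl⟩
      exact ⟨β, hβ, u, hu, (hχ h hh β u).symm⟩
    · rintro ⟨β, hβ, u, hu, rfl⟩
      exact ⟨h β, ⟨β, hβ, rfl⟩, h u, ⟨u, hu, rfl⟩, hχ h hh β u⟩
  have htriple : ∀ β u v, β ∈ B → u ∉ B → v ∉ B → u ≠ v → {χ β u, χ β v} ∈ φ '' layer B 1 2 := by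
    intro β u v hβ hu hv huv
    have hd : Disjoint ({u, v} : Finset α) B := by
      rw [disjoint_left]
      intro z hz
      simp only [mem_insert, mem_singleton] at hz
      rcases hz with e | e <;> rwa [e]
    obtain ⟨e1, e2, e3⟩ := union_mem_layer (singleton_subset_iff.2 hβ) hd
    rw [card_pair huv, card_singleton] at e1
    refine ⟨_, e1, ?_⟩
    ext c
    simp only [φ, e2, e3, Set.mem_ofPred_eq, mem_insert, mem_singleton, exists_eq_or_imp,
      exists_eq_left, Set.mem_insert_iff, Set.mem_singleton_iff, eq_comm (b := c)]
  obtain ⟨u, hu⟩ := card_pos.1 (show 0 < #Bᶜ by omega)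
  have huB : u ∉ B := mem_compl.1 hu
  have hsub := orbs_layer_one_one_le_two hB huB h1
  have hval : ∀ β ∈ B, ∀ v, v ∉ B → χ β v = χ b u ∨ χ β v = χ b' u := by
    intro β hβ v hv
    obtain ⟨e1, -, -⟩ := union_mem_layer (singleton_subset_iff.2 hβ) (disjoint_singleton_left.2 hv)
    rw [card_singleton, card_singleton] at e1
    exact hsub ⟨_, e1, rfl⟩
  have hcu : χ b u ≠ χ b' u := by
    intro e
    have h3 := Set.ncard_le_ncard hsub (Set.toFinite _)
    rw [show cls H {b, u} = cls H {b', u} from e, Set.pair_eq_singleton, Set.ncard_singleton] at h3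
    exact absurd (h2.trans h3) (by norm_num)
  have hl : ∀ z, z ∉ B → {z} ∈ layer B 0 1 := fun z hz =>
    mem_layer_zero.2 ⟨disjoint_singleton_left.2 hz, card_singleton z⟩
  have hne : ∀ v, v ∉ B → χ b v ≠ χ b' v := by
    intro v hv e
    obtain ⟨h, hh, e'⟩ := (cls_eq_iff H _ _).1 (cls_eq_of_orbs_le_one h1 (hl v hv) (hl u huB))
    rw [image_singleton, singleton_inj] at e'
    rw [← hχ h hh b v, ← hχ h hh b' v, e'] at e
    have m1 := (hB h hh b).2 (by simp [hBdef])
    have m2 := (hB h hh b').2 (by simp [hBdef])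
    have m3 : h b ≠ h b' := h.injective.ne hbb
    simp only [hBdef, mem_insert, mem_singleton] at m1 m2
    rcases m1 with m1 | m1 <;> rcases m2 with m2 | m2 <;> rw [m1, m2] at e m3
    · exact m3 rfl
    · exact hcu e
    · exact hcu e.symm
    · exact m3 rfl
  have hgu : χ b (g u) = χ b' u := by rw [← hχ g hg b' u, hgb']
  have hguB : g u ∉ B := fun h' => huB ((hB g hg u).1 h')
  have hguu : u ≠ g u := fun e => hcu (by rw [← hgu, ← e])
  have hbB : b ∈ B := by simp [hBdef]
  have hbB' : b' ∈ B := by simp [hBdef]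
  -- two points outside `B` of the same colour
  obtain ⟨v, w, hv, hw, hvw, hχvw⟩ : ∃ v w, v ∉ B ∧ w ∉ B ∧ v ≠ w ∧ χ b v = χ b w := by
    obtain ⟨w, hw, hwu⟩ : ∃ w ∈ Bᶜ, w ∉ ({u, g u} : Finset α) := by
      by_contra! hc
      have := card_le_card (show Bᶜ ⊆ {u, g u} from hc)
      rw [card_pair hguu] at this
      omega
    rw [mem_compl] at hw
    simp only [mem_insert, mem_singleton, not_or] at hwu
    rcases hval b hbB w hw with e | e
    · exact ⟨w, u, hw, huB, hwu.1, e⟩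
    · exact ⟨w, g u, hw, hguB, hwu.2, e.trans hgu.symm⟩
  have hχvw' : χ b' v = χ b' w := by
    have i1 := hne v hv
    have i2 := hne w hw
    rcases hval b' hbB' v hv with e | e <;> rcases hval b' hbB' w hw with e' | e'
    · rw [e, e']
    · rcases hval b hbB v hv with e'' | e''
      · exact absurd (e''.trans e.symm) i1
      · exact absurd (hχvw.symm.trans (e''.trans e'.symm)) i2
    · rcases hval b hbB v hv with e'' | e''
      · exact absurd (hχvw.symm.trans (e''.trans e'.symm)) i2
      · exact absurd (e''.trans e.symm) i1
    · rw [e, e']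
  have t1 := htriple b v w hbB hv hw hvw
  have t2 := htriple b' v w hbB' hv hw hvw
  have t3 := htriple b u (g u) hbB huB hguB hguu
  rw [← hχvw, Set.pair_eq_singleton] at t1
  rw [← hχvw', Set.pair_eq_singleton] at t2
  rw [hgu] at t3
  refine le_trans ?_ (ncard_image_le_orbs (layer B 1 2) φ hφ)
  have h3 : ({{χ b v}, {χ b' v}, {χ b u, χ b' u}} : Set (Set (Set (Finset α)))).ncard = 3 := by
    have hns : ∀ c, ({c} : Set (Set (Finset α))) ≠ {χ b u, χ b' u} := by
      intro c hc
      have i1 : χ b u ∈ ({c} : Set (Set (Finset α))) := by rw [hc]; simp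
      have i2 : χ b' u ∈ ({c} : Set (Set (Finset α))) := by rw [hc]; simp
      exact hcu ((Set.mem_singleton_iff.1 i1).trans (Set.mem_singleton_iff.1 i2).symm)
    refine Set.ncard_eq_three.2 ⟨_, _, _, fun h => hne v hv (Set.singleton_injective h), hns _,
      hns _, rfl⟩
  rw [← h3]
  refine Set.ncard_le_ncard ?_ (Set.toFinite _)
  rintro _ (rfl | rfl | rfl) <;> assumption

theorem orbs_layer_two_le_one {H : Subgroup (Perm α)} {b b' : α}
    (hbb : b ≠ b') (hB : ∀ h ∈ H, ∀ z, h z ∈ ({b, b'} : Finset α) ↔ z ∈ ({b, b'} : Finset α))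
    (hn : 3 ≤ #({b, b'} : Finset α)ᶜ) (h1 : orbs H (layer {b, b'} 0 1) ≤ 1)
    (h2 : orbs H (layer {b, b'} 1 2) ≤ orbs H (layer {b, b'} 1 1)) :
    orbs H (layer {b, b'} 0 2) ≤ 1 := by
  obtain ⟨u, hu⟩ := card_pos.1 (show 0 < #({b, b'} : Finset α)ᶜ by omega)
  have hle2 : orbs H (layer {b, b'} 1 1) ≤ 2 :=
    (Set.ncard_le_ncard (orbs_layer_one_one_le_two hB (mem_compl.1 hu) h1) (Set.toFinite _)).trans
      (by have := Set.ncard_insert_le (cls H {b, u}) {cls H {b', u}}; rwa [Set.ncard_singleton] at this)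
  rcases Nat.lt_or_ge (orbs H (layer {b, b'} 1 1)) 2 with hlt | hge
  · refine le_trans (le_trans (Set.ncard_le_ncard ?_ (Set.toFinite _))
      (ncard_image_le_orbs (layer {b, b'} 1 2) (fun S => cls H (S \ {b, b'})) fun h hh S => ?_))
      (h2.trans (by omega))
    · rintro _ ⟨S, hS, rfl⟩
      obtain ⟨hS, hS2⟩ := mem_layer_zero.1 hS
      obtain ⟨e1, -, e3⟩ := union_mem_layer (T := {b}) (by simp) hS
      rw [hS2, card_singleton] at e1
      exact ⟨_, e1, by simp only [e3]⟩
    · simp only [image_sdiff_of_invariant (hB h hh), cls_image hh]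
  · by_cases hg : ∃ g ∈ H, g b = b'
    · obtain ⟨g, hg, hgb⟩ := hg
      have := three_le_orbs_layer_one_two hbb hB hn h1 hge hg hgb
      omega
    · -- `H` fixes both points of `B`
      push Not at hg
      have hfb : ∀ h ∈ H, h b = b := by
        intro h hh
        have := (hB h hh b).2 (by simp)
        simp only [mem_insert, mem_singleton] at this
        exact this.resolve_right (hg h hh)
      have hfb' : ∀ h ∈ H, h b' = b' := by
        intro h hh
        have := (hB h hh b').2 (by simp)
        simp only [mem_insert, mem_singleton] at this
        exact this.resolve_left fun e => hbb (h.injective ((hfb h hh).trans e.symm))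
      have h3 := ncard_image_le_orbs (layer {b, b'} 1 2)
        (fun S => (S ∩ {b, b'}, cls H (S \ {b, b'}))) (H := H) fun h hh S => by
          have e : (S ∩ {b, b'}).image h = S ∩ {b, b'} := by
            refine Eq.trans (image_congr fun z hz => ?_) image_id
            have := (mem_inter.1 hz).2
            simp only [mem_insert, mem_singleton] at this
            rcases this with e | e <;> rw [e]
            · exact hfb h hh
            · exact hfb' h hh
          simp only [image_sdiff_of_invariant (hB h hh), image_inter_of_invariant (hB h hh),
            cls_image hh, e]
      have h4 : (({{b}, {b'}} : Set (Finset α)) ×ˢ (cls H '' layer {b, b'} 0 2)).ncard ≤ _ :=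
        le_trans (Set.ncard_le_ncard (by
          rintro ⟨T, c⟩ ⟨hT, S, hS, rfl⟩
          obtain ⟨hS, hS2⟩ := mem_layer_zero.1 hS
          have hT' : T ⊆ {b, b'} ∧ #T = 1 := by
            rcases hT with e | e <;> rw [show T = _ from e] <;> simp
          obtain ⟨e1, e2, e3⟩ := union_mem_layer hT'.1 hS
          rw [hS2, hT'.2] at e1
          exact ⟨_, e1, by simp only [e2, e3]⟩) (Set.toFinite _)) h3
      rw [Set.ncard_prod, Set.ncard_pair (fun e => hbb (singleton_injective e))] at h4
      have : (cls H '' layer {b, b'} 0 2).ncard = orbs H (layer {b, b'} 0 2) := rfl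
      omega

end

/-! ### Consequences of constant orbit counts -/

section

variable {α : Type*} [DecidableEq α] [Fintype α]

/-- The orbits on `k`-sets are those that avoid the fixed point and those that contain it. Both
numbers are monotone in `k`, so that constant sums force constant terms. -/
theorem orbs_layer_zero_le_one_of_card_eq_one {H : Subgroup (Perm α)} {B : Finset α} {D : ℕ}
    (hD : 3 ≤ D) (hn : 2 * D ≤ #Bᶜ) (hB : ∀ h ∈ H, ∀ b, h b ∈ B ↔ b ∈ B) (hc : #B = 1)
    (hfix : ∀ u, u ∉ B → ∃ h ∈ H, h u ≠ u)
    (hO : ∀ k, 2 ≤ k → k ≤ D → OrbitCorollary.numOrbits H k = OrbitCorollary.numOrbits H 2)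
    {k : ℕ} (hk : k ≤ D) : orbs H (layer B 0 k) ≤ 1 := by
  have hsplit : ∀ k, OrbitCorollary.numOrbits H (k + 1) =
      orbs H (layer B 0 (k + 1)) + orbs H (layer B 0 k) := fun k => by
    rw [numOrbits_of_card_eq_one hB hc, ← orbs_layer_card hB k, hc]
  have hmono : ∀ k, k + 1 ≤ D → orbs H (layer B 0 k) ≤ orbs H (layer B 0 (k + 1)) :=
    fun k hk => orbs_layer_le_succ H B hB 0 k (by omega)
  have h2 : OrbitCorollary.numOrbits H 2 = orbs H (layer B 0 2) + orbs H (layer B 0 1) := hsplit 1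
  have h3 : OrbitCorollary.numOrbits H 3 = orbs H (layer B 0 3) + orbs H (layer B 0 2) := hsplit 2
  rw [hO 3 (by norm_num) hD, h2] at h3
  have hm1 : orbs H (layer B 0 1) ≤ orbs H (layer B 0 2) := hmono 1 (by omega)
  have hm2 : orbs H (layer B 0 2) ≤ orbs H (layer B 0 3) := hmono 2 (by omega)
  have h12 : orbs H (layer B 0 2) = orbs H (layer B 0 1) := by omega
  have h1 := orbs_layer_one_le_one hB hfix h12.le
  have hall : ∀ k, k + 1 ≤ D → orbs H (layer B 0 (k + 1)) = orbs H (layer B 0 1) := by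
    intro k
    induction k with
    | zero => exact fun _ => rfl
    | succ k ih =>
      intro hk
      have h4 := hsplit (k + 1)
      rw [hO (k + 1 + 1) (by omega) hk, h2, ih (by omega)] at h4
      omega
  cases k with
  | zero => exact (hmono 0 (by omega)).trans h1
  | succ k => rw [hall k hk]; exact h1

/-- The analogue for an invariant pair: the orbits on `k`-sets are divided into three families, with
monotone numbers. In the third one the number is `1` for `k = 2`, hence also for `k = 3`, which says
that `H` is transitive off the pair. -/
theorem orbs_layer_zero_le_one_of_card_eq_two {H : Subgroup (Perm α)} {B : Finset α} {D : ℕ}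
    (hD : 3 ≤ D) (hn : 2 * D ≤ #Bᶜ) (hB : ∀ h ∈ H, ∀ b, h b ∈ B ↔ b ∈ B) (hc : #B = 2)
    (hO : ∀ k, 2 ≤ k → k ≤ D → OrbitCorollary.numOrbits H k = OrbitCorollary.numOrbits H 2)
    {k : ℕ} (hk : k ≤ D) : orbs H (layer B 0 k) ≤ 1 := by
  have hsplit : ∀ k, OrbitCorollary.numOrbits H (k + 2) = orbs H (layer B 0 (k + 2)) +
      orbs H (layer B 1 (k + 1)) + orbs H (layer B 0 k) := fun k => by
    rw [numOrbits_of_card_eq_two hB hc, ← orbs_layer_card hB k, hc]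
  have hmono : ∀ j k l, l ≤ D → k ≤ l → orbs H (layer B j k) ≤ orbs H (layer B j l) := by
    intro j k l hl hkl
    induction l, hkl using Nat.le_induction with
    | base => exact le_rfl
    | succ l hkl ih =>
      exact (ih (by omega)).trans (orbs_layer_le_succ H B hB j l (by omega))
  have h0 : orbs H (layer B 0 0) ≤ 1 := by
    refine (Set.ncard_le_one (Set.toFinite _)).2 ?_
    rintro _ ⟨S, hS, rfl⟩ _ ⟨T, hT, rfl⟩
    rw [card_eq_zero.1 (mem_layer_zero.1 hS).2, card_eq_zero.1 (mem_layer_zero.1 hT).2]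
  have h2 := hsplit 0
  have h3 := hsplit 1
  rw [hO 3 (by norm_num) hD, h2] at h3
  have m1 := hmono 0 0 1 (by omega) (by omega)
  have m2 := hmono 0 2 3 (by omega) (by omega)
  have m3 := hmono 1 1 2 (by omega) (by omega)
  simp only [zero_add, Nat.reduceAdd] at h2 h3
  obtain ⟨b, b', hbb, rfl⟩ := card_eq_two.1 hc
  have ha2 := orbs_layer_two_le_one hbb hB (by omega) (by omega) (by omega)
  rcases k with _ | _ | k
  · exact h0
  · simp only [zero_add]
    omega
  · have h4 := hsplit k
    rw [hO (k + 2) (by omega) hk, h2] at h4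
    have m4 := hmono 1 1 (k + 1) (by omega) (by omega)
    have m5 := hmono 0 0 k (by omega) (by omega)
    show orbs H (layer {b, b'} 0 (k + 2)) ≤ 1
    omega

/-! ### The group induced off the invariant set -/

/-- The pairs of permutations of `B` and of its complement that together lie in `H`. -/
def blockPairs (H : Subgroup (Perm α)) (B : Finset α) :
    Subgroup (Perm {a // a ∈ B} × Perm {a // a ∉ B}) :=
  H.comap (Perm.subtypeCongrHom (fun a => a ∈ B))

theorem exists_subtypeCongrHom_eq {B : Finset α} {h : Perm α} (hB : ∀ b, h b ∈ B ↔ b ∈ B) :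
    ∃ p : Perm {a // a ∈ B} × Perm {a // a ∉ B},
      Perm.subtypeCongrHom (fun a => a ∈ B) p = h := by
  refine ⟨(h.subtypePerm hB, h.subtypePerm fun b => not_congr (hB b)), Equiv.ext fun x => ?_⟩
  by_cases hx : x ∈ B
  · simp [Perm.subtypeCongr.left_apply, hx]
  · simp [Perm.subtypeCongr.right_apply, hx]

theorem embed_blockPairs {H : Subgroup (Perm α)} {B : Finset α}
    (hB : ∀ h ∈ H, ∀ b, h b ∈ B ↔ b ∈ B) :
    OrbitCorollary.embed B (blockPairs H B) = H :=
  Subgroup.map_comap_eq_self fun h hh => exists_subtypeCongrHom_eq (hB h hh)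

theorem isHomogeneous_map_snd_blockPairs {H : Subgroup (Perm α)} {B : Finset α}
    (hB : ∀ h ∈ H, ∀ b, h b ∈ B ↔ b ∈ B) {k : ℕ} (h1 : orbs H (layer B 0 k) ≤ 1) :
    IsHomogeneous ((blockPairs H B).map (MonoidHom.snd _ _)) k := by
  intro S T hS hT
  have hl : ∀ S : Finset {a // a ∉ B}, #S = k →
      S.map (Function.Embedding.subtype _) ∈ layer B 0 k := by
    intro S hS
    refine mem_layer_zero.2 ⟨disjoint_left.2 fun z hz => ?_, by rw [card_map, hS]⟩
    obtain ⟨w, -, rfl⟩ := mem_map.1 hz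
    exact w.2
  obtain ⟨h, hh, e⟩ := (cls_eq_iff H _ _).1 (cls_eq_of_orbs_le_one h1 (hl S hS) (hl T hT))
  obtain ⟨p, rfl⟩ := exists_subtypeCongrHom_eq (hB h hh)
  refine ⟨p.2, ⟨p, hh, rfl⟩, fun x hx => ?_⟩
  have h2 : Perm.subtypeCongrHom (fun a => a ∈ B) p x ∈ T.map (Function.Embedding.subtype _) := by
    rw [← e]
    exact mem_image_of_mem _ (mem_map_of_mem _ hx)
  rw [Perm.subtypeCongrHom_apply, Perm.subtypeCongr.right_apply_subtype] at h2
  obtain ⟨w, hw, e'⟩ := mem_map.1 h2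
  rwa [← Subtype.ext e']

theorem IsHomogeneous.map_permCongr {β γ : Type*} [DecidableEq β] [DecidableEq γ]
    {K : Subgroup (Perm β)} {k : ℕ} (h : IsHomogeneous K k) (e : β ≃ γ) :
    IsHomogeneous (K.map e.permCongrHom.toMonoidHom) k := by
  intro S T hS hT
  obtain ⟨g, hg, hgS⟩ := h (S.map e.symm.toEmbedding) (T.map e.symm.toEmbedding)
    (by rw [card_map, hS]) (by rw [card_map, hT])
  refine ⟨_, ⟨g, hg, rfl⟩, fun x hx => ?_⟩
  have h1 := hgS (e.symm x) (mem_map_of_mem e.symm.toEmbedding hx)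
  rw [mem_map_equiv] at h1
  exact h1

theorem IsMultTransitive.isMultiplyPretransitive {G : Subgroup (Perm α)} {k : ℕ}
    (h : IsMultTransitive G k) : MulAction.IsMultiplyPretransitive G α k := by
  refine ⟨fun x y => ?_⟩
  obtain ⟨g, hg, hgl⟩ := h.exists_map_eq (List.ofFn x) (List.ofFn y)
    (List.nodup_ofFn.2 x.injective) (List.nodup_ofFn.2 y.injective) (by simp) (by simp)
  rw [List.map_ofFn] at hgl
  exact ⟨⟨g, hg⟩, Function.Embedding.ext fun i => congrFun (List.ofFn_injective hgl) i⟩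

theorem IsHomogeneous.numOrbits_eq_one {G : Subgroup (Perm α)} {k : ℕ} (h : IsHomogeneous G k)
    (hk : k ≤ Fintype.card α) : OrbitCorollary.numOrbits G k = 1 := by
  obtain ⟨S, -, hS⟩ := exists_superset_card (∅ : Finset α) (k := k) (by simp) hk
  rw [numOrbits_eq_orbs, orbs, Set.ncard_eq_one]
  refine ⟨cls G S, Set.eq_singleton_iff_unique_mem.2 ⟨⟨S, hS, rfl⟩, ?_⟩⟩
  rintro _ ⟨T, hT, rfl⟩
  obtain ⟨g, hg, hgT⟩ := h T S hT hS
  exact (cls_eq_iff G _ _).2 ⟨g, hg, image_eq_of_forall_mem hgT (by rw [hS, hT])⟩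

/-- Under a transitivity bound, homogeneous groups of the admissible degrees contain the alternating
group. The Livingstone-Wagner theorem supplies transitivity when `5 ≤ D`. -/
theorem alternatingGroup_le_of_isHomogeneous {n D : ℕ}
    (hD : OrbitCorollary.IsTransitivityBound n D) {γ : Type*} [DecidableEq γ] [Fintype γ]
    (h1 : n - 2 ≤ Fintype.card γ) (h2 : Fintype.card γ ≤ n) {K : Subgroup (Perm γ)}
    (hK : ∀ k ≤ D, IsHomogeneous K k) : alternatingGroup γ ≤ K := by
  have hlt := hD.lt_half
  have h3 := hD.three_le
  let e : γ ≃ Fin (Fintype.card γ) := Fintype.equivFin γ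
  have hK' : ∀ k ≤ D, IsHomogeneous (K.map e.permCongrHom.toMonoidHom) k := fun k hk =>
    (hK k hk).map_permCongr e
  have hor : K.map e.permCongrHom.toMonoidHom = alternatingGroup (Fin (Fintype.card γ)) ∨
      K.map e.permCongrHom.toMonoidHom = ⊤ := by
    rcases Nat.lt_or_ge 4 D with h4 | h4
    · refine hD.transitive _ h1 h2 _ (IsMultTransitive.isMultiplyPretransitive ?_)
      exact isMultTransitive_of_isHomogeneous h4.le (by rw [Fintype.card_fin]; omega)
        (by rw [Fintype.card_fin]; omega) fun i hi => hK' i (by omega)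
    · exact hD.homogeneous h4 _ h1 h2 _
        ((hK' D le_rfl).numOrbits_eq_one (by rw [Fintype.card_fin]; omega))
  intro τ hτ
  have hmem : e.permCongrHom.toMonoidHom τ ∈ K.map e.permCongrHom.toMonoidHom := by
    rcases hor with h | h <;> rw [h]
    · rw [Perm.mem_alternatingGroup] at hτ ⊢
      rw [← hτ]
      exact Perm.sign_permCongr e τ
    · exact Subgroup.mem_top _
  obtain ⟨σ, hσ, h⟩ := hmem
  rwa [← e.permCongrHom.injective h]

/-! ### Subgroups of a product that cover the alternating group of one factor -/

section Classification

variable {β γ : Type*} [DecidableEq β] [Fintype β] [DecidableEq γ] [Fintype γ]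

/-- The fourth power of a pair `(g, c)` with a 3-cycle `c` is `(1, c)`. -/
theorem bot_prod_alternatingGroup_le (hβ : Fintype.card β ≤ 2)
    {L : Subgroup (Perm β × Perm γ)}
    (hL : alternatingGroup γ ≤ L.map (MonoidHom.snd _ _)) :
    (⊥ : Subgroup (Perm β)).prod (alternatingGroup γ) ≤ L := by
  have h4 : ∀ g : Perm β, g ^ 4 = 1 := by
    intro g
    have hd : Nat.card (Perm β) ∣ 4 := by
      rw [Nat.card_perm, Nat.card_eq_fintype_card]
      interval_cases Fintype.card β <;> decide
    obtain ⟨c, hc⟩ := hd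
    rw [hc, pow_mul, pow_card_eq_one', one_pow]
  have h1 : alternatingGroup γ ≤ L.comap (MonoidHom.inr (Perm β) (Perm γ)) := by
    rw [← Perm.closure_three_cycles_eq_alternating, Subgroup.closure_le]
    intro c hc
    obtain ⟨p, hp, e⟩ := hL (Perm.IsThreeCycle.mem_alternatingGroup hc)
    have hpc : p ^ 4 = (1, c) := by
      refine Prod.ext (h4 p.1) ?_
      have hc3 : c ^ 3 = 1 := by rw [← Perm.IsThreeCycle.orderOf hc, pow_orderOf_eq_one]
      rw [Prod.pow_snd, show p.2 = c from e, pow_succ, hc3, one_mul]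
    show (1, c) ∈ L
    rw [← hpc]
    exact L.pow_mem hp 4
  rintro ⟨g, τ⟩ hgτ
  obtain ⟨hg, hτ⟩ := Subgroup.mem_prod.1 hgτ
  rw [show g = 1 from Subgroup.mem_bot.1 hg]
  exact h1 hτ

theorem eq_one_of_sign_eq_one (hβ : Fintype.card β ≤ 2) {g : Perm β} (hg : Perm.sign g = 1) :
    g = 1 := by
  by_contra hne
  have h1 := Perm.two_le_card_support_of_ne_one hne
  have h2 : #g.support ≤ 2 := (card_le_univ _).trans hβ
  have h3 : #g.support = 2 := le_antisymm h2 h1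
  rw [(Perm.card_support_eq_two.1 h3).sign_eq] at hg
  exact absurd hg (by decide)

/-- A subgroup that contains the alternating group of the second factor is determined by the pairs
of signs that occur in it, since the sign is injective on the first factor. -/
theorem mem_of_sign_eq (hβ : Fintype.card β ≤ 2) {L : Subgroup (Perm β × Perm γ)}
    (hL : (⊥ : Subgroup (Perm β)).prod (alternatingGroup γ) ≤ L) {p q : Perm β × Perm γ}
    (hq : q ∈ L) (h1 : Perm.sign p.1 = Perm.sign q.1) (h2 : Perm.sign p.2 = Perm.sign q.2) :
    p ∈ L := by
  have h3 : p * q⁻¹ ∈ L := hL (Subgroup.mem_prod.2 ⟨Subgroup.mem_bot.2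
    (eq_one_of_sign_eq_one hβ (by simp [h1])), by
      rw [Perm.mem_alternatingGroup]; simp [h2]⟩)
  simpa using L.mul_mem h3 hq

theorem classification_of_card_le_two (hβ : Fintype.card β ≤ 2) {L : Subgroup (Perm β × Perm γ)}
    (hL : (⊥ : Subgroup (Perm β)).prod (alternatingGroup γ) ≤ L) :
    L = (⊥ : Subgroup (Perm β)).prod (alternatingGroup γ) ∨
    L = (⊥ : Subgroup (Perm β)).prod ⊤ ∨
    L = (⊤ : Subgroup (Perm β)).prod ⊤ ∨
    L = ((Perm.sign : Perm β →* ℤˣ).comp (MonoidHom.fst (Perm β) (Perm γ))).eqLocus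
      ((Perm.sign : Perm γ →* ℤˣ).comp (MonoidHom.snd (Perm β) (Perm γ))) ∨
    L = (⊤ : Subgroup (Perm β)).prod (alternatingGroup γ) := by
  have key : ∀ p : Perm β × Perm γ,
      p ∈ L ↔ ∃ q ∈ L, Perm.sign p.1 = Perm.sign q.1 ∧ Perm.sign p.2 = Perm.sign q.2 :=
    fun p => ⟨fun h => ⟨p, h, rfl, rfl⟩, fun ⟨q, hq, h1, h2⟩ => mem_of_sign_eq hβ hL hq h1 h2⟩
  have hbot : ∀ g : Perm β, g ∈ (⊥ : Subgroup (Perm β)) ↔ Perm.sign g = 1 := fun g =>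
    ⟨fun h => by rw [Subgroup.mem_bot.1 h, map_one],
      fun h => Subgroup.mem_bot.2 (eq_one_of_sign_eq_one hβ h)⟩
  have hu : ∀ s : ℤˣ, s = 1 ∨ s = -1 := Int.units_eq_one_or
  -- which of the three nontrivial pairs of signs occur
  by_cases h1 : ∃ q ∈ L, Perm.sign q.1 = 1 ∧ Perm.sign q.2 = -1
  · obtain ⟨q1, hq1, s1, s1'⟩ := h1
    by_cases h2 : ∃ q ∈ L, Perm.sign q.1 = -1
    · obtain ⟨q2, hq2, s2⟩ := h2
      refine Or.inr (Or.inr (Or.inl (eq_top_iff.2 ?_ |>.trans Subgroup.top_prod_top.symm)))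
      intro p _
      rw [key]
      rcases hu (Perm.sign p.1) with e | e <;> rcases hu (Perm.sign p.2) with e' | e' <;>
        rcases hu (Perm.sign q2.2) with s2' | s2'
      · exact ⟨1, L.one_mem, by simp [e], by simp [e']⟩
      · exact ⟨1, L.one_mem, by simp [e], by simp [e']⟩
      · exact ⟨q1, hq1, by rw [e, s1], by rw [e', s1']⟩
      · exact ⟨q1, hq1, by rw [e, s1], by rw [e', s1']⟩
      · exact ⟨q2, hq2, by rw [e, s2], by rw [e', s2']⟩
      · exact ⟨q2 * q1, L.mul_mem hq2 hq1, by simp [e, s1, s2], by simp [e', s1', s2']⟩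
      · exact ⟨q2 * q1, L.mul_mem hq2 hq1, by simp [e, s1, s2], by simp [e', s1', s2']⟩
      · exact ⟨q2, hq2, by rw [e, s2], by rw [e', s2']⟩
    · refine Or.inr (Or.inl (Subgroup.ext fun p => ?_))
      rw [Subgroup.mem_prod, hbot]
      constructor
      · intro hp
        exact ⟨(hu _).resolve_right fun e => h2 ⟨p, hp, e⟩, Subgroup.mem_top _⟩
      · rintro ⟨e, -⟩
        rw [key]
        rcases hu (Perm.sign p.2) with e' | e'
        · exact ⟨1, L.one_mem, by simp [e], by simp [e']⟩
        · exact ⟨q1, hq1, by rw [e, s1], by rw [e', s1']⟩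
  · have hone : ∀ p ∈ L, Perm.sign p.1 = 1 → Perm.sign p.2 = 1 := fun p hp e =>
      (hu _).resolve_right fun e' => h1 ⟨p, hp, e, e'⟩
    by_cases h2 : ∃ q ∈ L, Perm.sign q.1 = -1
    · obtain ⟨q2, hq2, s2⟩ := h2
      have heq : ∀ p ∈ L, Perm.sign p.1 = -1 → Perm.sign p.2 = Perm.sign q2.2 := by
        intro p hp e
        have := hone (p * q2⁻¹) (L.mul_mem hp (L.inv_mem hq2)) (by simp [e, s2])
        rw [Prod.snd_mul, Prod.snd_inv, map_mul, map_inv, mul_inv_eq_one] at this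
        exact this
      rcases hu (Perm.sign q2.2) with s2' | s2'
      · refine Or.inr (Or.inr (Or.inr (Or.inr (Subgroup.ext fun p => ?_))))
        rw [Subgroup.mem_prod, Perm.mem_alternatingGroup]
        constructor
        · intro hp
          refine ⟨Subgroup.mem_top _, ?_⟩
          rcases hu (Perm.sign p.1) with e | e
          · exact hone p hp e
          · rw [heq p hp e, s2']
        · rintro ⟨-, e'⟩
          rw [key]
          rcases hu (Perm.sign p.1) with e | e
          · exact ⟨1, L.one_mem, by simp [e], by simp [e']⟩
          · exact ⟨q2, hq2, by rw [e, s2], by rw [e', s2']⟩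
      · refine Or.inr (Or.inr (Or.inr (Or.inl (Subgroup.ext fun p => ?_))))
        show p ∈ L ↔ Perm.sign p.1 = Perm.sign p.2
        constructor
        · intro hp
          rcases hu (Perm.sign p.1) with e | e
          · rw [e, hone p hp e]
          · rw [e, heq p hp e, s2']
        · intro h
          rw [key]
          rcases hu (Perm.sign p.1) with e | e
          · exact ⟨1, L.one_mem, by simp [e], by simp [← h, e]⟩
          · exact ⟨q2, hq2, by rw [e, s2], by rw [← h, e, s2']⟩
    · refine Or.inl (le_antisymm (fun p hp => ?_) hL)
      have e : Perm.sign p.1 = 1 := (hu _).resolve_right fun e => h2 ⟨p, hp, e⟩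
      rw [Subgroup.mem_prod, hbot, Perm.mem_alternatingGroup]
      exact ⟨e, hone p hp e⟩

end Classification

/-- The common conclusion of both parts of the theorem. -/
theorem classification_of_orbs_layer_le_one {D : ℕ}
    (hD : OrbitCorollary.IsTransitivityBound (Fintype.card α) D) {H : Subgroup (Perm α)}
    {B : Finset α} (hB : ∀ h ∈ H, ∀ b, h b ∈ B ↔ b ∈ B) (hc : #B ≤ 2)
    (h1 : ∀ k ≤ D, orbs H (layer B 0 k) ≤ 1) :
    H = OrbitCorollary.altCompl B ∨ H = OrbitCorollary.symCompl B ∨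
      H = OrbitCorollary.symProdSym B ∨ H = OrbitCorollary.symFiberSym B ∨
      H = OrbitCorollary.symProdAlt B := by
  have hcard : Fintype.card {a // a ∈ B} ≤ 2 := by rwa [Fintype.card_coe]
  have hcard' : Fintype.card {a // a ∉ B} = Fintype.card α - #B := by
    rw [Fintype.card_subtype_compl, Fintype.card_coe]
  have hL := bot_prod_alternatingGroup_le hcard
    (alternatingGroup_le_of_isHomogeneous hD (by omega) (by omega) fun k hk =>
      isHomogeneous_map_snd_blockPairs hB (h1 k hk))
  rw [← embed_blockPairs hB]
  rcases classification_of_card_le_two hcard hL with h | h | h | h | h <;> rw [h]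
  · exact Or.inl rfl
  · exact Or.inr (Or.inl rfl)
  · exact Or.inr (Or.inr (Or.inl rfl))
  · exact Or.inr (Or.inr (Or.inr (Or.inl rfl)))
  · exact Or.inr (Or.inr (Or.inr (Or.inr rfl)))

end

end LivingstoneWagner


theorem corollary3p2 (n D : ℕ) (hn : 8 ≤ n) (hD : OrbitCorollary.IsTransitivityBound n D)
    (H : Subgroup (Equiv.Perm (Fin n)))
    (hO : ∀ k : ℕ, 2 ≤ k → k ≤ D →
      OrbitCorollary.numOrbits H k = OrbitCorollary.numOrbits H 2) :
    (∀ x : Fin n, MulAction.fixedPoints H (Fin n) = {x} →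
      H = OrbitCorollary.altCompl {x} ∨ H = OrbitCorollary.symCompl {x}) ∧
    (∀ B : Finset (Fin n), B.card = 2 → (∀ h ∈ H, ∀ b ∈ B, h b ∈ B) →
      H = OrbitCorollary.altCompl B ∨
      H = OrbitCorollary.symCompl B ∨
      H = OrbitCorollary.symProdSym B ∨
      H = OrbitCorollary.symFiberSym B ∨
      H = OrbitCorollary.symProdAlt B) := by
  have hlt := hD.lt_half
  have hD' : OrbitCorollary.IsTransitivityBound (Fintype.card (Fin n)) D := by
    rwa [Fintype.card_fin]
  constructor
  · intro x hx
    have hxfix : ∀ h ∈ H, h x = x := fun h hh =>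
      (show x ∈ MulAction.fixedPoints H (Fin n) by rw [hx]; rfl) ⟨h, hh⟩
    have hB : ∀ h ∈ H, ∀ b, h b ∈ ({x} : Finset (Fin n)) ↔ b ∈ ({x} : Finset (Fin n)) := by
      intro h hh b
      rw [Finset.mem_singleton, Finset.mem_singleton]
      constructor
      · exact fun e => h.injective (e.trans (hxfix h hh).symm)
      · intro e; rw [e, hxfix h hh]
    have hcl := LivingstoneWagner.classification_of_orbs_layer_le_one hD' hB (by simp)
      fun k hk => LivingstoneWagner.orbs_layer_zero_le_one_of_card_eq_one hD.three_le
        (by rw [Finset.card_compl, Fintype.card_fin, Finset.card_singleton]; omega) hB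
        (Finset.card_singleton x) (by
          intro u hu
          by_contra! h
          refine hu (Finset.mem_singleton.2 ?_)
          have : u ∈ MulAction.fixedPoints H (Fin n) := fun g => h g g.2
          rwa [hx] at this) hO hk
    -- `{x}` has no nontrivial permutation, so that the five groups reduce to two
    have hsub : Subsingleton {a // a ∈ ({x} : Finset (Fin n))} :=
      ⟨fun a b => Subtype.ext ((Finset.mem_singleton.1 a.2).trans
        (Finset.mem_singleton.1 b.2).symm)⟩
    have htop : (⊤ : Subgroup (Equiv.Perm {a // a ∈ ({x} : Finset (Fin n))})) = ⊥ :=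
      Subsingleton.elim _ _
    have hfib : OrbitCorollary.symFiberSym ({x} : Finset (Fin n)) =
        OrbitCorollary.altCompl {x} := by
      unfold OrbitCorollary.symFiberSym OrbitCorollary.altCompl
      congr 1
      ext p
      rw [Subgroup.mem_prod, Equiv.Perm.mem_alternatingGroup, ← htop]
      have h1 : p.1 = 1 := Subsingleton.elim _ _
      change Equiv.Perm.sign p.1 = Equiv.Perm.sign p.2 ↔ _
      rw [h1, map_one]
      exact ⟨fun h => ⟨Subgroup.mem_top _, h.symm⟩, fun h => h.2.symm⟩
    rcases hcl with h | h | h | h | h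
    · exact Or.inl h
    · exact Or.inr h
    · rw [OrbitCorollary.symProdSym, htop] at h
      exact Or.inr h
    · exact Or.inl (h.trans hfib)
    · rw [OrbitCorollary.symProdAlt, htop] at h
      exact Or.inl h
  · intro B hc hB
    have hB' : ∀ h ∈ H, ∀ b, h b ∈ B ↔ b ∈ B := by
      intro h hh b
      refine ⟨fun hb => ?_, hB h hh b⟩
      have := hB h⁻¹ (H.inv_mem hh) _ hb
      rwa [LivingstoneWagner.inv_apply_self'] at this
    exact LivingstoneWagner.classification_of_orbs_layer_le_one hD' hB' hc.le fun k hk =>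
      LivingstoneWagner.orbs_layer_zero_le_one_of_card_eq_two hD.three_le
        (by rw [Finset.card_compl, Fintype.card_fin, hc]; omega) hB' hc hO hk
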